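/- **Setting.** Let $f$ be a probability density with domain $\mathcal X\subseteq\mathbb R^D$ (so $f=0$ off $\mathcal X$). A *mode* of $f$ is a strict local maximizer; $\mathcal M$ is the set of modes. A *local maximum* of $f$ is a connected set $M$ on which $f$ is constant and at whose boundary $f$ decays, i.e. $f=c$ on $M$ and every connected set properly containing $M$ contains a point where $f<c$. *Modal structure*: every local maximum of $f$ is a single point, which is a mode; $\mathcal M$ is finite; the modes have pairwise disjoint open neighbourhoods on which $f$ is twice differentiable; the Hessian of $f$ at every mode is negative definite. *Hölder continuity*: $|f(x)-f(x')|\le C_\alpha|x-x'|^\alpha$ for $x,x'\in\mathcal X$, where $0<\alpha\le1$. *Modal constants* of $f$ are numbers $\lambda_0,r_M,\check C,\hat C>0$ such that * for each $x_0\in\mathcal M$ there is $\lambda_{x_0}>\lambda_0$ such that the connected component $A_{x_0}$ of $\{f\ge\lambda_{x_0}\}$ containing $x_0$ satisfies $B(x_0,r_M)\subseteq A_{x_0}$ and $\check C|x_0-x|^2\le f(x_0)-f(x)\le\hat C|x_0-x|^2$ for all $x\in A_{x_0}$; * for any two distinct modes $x_0,x_0'$ there is a set $S$ that is met by every path from $x_0$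 to $x_0'$ and satisfies $\inf_{B(x_0,r_M)\cup B(x_0',r_M)}f>\sup_{S+B(0,r_M)}f$. If $\mathcal X=[0,1]$ and the $p$ highest modes are strictly higher than all others ($1\le p\le|\mathcal M|$), the *$p$-mode* of $f$ is the smallest of the $p$ highest modes. *Estimators.* For a sample $X=\{X_1,\dots,X_n\}$ let $r_k(x)=\inf\{r:|B(x,r)\cap X|\ge k\}$ (closed balls), and for $D=1$ let $f_k(x)=k/(2n\,r_k(x))$ and $\beta_k=100\log(1/\delta)\sqrt{\log n}/\sqrt k$. Let $G(\gamma)$ be the graph whose vertices are the $X_i$ with $f_k(X_i)\ge\gamma$, with an edge between $X_i$ and $X_j$ if $|X_i-X_j|\le\min\{r_k(X_i),r_k(X_j)\}$. The *$p$-mode estimator* visits the $X_i$ in descending order of $f_k$, starting from $\mathcal A=\emptyset$; at $X_i$, with $\lambda=f_k(X_i)$, it takes the connected component $A$ of $G(\lambda-\beta_k\lambda)$ containing $X_i$ and adds $A$ to $\mathcal A$ if $A$ is disjoint from all sets in $\mathcal A$; it stops as soon as $|\mathcal A|=p$. It returns $\hat x=\min\{\operatorname{argmax}_{x\in A}f_k(x):A\in\mathcal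 A\}$. The *mode estimator* returns $\hat x=\operatorname{argmin}_{x\in X}r_k(x)$. Ties may be broken in any way: the error events below are the events that some admissible output has the stated error. **Theorem.** 1. Every Hölder continuous density on $[0,1]$ with modal structure has modal constants. 2. For all $\lambda_0,r_M,\check C,\hat C,F,C_\alpha,\alpha$ and $g>0$ there are $C_1,C_2>0$, depending only on these numbers, such that the following holds for every density $f$ on $[0,1]$ with modal structure that is Hölder continuous with constants $C_\alpha,\alpha$, has modal constants $\lambda_0,r_M,\check C,\hat C$, and has $\|f\|_\infty=F$. Let $1\le p\le|\mathcal M|$, let $x_p$ be the $p$-mode of $f$, and suppose that every mode that is not among the $p$ highest ones is lower than each of these by at least $g$. Let $0<\delta\le1/2$, let $k\ge1$ be an integer with $$C_1\log n\,\log(1/\delta)^2\le k\le C_2\,\log(1/\delta)^{2/5}(\log n)^{1/5}n^{4/5},$$ and let $M>\sqrt{\|f\|_\infty/\check C}$. Then the $p$-mode estimator on $n$ i.i.d. observations from $f$ satisfies $$\mathbb P\left(|\hat x-x_p|\ge\frac{M\sqrt{\log(1/\delta)}\,(\log n)^{1/4}}{k^{1/4}}\right)\le\delta.$$ 3. Let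 $D\ge1$, let $\mathcal X\subseteq\mathbb R^D$ be compact or equal to $\mathbb R^D$, and let $f$ be a Hölder continuous density on $\mathcal X$ with modal structure and exactly one mode $x_0$. Let $\delta_0<1$. Then there is $N$, depending on $f$ and $\delta_0$, such that for all $n\ge N$ and all $0<\delta\le\delta_0$ (and, if $\mathcal X$ is not compact, $\log n\,\log(1/\delta)\le n^{4/(4+D)}$), the mode estimator with $k=\lceil n^{4/(4+D)}\rceil$ on $n$ i.i.d. observations from $f$ satisfies $$\mathbb P\left(|\hat x-x_0|\ge\frac{\sqrt{\log(1/\delta)}\,\log n}{n^{1/(4+D)}}\right)\le\delta.$$ -/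

import Mathlib

open Set MeasureTheory
open scoped NNReal ENNReal

noncomputable section

namespace ModeEst

/-! ### Densities and their modes -/

/-- `f` is a probability density (with respect to Lebesgue measure) on the domain `S`. -/
structure IsDensityOn {E : Type*} [MeasureSpace E] (f : E → ℝ) (S : Set E) : Prop where
  measurable : Measurable f
  nonneg : ∀ x, 0 ≤ f x
  eq_zero : ∀ x, x ∉ S → f x = 0
  lintegral_eq_one : ∫⁻ x, ENNReal.ofReal (f x) = 1

/-- The probability distribution with density `f`. -/
def law {E : Type*} [MeasureSpace E] (f : E → ℝ) : Measure E :=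
  volume.withDensity (fun x => ENNReal.ofReal (f x))

/-- The joint distribution of `n` i.i.d. observations with density `f`. -/
def sampleLaw {E : Type*} [MeasureSpace E] (f : E → ℝ) (n : ℕ) : Measure (Fin n → E) :=
  Measure.pi (fun _ => law f)

/-- The modes of `f`: the strict local maximizers. For a density that vanishes off its domain it
makes no difference whether neighbourhoods are taken in the domain `[0, 1]` or in `ℝ`. -/
def modes {E : Type*} [PseudoMetricSpace E] (f : E → ℝ) : Set E :=
  {x | ∃ ρ : ℝ, 0 < ρ ∧ ∀ y ∈ Metric.closedBall x ρ, y ≠ x → f y < f x}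

/-- A local maximum of `f` as a region: a connected set `M` on which `f` is constant, and at whose
boundary `f` decays, in the sense that `M` cannot be enlarged to a connected set without meeting
smaller values of `f` (so `M` is a connected component of a superlevel set of `f`). -/
def IsLocalMaxRegion {E : Type*} [TopologicalSpace E] (f : E → ℝ) (M : Set E) : Prop :=
  IsConnected M ∧ ∃ c : ℝ, (∀ x ∈ M, f x = c) ∧
    ∀ N : Set E, IsConnected N → M ⊂ N → ∃ y ∈ N, f y < c

/-- The modal structure assumption: every local maximum is a point (a mode), there are finitely
many modes, and the modes have pairwise disjoint neighbourhoods on which `f` is twice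
differentiable, with negative definite Hessian at the mode. -/
structure ModalStructure {E : Type*} [NormedAddCommGroup E] [NormedSpace ℝ E]
    (f : E → ℝ) : Prop where
  region_is_point : ∀ M : Set E, IsLocalMaxRegion f M → ∃ x ∈ modes f, M = {x}
  finite : (modes f).Finite
  smooth : ∃ U : E → Set E,
    (∀ x ∈ modes f, IsOpen (U x) ∧ x ∈ U x ∧
      ∀ y ∈ U x, DifferentiableAt ℝ f y ∧ DifferentiableAt ℝ (fderiv ℝ f) y) ∧
    (modes f).PairwiseDisjoint U
  hessian_neg : ∀ x ∈ modes f, ∀ v : E, v ≠ 0 → fderiv ℝ (fderiv ℝ f) x v v < 0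

/-- `lam₀, rM, Cl, Cu` (in the usual notation `λ₀, r_M, Č, Ĉ`) are modal constants of `f`:
quadratic decay around every mode on a component of a superlevel set of height more than `lam₀`
that contains the ball of radius `rM`, and separation of any two modes by a set `S` whose
`rM`-neighbourhood has smaller density than the `rM`-balls around the two modes. -/
structure ModalConstants {E : Type*} [NormedAddCommGroup E]
    (f : E → ℝ) (lam₀ rM Cl Cu : ℝ) : Prop where
  lam₀_pos : 0 < lam₀
  rM_pos : 0 < rM
  Cl_pos : 0 < Cl
  Cu_pos : 0 < Cu
  quadratic : ∀ x₀ ∈ modes f, ∃ lam : ℝ, lam₀ < lam ∧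
    Metric.closedBall x₀ rM ⊆ connectedComponentIn {x | lam ≤ f x} x₀ ∧
    ∀ x ∈ connectedComponentIn {x | lam ≤ f x} x₀,
      Cl * ‖x₀ - x‖ ^ 2 ≤ f x₀ - f x ∧ f x₀ - f x ≤ Cu * ‖x₀ - x‖ ^ 2
  separated : ∀ x₀ ∈ modes f, ∀ x₁ ∈ modes f, x₀ ≠ x₁ → ∃ S : Set E,
    (∀ γ : Path x₀ x₁, ∃ t, γ t ∈ S) ∧
    ∃ a b : ℝ, a < b ∧
      (∀ s ∈ S, ∀ x ∈ Metric.closedBall s rM, f x ≤ a) ∧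
      (∀ x ∈ Metric.closedBall x₀ rM ∪ Metric.closedBall x₁ rM, b ≤ f x)

/-- `T` is the set of the `min p ℓ` highest modes of `f`, where `ℓ` is the number of modes; in
particular every mode outside `T` is strictly lower than every mode in `T`. -/
def IsTopModes {E : Type*} [PseudoMetricSpace E] (f : E → ℝ) (p : ℕ) (T : Set E) : Prop :=
  T ⊆ modes f ∧ T.ncard = min p (modes f).ncard ∧
    ∀ m ∈ T, ∀ m' ∈ modes f \ T, f m' < f m

/-- `x` is the `p`-mode of `f`: the smallest of its `p` highest modes. -/
def IsPMode (f : ℝ → ℝ) (p : ℕ) (x : ℝ) : Prop :=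
  ∃ T, IsTopModes f p T ∧ IsLeast T x

/-- The `(p+1)`-st highest mode (if there is one) lies at least `g` below the `p`-th one. -/
def HasModeGap (f : ℝ → ℝ) (p : ℕ) (g : ℝ) : Prop :=
  ∀ T, IsTopModes f p T → ∀ m ∈ T, ∀ m' ∈ modes f \ T, f m' + g ≤ f m

/-! ### The estimators -/

/-- The `k`-nearest-neighbour radius `r_k(x) = inf {r : |B(x, r) ∩ X| ≥ k}`. -/
def knnRadius {E : Type*} [PseudoMetricSpace E] {n : ℕ} (X : Fin n → E) (k : ℕ) (x : E) : ℝ :=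
  sInf {r : ℝ | k ≤ {i | X i ∈ Metric.closedBall x r}.ncard}

/-- The `k`-NN mode estimate: `xhat` is a sample point that minimizes `r_k` (with any tie
breaking). -/
def IsModeEstimate {E : Type*} [PseudoMetricSpace E] {n : ℕ} (k : ℕ) (X : Fin n → E)
    (xhat : E) : Prop :=
  ∃ i, xhat = X i ∧ ∀ j, knnRadius X k (X i) ≤ knnRadius X k (X j)

/-- The `k`-NN density estimate on the line, `f_k(x) = k / (2 n r_k(x))`. -/
def knnDensity {n : ℕ} (X : Fin n → ℝ) (k : ℕ) (x : ℝ) : ℝ :=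
  k / (2 * n * knnRadius X k x)

/-- The graph `G(γ)` on the sample points with `f_k ≥ γ`; indices of the other sample points are
isolated. -/
def knnGraph {n : ℕ} (X : Fin n → ℝ) (k : ℕ) (γ : ℝ) : SimpleGraph (Fin n) where
  Adj i j := i ≠ j ∧ γ ≤ knnDensity X k (X i) ∧ γ ≤ knnDensity X k (X j) ∧
    |X i - X j| ≤ min (knnRadius X k (X i)) (knnRadius X k (X j))
  symm := ⟨fun i j h => ⟨h.1.symm, h.2.2.1, h.2.1, by rw [abs_sub_comm, min_comm]; exact h.2.2.2⟩⟩
  loopless := ⟨fun _ h => h.1 rfl⟩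

/-- `β_k = 100 log(1/δ) √(log n) / √k`. -/
def beta (n k : ℕ) (δ : ℝ) : ℝ :=
  100 * Real.log (1 / δ) * √(Real.log n) / √k

/-- With `lam = f_k(X_i)`, the connected component of `G(lam - β_k lam)` that contains `X_i`. -/
def cluster {n : ℕ} (k : ℕ) (δ : ℝ) (X : Fin n → ℝ) (i : Fin n) : Set (Fin n) :=
  {j | (knnGraph X k (knnDensity X k (X i) - beta n k δ * knnDensity X k (X i))).Reachable i j}

open Classical in
/-- One pass of the loop: nothing happens once `p` clusters have been found; otherwise the cluster
of `X_i` is added if it is disjoint from all the clusters found before. -/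
def clusterStep {n : ℕ} (p k : ℕ) (δ : ℝ) (X : Fin n → ℝ) (𝒜 : List (Set (Fin n)))
    (i : Fin n) : List (Set (Fin n)) :=
  if 𝒜.length = p then 𝒜
  else if ∀ B ∈ 𝒜, Disjoint (cluster k δ X i) B then cluster k δ X i :: 𝒜
  else 𝒜

/-- The clusters found when the sample points are visited in the order of the list `l`. -/
def clusters {n : ℕ} (p k : ℕ) (δ : ℝ) (X : Fin n → ℝ) (l : List (Fin n)) :
    List (Set (Fin n)) :=
  l.foldl (clusterStep p k δ X) []

/-- `xhat` is an output of the `p`-mode algorithm: the sample points are visited in descending order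
of `f_k`, and `xhat` is the smallest of the maximizers of `f_k` over the clusters that were found.
Any order among ties and any choice of the maximizers is allowed. -/
def IsPModeEstimate {n : ℕ} (p k : ℕ) (δ : ℝ) (X : Fin n → ℝ) (xhat : ℝ) : Prop :=
  ∃ l : List (Fin n), l.Nodup ∧ (∀ i, i ∈ l) ∧
    l.Pairwise (fun i j => knnDensity X k (X j) ≤ knnDensity X k (X i)) ∧
    ∃ c : Set (Fin n) → Fin n,
      (∀ A ∈ clusters p k δ X l,
        c A ∈ A ∧ ∀ j ∈ A, knnDensity X k (X j) ≤ knnDensity X k (X (c A))) ∧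
      IsLeast {x | ∃ A ∈ clusters p k δ X l, x = X (c A)} xhat

/-! ### The two estimators always have an output -/

theorem exists_isModeEstimate {E : Type*} [PseudoMetricSpace E] {n : ℕ} (hn : 0 < n) (k : ℕ)
    (X : Fin n → E) : ∃ xhat, IsModeEstimate k X xhat := by
  have : Nonempty (Fin n) := ⟨⟨0, hn⟩⟩
  obtain ⟨i, hi⟩ := Finite.exists_min (fun i => knnRadius X k (X i))
  exact ⟨X i, i, rfl, hi⟩

theorem foldl_clusterStep {n : ℕ} (p k : ℕ) (δ : ℝ) (X : Fin n → ℝ) (l : List (Fin n)) :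
    ∀ 𝒜 : List (Set (Fin n)), (∀ A ∈ 𝒜, A.Nonempty) →
      (∀ A ∈ l.foldl (clusterStep p k δ X) 𝒜, A.Nonempty) ∧
      (𝒜 ≠ [] → l.foldl (clusterStep p k δ X) 𝒜 ≠ []) := by
  induction l with
  | nil => intro 𝒜 h; exact ⟨h, id⟩
  | cons i l ih =>
    intro 𝒜 h
    have hs : (∀ A ∈ clusterStep p k δ X 𝒜 i, A.Nonempty) ∧
        (𝒜 ≠ [] → clusterStep p k δ X 𝒜 i ≠ []) := by
      unfold clusterStep
      split_ifs
      · exact ⟨h, id⟩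
      · refine ⟨fun A hA => ?_, fun _ => List.cons_ne_nil _ _⟩
        rcases List.mem_cons.1 hA with rfl | hA
        · exact ⟨i, SimpleGraph.Reachable.refl _⟩
        · exact h A hA
      · exact ⟨h, id⟩
    obtain ⟨h1, h2⟩ := ih _ hs.1
    exact ⟨h1, fun hne => h2 (hs.2 hne)⟩

theorem exists_isPModeEstimate {n : ℕ} (hn : 0 < n) {p : ℕ} (hp : 1 ≤ p) (k : ℕ) (δ : ℝ)
    (X : Fin n → ℝ) : ∃ xhat, IsPModeEstimate p k δ X xhat := by
  classical
  let r : Fin n → Fin n → Prop := fun i j => knnDensity X k (X j) ≤ knnDensity X k (X i)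
  have : Std.Total r := ⟨fun i j => le_total _ _⟩
  have : IsTrans (Fin n) r := ⟨fun i j m h1 h2 => le_trans h2 h1⟩
  let l := (List.finRange n).insertionSort r
  have hperm : l.Perm (List.finRange n) := List.perm_insertionSort r _
  have hmem : ∀ i, i ∈ l := fun i => hperm.mem_iff.2 (List.mem_finRange i)
  have hne : ∀ A ∈ clusters p k δ X l, A.Nonempty :=
    (foldl_clusterStep p k δ X l [] (by simp)).1
  have hnil : clusters p k δ X l ≠ [] := by
    have h0 := hmem ⟨0, hn⟩
    unfold clusters
    cases hl : l with
    | nil => rw [hl] at h0; simp at h0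
    | cons i t =>
      have hst : clusterStep p k δ X [] i = [cluster k δ X i] := by
        have : p ≠ 0 := by omega
        simp [clusterStep, this.symm]
      rw [List.foldl_cons, hst]
      refine (foldl_clusterStep p k δ X t [cluster k δ X i] ?_).2 (by simp)
      intro A hA
      rw [List.mem_singleton] at hA
      subst hA
      exact ⟨i, SimpleGraph.Reachable.refl _⟩
  have hch : ∀ A : Set (Fin n), ∃ i : Fin n, A ∈ clusters p k δ X l →
      i ∈ A ∧ ∀ j ∈ A, knnDensity X k (X j) ≤ knnDensity X k (X i) := by
    intro A
    by_cases hA : A ∈ clusters p k δ X l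
    · obtain ⟨i, hi, hi'⟩ := Set.exists_max_image A (fun i => knnDensity X k (X i))
        (Set.toFinite A) (hne A hA)
      exact ⟨i, fun _ => ⟨hi, hi'⟩⟩
    · exact ⟨⟨0, hn⟩, fun h => absurd h hA⟩
  choose c hc using hch
  have hfin : {x | ∃ A ∈ clusters p k δ X l, x = X (c A)}.Finite :=
    (Set.finite_range X).subset (by rintro x ⟨A, _, rfl⟩; exact ⟨_, rfl⟩)
  have hnon : {x | ∃ A ∈ clusters p k δ X l, x = X (c A)}.Nonempty := by
    obtain ⟨A, hA⟩ := List.exists_mem_of_ne_nil _ hnil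
    exact ⟨_, A, hA, rfl⟩
  obtain ⟨x, hx, hx'⟩ := Set.exists_min_image _ id hfin hnon
  exact ⟨x, l, hperm.nodup_iff.2 (List.nodup_finRange n), hmem,
    List.pairwise_insertionSort r _, c, hc, hx, hx'⟩

end ModeEst

end

/-!
All three parts compare the mass that the density gives to small balls near a mode with the mass it
gives to small balls away from it. Near a mode `z` the density decreases quadratically, so at
distance `h` the two masses differ by a relative amount of order `h ^ 2`, and the counts of sample
points must be known with this precision.

**Modal constants.** Taylor's formula with the negative definite Hessian gives the two quadratic
bounds near each of the finitely many modes. On the line, the component of a superlevel set whose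
level is just below `f z` is confined to a short interval around `z`. Between two distinct modes
there is a valley, that is a point where the density is lower than at both; by continuity a
neighbourhood of it separates small balls around the modes (`exists_modalConstants`).

**The single mode.** A Hölder continuous density that has only one mode attains its maximum there,
and nowhere else, since every global maximizer is a mode. By
compactness of the superlevel sets it then decays quadratically near the mode and stays away from
the maximum elsewhere (`exists_global_quadratic`). For the right radius `r`, balls of radius `r`
around points close to `x₀` have more than `k` expected observations and those around points at
distance at least `h` have fewer. Conditionally on its centre, the number of the other observations
in a ball around an observation is binomial, so Chernoff's bound and a union bound over the
observations suffice (`pi_modeEstimate_le`).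

**The `p`-mode: deterministic part.** Let `w` be defined by `w ^ 4 * k = log (1 / δ) ^ 2 * log n`.
Then `beta n k δ = 100 * w ^ 2`, and the error bound is a multiple of `w`, greater than `b * w` with
`b = √(F / Cl)`. Call a sample regular if the counts of intervals have error at most `8 * w ^ 2 * k`
(`RegularSample`). On a regular sample every observation with a high estimate is connected to the
observations in the core of a mode that is essentially as high (`RegularSample.exists_home`): climb
from the highest point of its nearest-neighbour ball to a mode; the estimate hardly decreases on the
way. Conversely the graph cannot leave the neighbourhood of a mode at a level close to its height
(`RegularSample.confined`). Hence the `p` clusters found by the algorithm belong to the `p` highest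
modes (`clusters_spec`), and only the position of the maximum of the estimate in the cluster of `xp`
is left. It is within `b * w` of `xp` if some radius gives `k` observations in a ball around a point
in the core, but in no such ball around an observation in the shell `b * w ≤ |x - xp| ≤ 13 * (b * w)`
(`SharpAt`, `RegularSample.abs_sub_lt_of_isPModeEstimate`).

**The `p`-mode: probabilistic part.** Only `b > 0` with `Cl * b ^ 2 = F` is available, so the gap
between the expected counts in the core and in the shell is about `w ^ 2 * k` and cannot be enlarged
by a constant factor. A union bound over a grid of intervals (`sampleLaw_not_unifDev_le`) shows that
all counts have relative error `w ^ 2 / 10` if `log (1 / δ) ≥ 100`, and then the sample is sharp. If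
`δ` is larger, such a uniform bound cannot be expected: the logarithm of the number of windows is of the same
order as the exponent in the tail bound. Instead, fluctuations help. The core contains a number of
disjoint windows that is comparable to the number of grid points in the shell. Their counts are
negatively correlated (`pi_le_cnt_inter_le`), so by the second moment method
(`measure_iInter_compl_le`) one of them is exceptionally large, at a threshold where the expected
number of such windows is large. At almost the same threshold the tail of a binomial variable whose
success probability is smaller by the relative amount `8 / 10 * w ^ 2` is smaller by an exponential
factor (`binTail_compare`), so no window in the shell gets that far (`exists_binTail_separation`,
`sampleLaw_not_sharpAt_le`). The error probability obtained in this way tends to zero with `n`, and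
so is eventually less than `exp (-100)`. Large `C₁` makes `w` small; small `C₂` makes `k / n` small
compared with `w` and `n` large.
-/

namespace ModeEst

/-! ### Binomial tails -/

/-- The probability that a binomial variable with parameters `n` and `q` is at least `T`, given by
conditioning on the first trial. -/
noncomputable def binTail : ℕ → ℝ → ℕ → ℝ
  | _, _, 0 => 1
  | 0, _, _ + 1 => 0
  | n + 1, q, T + 1 => q * binTail n q T + (1 - q) * binTail n q (T + 1)

@[simp] theorem binTail_zero_right (n : ℕ) (q : ℝ) : binTail n q 0 = 1 := by
  cases n <;> rfl

@[simp] theorem binTail_zero_succ (q : ℝ) (T : ℕ) : binTail 0 q (T + 1) = 0 := rfl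

theorem binTail_succ_succ (n : ℕ) (q : ℝ) (T : ℕ) :
    binTail (n + 1) q (T + 1) = q * binTail n q T + (1 - q) * binTail n q (T + 1) := rfl

theorem binTail_nonneg {q : ℝ} (h0 : 0 ≤ q) (h1 : q ≤ 1) : ∀ n T, 0 ≤ binTail n q T
  | _, 0 => by simp
  | 0, _ + 1 => by simp
  | n + 1, T + 1 => by
    have := binTail_nonneg h0 h1 n T
    have := binTail_nonneg h0 h1 n (T + 1)
    have : 0 ≤ 1 - q := by linarith
    rw [binTail_succ_succ]; positivity

theorem binTail_le_one {q : ℝ} (h0 : 0 ≤ q) (h1 : q ≤ 1) : ∀ n T, binTail n q T ≤ 1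
  | _, 0 => by simp
  | 0, _ + 1 => by simp
  | n + 1, T + 1 => by
    have := binTail_le_one h0 h1 n T
    have := binTail_le_one h0 h1 n (T + 1)
    rw [binTail_succ_succ]; nlinarith

/-- The recursion of Pascal's triangle: the increments of `binTail` are the binomial probabilities.
-/
theorem binTail_sub_succ (q : ℝ) : ∀ n T,
    binTail n q T - binTail n q (T + 1) = n.choose T * q ^ T * (1 - q) ^ (n - T)
  | 0, 0 => by simp
  | 0, T + 1 => by simp
  | n + 1, 0 => by
    have := binTail_sub_succ q n 0
    simp only [binTail_zero_right, Nat.choose_zero_right, Nat.cast_one, pow_zero,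
      Nat.sub_zero] at this
    rw [binTail_succ_succ]
    simp only [binTail_zero_right, Nat.choose_zero_right, Nat.cast_one, pow_zero, Nat.sub_zero,
      pow_succ]
    linear_combination (1 - q) * this
  | n + 1, T + 1 => by
    have h1 := binTail_sub_succ q n T
    have h2 := binTail_sub_succ q n (T + 1)
    rw [binTail_succ_succ, binTail_succ_succ, Nat.choose_succ_succ, Nat.add_sub_add_right]
    push_cast
    have h3 : (n.choose (T + 1) : ℝ) * (1 - q) ^ (n - T)
        = n.choose (T + 1) * ((1 - q) * (1 - q) ^ (n - (T + 1))) := by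
      rcases Nat.lt_or_ge n (T + 1) with h | h
      · simp [Nat.choose_eq_zero_of_lt h]
      · rw [← pow_succ', show n - (T + 1) + 1 = n - T by omega]
    rw [pow_succ]
    linear_combination q * h1 + (1 - q) * h2 - q ^ T * q * h3

theorem binTail_succ_le {q : ℝ} (h0 : 0 ≤ q) (h1 : q ≤ 1) (n T : ℕ) :
    binTail n q (T + 1) ≤ binTail n q T := by
  have := binTail_sub_succ q n T
  have h2 : 0 ≤ 1 - q := by linarith
  have : 0 ≤ binTail n q T - binTail n q (T + 1) := by rw [this]; positivity
  linarith

theorem binTail_mono {q q' : ℝ} (h0 : 0 ≤ q) (h : q ≤ q') (h1 : q' ≤ 1) :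
    ∀ n T, binTail n q T ≤ binTail n q' T
  | _, 0 => by simp
  | 0, _ + 1 => by simp
  | n + 1, T + 1 => by
    have h2 := binTail_mono h0 h h1 n T
    have h3 := binTail_mono h0 h h1 n (T + 1)
    have h4 := binTail_succ_le h0 (h.trans h1) n T
    rw [binTail_succ_succ, binTail_succ_succ]
    nlinarith

theorem binTail_eq_zero (q : ℝ) : ∀ n T, n < T → binTail n q T = 0
  | _, 0, h => by omega
  | 0, _ + 1, _ => rfl
  | n + 1, T + 1, h => by
    rw [binTail_succ_succ, binTail_eq_zero q n T (by omega),
      binTail_eq_zero q n (T + 1) (by omega)]; simp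

theorem continuous_binTail : ∀ n T, Continuous fun q => binTail n q T
  | _, 0 => by simpa using continuous_const
  | 0, _ + 1 => by simpa using continuous_const
  | n + 1, T + 1 => by
    have h1 := continuous_binTail n T
    have h2 := continuous_binTail n (T + 1)
    simp only [binTail_succ_succ]
    fun_prop

/-- The exponential Markov inequality for the upper tail. -/
theorem binTail_le_mgf {q : ℝ} (h0 : 0 ≤ q) (h1 : q ≤ 1) {t : ℝ} (ht : 0 ≤ t) :
    ∀ n T, binTail n q T ≤ Real.exp (-(t * T)) * (1 + (Real.exp t - 1) * q) ^ n
  | n, 0 => by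
    have : 1 ≤ Real.exp t := Real.one_le_exp ht
    simpa using one_le_pow₀ (n := n) (show 1 ≤ 1 + (Real.exp t - 1) * q by nlinarith)
  | 0, _ + 1 => by simp [Real.exp_nonneg]
  | n + 1, T + 1 => by
    have h2 := binTail_le_mgf h0 h1 ht n T
    have h3 := binTail_le_mgf h0 h1 ht n (T + 1)
    have h4 : Real.exp (-(t * T)) = Real.exp (-(t * (T + 1 : ℕ))) * Real.exp t := by
      rw [← Real.exp_add]; push_cast; ring_nf
    rw [h4] at h2
    rw [binTail_succ_succ, pow_succ]
    have := mul_le_mul_of_nonneg_left h2 h0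
    have := mul_le_mul_of_nonneg_left h3 (sub_nonneg.2 h1)
    linarith

/-- The exponential Markov inequality for the lower tail. -/
theorem one_sub_binTail_le_mgf {q : ℝ} (h0 : 0 ≤ q) (h1 : q ≤ 1) {t : ℝ} (ht : 0 ≤ t) :
    ∀ n T, 1 - binTail n q T ≤ Real.exp (t * T) * (1 - (1 - Real.exp (-t)) * q) ^ n
  | n, 0 => by
    have : 0 ≤ Real.exp (-t) := (Real.exp_pos _).le
    have : 0 ≤ 1 - (1 - Real.exp (-t)) * q := by nlinarith
    simpa using pow_nonneg this n
  | 0, T + 1 => by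
    simpa using mul_nonneg ht (by positivity : (0 : ℝ) ≤ T + 1)
  | n + 1, T + 1 => by
    have h2 := one_sub_binTail_le_mgf h0 h1 ht n T
    have h3 := one_sub_binTail_le_mgf h0 h1 ht n (T + 1)
    have h4 : Real.exp (t * T) = Real.exp (t * (T + 1 : ℕ)) * Real.exp (-t) := by
      rw [← Real.exp_add]; push_cast; ring_nf
    rw [h4] at h2
    rw [binTail_succ_succ, pow_succ]
    have := mul_le_mul_of_nonneg_left h2 h0
    have := mul_le_mul_of_nonneg_left h3 (sub_nonneg.2 h1)
    linarith

/-- Chernoff's bound for the upper tail. -/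
theorem binTail_le_exp {q m s : ℝ} {n T : ℕ} (h0 : 0 ≤ q) (h1 : q ≤ 1) (hm : 0 < m)
    (hq : n * q ≤ m) (hs : 0 ≤ s) (hsm : s ≤ 2 * m) (hT : n * q + s ≤ T) :
    binTail n q T ≤ Real.exp (-(s ^ 2 / (4 * m))) := by
  set t := s / (2 * m) with ht
  have ht0 : 0 ≤ t := by positivity
  have ht1 : t ≤ 1 := by rw [ht, div_le_one (by positivity)]; exact hsm
  have hexp : Real.exp t - 1 ≤ t + t ^ 2 := by
    have := (abs_le.1 (Real.abs_exp_sub_one_sub_id_le (x := t) (by rwa [abs_of_nonneg ht0]))).2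
    linarith
  have hexp0 : 0 ≤ Real.exp t - 1 := by linarith [Real.one_le_exp ht0]
  have hts : s = 2 * m * t := by rw [ht]; field_simp
  calc binTail n q T ≤ Real.exp (-(t * T)) * (1 + (Real.exp t - 1) * q) ^ n :=
        binTail_le_mgf h0 h1 ht0 n T
    _ ≤ Real.exp (-(t * T)) * Real.exp ((Real.exp t - 1) * q) ^ n := by
        gcongr
        linarith [Real.add_one_le_exp ((Real.exp t - 1) * q)]
    _ = Real.exp (-(t * T) + (Real.exp t - 1) * (n * q)) := by
        rw [← Real.exp_nat_mul, ← Real.exp_add]; ring_nf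
    _ ≤ Real.exp (-(s ^ 2 / (4 * m))) := by
        apply Real.exp_le_exp.2
        have e1 : t * (n * q + s) ≤ t * T := mul_le_mul_of_nonneg_left hT ht0
        have e2 : (Real.exp t - 1) * (n * q) ≤ (t + t ^ 2) * (n * q) :=
          mul_le_mul_of_nonneg_right hexp (by positivity)
        have e3 : s ^ 2 / (4 * m) = m * t ^ 2 := by rw [ht]; field_simp; ring
        have e4 : t ^ 2 * (n * q) ≤ t ^ 2 * m := mul_le_mul_of_nonneg_left hq (sq_nonneg t)
        rw [e3]; rw [hts] at e1; nlinarith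

/-- Chernoff's bound for the lower tail. -/
theorem one_sub_binTail_le_exp {q m s : ℝ} {n T : ℕ} (h0 : 0 ≤ q) (h1 : q ≤ 1) (hm : 0 < m)
    (hq : m ≤ n * q) (hs : 0 ≤ s) (hsm : s ≤ 2 * m) (hT : T ≤ m - s) :
    1 - binTail n q T ≤ Real.exp (-(s ^ 2 / (4 * m))) := by
  set t := s / (2 * m) with ht
  have ht0 : 0 ≤ t := by positivity
  have ht1 : t ≤ 1 := by rw [ht, div_le_one (by positivity)]; exact hsm
  have hexp : t - t ^ 2 ≤ 1 - Real.exp (-t) := by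
    have := (abs_le.1 (Real.abs_exp_sub_one_sub_id_le (x := -t)
      (by rwa [abs_neg, abs_of_nonneg ht0]))).2
    rw [neg_sq] at this
    linarith
  have hts : s = 2 * m * t := by rw [ht]; field_simp
  have hexp1 : 0 ≤ 1 - Real.exp (-t) := by
    have : Real.exp (-t) ≤ 1 := Real.exp_le_one_iff.2 (by linarith)
    linarith
  calc 1 - binTail n q T ≤ Real.exp (t * T) * (1 - (1 - Real.exp (-t)) * q) ^ n :=
        one_sub_binTail_le_mgf h0 h1 ht0 n T
    _ ≤ Real.exp (t * T) * Real.exp (-((1 - Real.exp (-t)) * q)) ^ n := by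
        have : 0 ≤ Real.exp (-t) := (Real.exp_pos _).le
        gcongr
        · nlinarith
        · linarith [Real.add_one_le_exp (-((1 - Real.exp (-t)) * q))]
    _ = Real.exp (t * T - (1 - Real.exp (-t)) * (n * q)) := by
        rw [← Real.exp_nat_mul, ← Real.exp_add]; ring_nf
    _ ≤ Real.exp (-(s ^ 2 / (4 * m))) := by
        apply Real.exp_le_exp.2
        have e1 : t * T ≤ t * (m - s) := mul_le_mul_of_nonneg_left hT ht0
        have e2 : (t - t ^ 2) * m ≤ (1 - Real.exp (-t)) * (n * q) :=
          (mul_le_mul_of_nonneg_right hexp hm.le).trans (mul_le_mul_of_nonneg_left hq hexp1)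
        have e3 : s ^ 2 / (4 * m) = m * t ^ 2 := by rw [ht]; field_simp; ring
        rw [e3]; rw [hts] at e1; nlinarith

/-! ### Counts of sample points -/

/-- The number of sample points in the set `A`. -/
noncomputable def cnt {E : Type*} {n : ℕ} (A : Set E) (X : Fin n → E) : ℕ := {i | X i ∈ A}.ncard

section Count

variable {E : Type*} {n : ℕ}

open Classical in
theorem cnt_eq_sum (A : Set E) (X : Fin n → E) : cnt A X = ∑ i, if X i ∈ A then 1 else 0 := by
  rw [cnt, Set.ncard_eq_toFinset_card', ← Finset.card_filter]
  congr 1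
  ext i; simp

theorem cnt_mono {A B : Set E} (h : A ⊆ B) (X : Fin n → E) : cnt A X ≤ cnt B X :=
  Set.ncard_le_ncard (fun _ hi => h hi) (Set.toFinite _)

theorem cnt_union_le (A B : Set E) (X : Fin n → E) : cnt (A ∪ B) X ≤ cnt A X + cnt B X :=
  Set.ncard_union_le _ _

theorem cnt_le (A : Set E) (X : Fin n → E) : cnt A X ≤ n := by
  have := Set.ncard_le_ncard (Set.subset_univ {i | X i ∈ A}) (Set.toFinite _)
  simpa [cnt, Set.ncard_univ] using this

theorem cnt_union_of_disjoint {A B : Set E} (h : Disjoint A B) (X : Fin n → E) :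
    cnt (A ∪ B) X = cnt A X + cnt B X :=
  Set.ncard_union_eq (Set.disjoint_left.2 fun _ ha hb => Set.disjoint_left.1 h ha hb)
    (Set.toFinite _) (Set.toFinite _)

theorem exists_of_cnt_pos {A : Set E} {X : Fin n → E} (h : 0 < cnt A X) : ∃ i, X i ∈ A :=
  (Set.ncard_pos (Set.toFinite _)).1 h

open Classical in
theorem cnt_insertNth (A : Set E) (i : Fin (n + 1)) (x : E) (Y : Fin n → E) :
    cnt A (i.insertNth x Y : Fin (n + 1) → E) = (if x ∈ A then 1 else 0) + cnt A Y := by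
  rw [cnt_eq_sum, cnt_eq_sum, Fin.sum_univ_succAbove _ i]
  simp

variable [MeasurableSpace E]

theorem measurable_cnt {A : Set E} (hA : MeasurableSet A) :
    Measurable fun X : Fin n → E => cnt A X := by
  classical
  simp only [cnt_eq_sum]
  refine Finset.measurable_sum _ fun i _ => Measurable.ite ?_ measurable_const measurable_const
  exact measurable_pi_apply i hA

theorem measurableSet_le_cnt {A : Set E} (hA : MeasurableSet A) (T : ℕ) :
    MeasurableSet {X : Fin n → E | T ≤ cnt A X} :=
  measurable_cnt hA measurableSet_Ici

variable (μ : Measure E) [IsProbabilityMeasure μ]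

/-- Conditioning an event on the `i`-th observation. -/
theorem pi_succ_apply (i : Fin (n + 1)) {S : Set (Fin (n + 1) → E)} (hS : MeasurableSet S) :
    Measure.pi (fun _ : Fin (n + 1) => μ) S
      = ∫⁻ x, Measure.pi (fun _ : Fin n => μ) {Y | (i.insertNth x Y : Fin (n + 1) → E) ∈ S} ∂μ := by
  have h := (measurePreserving_piFinSuccAbove (fun _ : Fin (n + 1) => μ) i).symm
  rw [← h.measure_preimage hS.nullMeasurableSet, Measure.prod_apply]
  · rfl
  · exact h.measurable hS

theorem pi_le_cnt {A : Set E} (hA : MeasurableSet A) : ∀ (n T : ℕ),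
    Measure.pi (fun _ : Fin n => μ) {X | T ≤ cnt A X} = ENNReal.ofReal (binTail n (μ.real A) T)
  | _, 0 => by simp
  | 0, T + 1 => by simp [cnt_eq_sum]
  | n + 1, T + 1 => by
    classical
    rw [pi_succ_apply μ 0 (measurableSet_le_cnt hA _), ← lintegral_add_compl _ hA]
    have e1 : ∀ x ∈ A, Measure.pi (fun _ : Fin n => μ)
        {Y | ((0 : Fin (n + 1)).insertNth x Y : Fin (n + 1) → E) ∈ {X | T + 1 ≤ cnt A X}}
        = ENNReal.ofReal (binTail n (μ.real A) T) := by
      intro x hx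
      rw [← pi_le_cnt hA n T]
      congr 1; ext Y
      simp only [mem_ofPred_eq, cnt_insertNth, hx, if_true]; omega
    have e2 : ∀ x ∈ Aᶜ, Measure.pi (fun _ : Fin n => μ)
        {Y | ((0 : Fin (n + 1)).insertNth x Y : Fin (n + 1) → E) ∈ {X | T + 1 ≤ cnt A X}}
        = ENNReal.ofReal (binTail n (μ.real A) (T + 1)) := by
      intro x hx
      rw [← pi_le_cnt hA n (T + 1)]
      congr 1; ext Y
      simp only [mem_ofPred_eq, cnt_insertNth, (show x ∉ A from hx), if_false]; omega
    have h1 : 0 ≤ μ.real A := measureReal_nonneg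
    have h2 : μ.real A ≤ 1 := measureReal_le_one
    rw [setLIntegral_congr_fun hA e1, setLIntegral_congr_fun hA.compl e2, setLIntegral_const,
      setLIntegral_const, binTail_succ_succ,
      ENNReal.ofReal_add (mul_nonneg h1 (binTail_nonneg h1 h2 _ _))
        (mul_nonneg (by linarith) (binTail_nonneg h1 h2 _ _)),
      ENNReal.ofReal_mul h1, ENNReal.ofReal_mul (by linarith),
      ← probReal_compl_eq_one_sub hA, measureReal_def, measureReal_def,
      ENNReal.ofReal_toReal (measure_ne_top _ _), ENNReal.ofReal_toReal (measure_ne_top _ _)]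
    ring

theorem pi_cnt_lt {A : Set E} (hA : MeasurableSet A) (n T : ℕ) :
    Measure.pi (fun _ : Fin n => μ) {X | cnt A X < T}
      = ENNReal.ofReal (1 - binTail n (μ.real A) T) := by
  have : {X : Fin n → E | cnt A X < T} = {X | T ≤ cnt A X}ᶜ := by ext; simp
  rw [this, prob_compl_eq_one_sub (measurableSet_le_cnt hA T), pi_le_cnt μ hA,
    ENNReal.ofReal_sub _ (binTail_nonneg measureReal_nonneg measureReal_le_one _ _),
    ENNReal.ofReal_one]

/-- The counts of two disjoint sets are negatively correlated. -/
theorem pi_le_cnt_inter_le {A B : Set E} (hA : MeasurableSet A) (hB : MeasurableSet B)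
    (hAB : Disjoint A B) : ∀ (n S T : ℕ),
    Measure.pi (fun _ : Fin n => μ) {X | S ≤ cnt A X ∧ T ≤ cnt B X}
      ≤ ENNReal.ofReal (binTail n (μ.real A) S * binTail n (μ.real B) T)
  | n, 0, T => by simp [pi_le_cnt μ hB]
  | n, S + 1, 0 => by simpa using (pi_le_cnt μ hA n (S + 1)).le
  | 0, S + 1, T + 1 => by simp [cnt_eq_sum]
  | n + 1, S + 1, T + 1 => by
    classical
    have hm : MeasurableSet {X : Fin (n + 1) → E | S + 1 ≤ cnt A X ∧ T + 1 ≤ cnt B X} :=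
      (measurableSet_le_cnt hA _).inter (measurableSet_le_cnt hB _)
    set a := μ.real A
    set b := μ.real B
    have ha0 : 0 ≤ a := measureReal_nonneg
    have hb0 : 0 ≤ b := measureReal_nonneg
    have ha1 : a ≤ 1 := measureReal_le_one
    have hb1 : b ≤ 1 := measureReal_le_one
    have hab : μ.real (A ∪ B) = a + b := measureReal_union hAB hB
    have hab1 : 0 ≤ 1 - a - b := by
      have : μ.real (A ∪ B) ≤ 1 := measureReal_le_one
      linarith
    have hU : MeasurableSet (A ∪ B) := hA.union hB
    rw [pi_succ_apply μ 0 hm, ← lintegral_add_compl _ hU, lintegral_union hB hAB]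
    have e1 : ∫⁻ x in A, Measure.pi (fun _ : Fin n => μ)
        {Y | ((0 : Fin (n + 1)).insertNth x Y : Fin (n + 1) → E) ∈
          {X | S + 1 ≤ cnt A X ∧ T + 1 ≤ cnt B X}} ∂μ
        ≤ ∫⁻ _ in A, ENNReal.ofReal (binTail n a S * binTail n b (T + 1)) ∂μ := by
      refine setLIntegral_mono' hA fun x hx => ?_
      refine le_trans (measure_mono ?_) (pi_le_cnt_inter_le hA hB hAB n S (T + 1))
      have hx' : x ∉ B := Set.disjoint_left.1 hAB hx
      intro Y hY
      simp only [mem_ofPred_eq, cnt_insertNth, hx, hx', if_true, if_false] at hY ⊢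
      omega
    have e2 : ∫⁻ x in B, Measure.pi (fun _ : Fin n => μ)
        {Y | ((0 : Fin (n + 1)).insertNth x Y : Fin (n + 1) → E) ∈
          {X | S + 1 ≤ cnt A X ∧ T + 1 ≤ cnt B X}} ∂μ
        ≤ ∫⁻ _ in B, ENNReal.ofReal (binTail n a (S + 1) * binTail n b T) ∂μ := by
      refine setLIntegral_mono' hB fun x hx => ?_
      refine le_trans (measure_mono ?_) (pi_le_cnt_inter_le hA hB hAB n (S + 1) T)
      have hx' : x ∉ A := Set.disjoint_right.1 hAB hx
      intro Y hY
      simp only [mem_ofPred_eq, cnt_insertNth, hx, hx', if_true, if_false] at hY ⊢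
      omega
    have e3 : ∫⁻ x in (A ∪ B)ᶜ, Measure.pi (fun _ : Fin n => μ)
        {Y | ((0 : Fin (n + 1)).insertNth x Y : Fin (n + 1) → E) ∈
          {X | S + 1 ≤ cnt A X ∧ T + 1 ≤ cnt B X}} ∂μ
        ≤ ∫⁻ _ in (A ∪ B)ᶜ, ENNReal.ofReal (binTail n a (S + 1) * binTail n b (T + 1)) ∂μ := by
      refine setLIntegral_mono' hU.compl fun x hx => ?_
      refine le_trans (measure_mono ?_) (pi_le_cnt_inter_le hA hB hAB n (S + 1) (T + 1))
      have hx' : x ∉ A ∧ x ∉ B := by simpa using hx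
      intro Y hY
      simp only [mem_ofPred_eq, cnt_insertNth, hx'.1, hx'.2, if_false] at hY ⊢
      omega
    refine (add_le_add (add_le_add e1 e2) e3).trans ?_
    have hA1 := binTail_nonneg ha0 ha1 n S
    have hA2 := binTail_nonneg ha0 ha1 n (S + 1)
    have hB1 := binTail_nonneg hb0 hb1 n T
    have hB2 := binTail_nonneg hb0 hb1 n (T + 1)
    have hA3 := binTail_succ_le ha0 ha1 n S
    have hB3 := binTail_succ_le hb0 hb1 n T
    have mA : μ A = ENNReal.ofReal a := (ofReal_measureReal).symm
    have mB : μ B = ENNReal.ofReal b := (ofReal_measureReal).symm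
    have mC : μ (A ∪ B)ᶜ = ENNReal.ofReal (1 - a - b) := by
      rw [← ofReal_measureReal, probReal_compl_eq_one_sub hU, hab]; ring_nf
    rw [setLIntegral_const, setLIntegral_const, setLIntegral_const, mA, mB, mC,
      ← ENNReal.ofReal_mul (by positivity), ← ENNReal.ofReal_mul (by positivity),
      ← ENNReal.ofReal_mul (by positivity), ← ENNReal.ofReal_add (by positivity) (by positivity),
      ← ENNReal.ofReal_add (by positivity) (by positivity)]
    apply ENNReal.ofReal_le_ofReal
    rw [binTail_succ_succ, binTail_succ_succ]
    have := mul_nonneg (mul_nonneg ha0 hb0) (mul_nonneg (sub_nonneg.2 hA3) (sub_nonneg.2 hB3))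
    nlinarith

end Count

/-! ### Comparison of binomial tails -/

/-- For arguments below `b`, a binomial probability is at most `ρ` times the next one; iterating
this `s` times compares the probabilities of `j` and `j + s`. -/
theorem choose_mul_pow_le {q ρ : ℝ} {n b : ℕ} (h0 : 0 < q) (h1 : q < 1) (hb : b < n)
    (hρ : (b : ℝ) * (1 - q) = ρ * ((n - b) * q)) (s j : ℕ) (hj : j + s ≤ b) :
    n.choose j * q ^ j * (1 - q) ^ (n - j)
      ≤ ρ ^ s * (n.choose (j + s) * q ^ (j + s) * (1 - q) ^ (n - (j + s))) := by
  have hq1 : 0 < 1 - q := by linarith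
  have hnb : (0 : ℝ) < n - b := by
    have : (b : ℝ) < n := by exact_mod_cast hb
    linarith
  have hρ0 : 0 ≤ ρ := by
    have h2 : 0 ≤ ρ * ((n - b) * q) := by rw [← hρ]; positivity
    exact nonneg_of_mul_nonneg_left h2 (mul_pos hnb h0)
  induction s with
  | zero => simp
  | succ s ih =>
    refine (ih (by omega)).trans ?_
    rw [pow_succ, mul_assoc (ρ ^ s)]
    refine mul_le_mul_of_nonneg_left ?_ (pow_nonneg hρ0 s)
    set i := j + s with hi
    have hch : (n.choose i : ℝ) * (n - i) = n.choose (i + 1) * (i + 1) := by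
      have := Nat.choose_succ_right_eq n i
      have h2 : (n.choose (i + 1) : ℝ) * (i + 1) = n.choose i * (n - i : ℕ) := by
        exact_mod_cast this
      rw [h2, Nat.cast_sub (by omega)]
    have hib : (i : ℝ) + 1 ≤ b := by exact_mod_cast (show i + 1 ≤ b by omega)
    have hni : (0 : ℝ) < n - i := by linarith
    have key : (i + 1 : ℝ) * (1 - q) ≤ ρ * ((n - i) * q) := by
      calc (i + 1 : ℝ) * (1 - q) ≤ b * (1 - q) := by gcongr
        _ = ρ * ((n - b) * q) := hρ
        _ ≤ ρ * ((n - i) * q) := by gcongr; linarith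
    rw [show n - i = n - (i + 1) + 1 by omega, show j + (s + 1) = i + 1 by omega, pow_succ, pow_succ]
    have hP : 0 ≤ (n.choose (i + 1) : ℝ) * q ^ i * (1 - q) ^ (n - (i + 1)) := by positivity
    have h3 := mul_le_mul_of_nonneg_left key hP
    refine le_of_mul_le_mul_right ?_ hni
    calc (n.choose i : ℝ) * q ^ i * ((1 - q) ^ (n - (i + 1)) * (1 - q)) * (n - i)
        = (n.choose i * (n - i)) * q ^ i * ((1 - q) ^ (n - (i + 1)) * (1 - q)) := by ring
      _ = n.choose (i + 1) * q ^ i * (1 - q) ^ (n - (i + 1)) * ((i + 1 : ℝ) * (1 - q)) := by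
          rw [hch]; ring
      _ ≤ _ := h3
      _ = _ := by ring

theorem one_sub_le_exp {x : ℝ} (h0 : 0 ≤ x) (h1 : x ≤ 1 / 4) :
    1 - x ≤ Real.exp (-(x + x ^ 2 / 2)) := by
  set y := x + x ^ 2 / 2 with hy
  have hy0 : 0 ≤ y := by positivity
  have hyx : y ≤ 9 / 8 * x := by nlinarith
  have hb := (abs_le.1 (Real.exp_bound (x := -y) (n := 3) (by rw [abs_neg, abs_of_nonneg hy0]; nlinarith)
    (by norm_num))).1
  rw [abs_neg, abs_of_nonneg hy0] at hb
  simp only [Finset.sum_range_succ, Finset.sum_range_zero, Nat.factorial] at hb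
  norm_num at hb
  have h3 : y ^ 3 ≤ (9 / 8 * x) ^ 3 := by gcongr
  have h4 : y ^ 2 = x ^ 2 + x ^ 3 + x ^ 4 / 4 := by rw [hy]; ring
  have h5 : 0 ≤ x ^ 3 := by positivity
  have h6 : 0 ≤ x ^ 4 := by positivity
  nlinarith

set_option maxHeartbeats 400000 in
/-- Multiplying the success probability by `1 - Δ` decreases the binomial probabilities near `T` by
an exponential factor, even if the argument is shifted by `s`: the likelihood ratio gains a factor
whose logarithm is of order `T * Δ ^ 2`, and the shift is so short that it costs less. -/
theorem binPmf_le {q Δ : ℝ} {n j s T : ℕ} (hn : 300 * T ≤ n) (hT : 0 < T)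
    (hΔ0 : 0 ≤ Δ) (hΔ1 : Δ ≤ 1 / 4) (hq0 : 9 / 10 * T ≤ n * q)
    (hq1 : n * q ≤ T * (1 + Δ / 10)) (hs : s ≤ Δ * T / 10) (hj : T ≤ j + s) (hj2 : j < 2 * T) :
    n.choose j * (q * (1 - Δ)) ^ j * (1 - q * (1 - Δ)) ^ (n - j)
      ≤ Real.exp (-(T * Δ ^ 2 / 5)) *
        (n.choose (j + s) * q ^ (j + s) * (1 - q) ^ (n - (j + s))) := by
  have hT' : (0 : ℝ) < T := by exact_mod_cast hT
  have hn' : 300 * (T : ℝ) ≤ n := by exact_mod_cast hn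
  have hnpos : (0 : ℝ) < n := by linarith
  have hq : 0 < q := by
    by_contra h
    have : n * q ≤ 0 := mul_nonpos_of_nonneg_of_nonpos hnpos.le (not_lt.1 h)
    linarith
  have hq' : q ≤ 1 / 200 := by
    by_contra h
    have : n * (1 / 200) < n * q := by gcongr; linarith
    nlinarith
  have hsT : (s : ℝ) ≤ T / 40 := by nlinarith
  have hsT2 : s ≤ T := by
    have : (s : ℝ) ≤ T := by linarith
    exact_mod_cast this
  set b : ℕ := j + s with hb
  have hbn : b < n := by omega
  have hb3 : (b : ℝ) ≤ 3 * T := by exact_mod_cast (show b ≤ 3 * T by omega)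
  have hbr : (b : ℝ) = j + s := by push_cast [hb]; rfl
  have hTb : (T : ℝ) ≤ b := by exact_mod_cast hj
  have hnb : (0 : ℝ) < n - b := by linarith
  have hnbq : 4 / 5 * (T : ℝ) ≤ (n - b) * q := by nlinarith
  set ρ : ℝ := b * (1 - q) / ((n - b) * q) with hρ
  have hρe : (b : ℝ) * (1 - q) = ρ * ((n - b) * q) := by rw [hρ]; field_simp
  have hρ1 : ρ - 1 = (b - n * q) / ((n - b) * q) := by rw [hρ]; field_simp; ring
  have hρ0 : 0 ≤ ρ := by rw [hρ]; have : 0 ≤ 1 - q := by linarith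
                         positivity
  have hP := choose_mul_pow_le hq (by linarith) hbn hρe s j le_rfl
  have h1q : 0 < 1 - q := by linarith
  -- the likelihood ratio of the success probabilities `q * (1 - Δ)` and `q`
  have e1 : (1 - q * (1 - Δ)) ^ (n - j)
      ≤ Real.exp ((n - j) * (q * Δ / (1 - q))) * (1 - q) ^ (n - j) := by
    have : 1 - q * (1 - Δ) ≤ Real.exp (q * Δ / (1 - q)) * (1 - q) := by
      have h := Real.add_one_le_exp (q * Δ / (1 - q))
      calc 1 - q * (1 - Δ) = (q * Δ / (1 - q) + 1) * (1 - q) := by field_simp; ring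
        _ ≤ _ := by gcongr
    have h2 : 0 ≤ 1 - q * (1 - Δ) := by nlinarith
    calc (1 - q * (1 - Δ)) ^ (n - j) ≤ (Real.exp (q * Δ / (1 - q)) * (1 - q)) ^ (n - j) := by
          gcongr
      _ = _ := by
          rw [mul_pow, ← Real.exp_nat_mul, Nat.cast_sub (by omega)]
  have e2 : (1 - Δ) ^ j ≤ Real.exp (-(j * (Δ + Δ ^ 2 / 2))) := by
    have h2 : 0 ≤ 1 - Δ := by linarith
    calc (1 - Δ) ^ j ≤ Real.exp (-(Δ + Δ ^ 2 / 2)) ^ j := by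
          gcongr; exact one_sub_le_exp hΔ0 hΔ1
      _ = _ := by rw [← Real.exp_nat_mul]; ring_nf
  have e3 : ρ ^ s ≤ Real.exp (s * (ρ - 1)) := by
    rw [Real.exp_nat_mul]
    gcongr
    linarith [Real.add_one_le_exp (ρ - 1)]
  have hE : -(j * (Δ + Δ ^ 2 / 2)) + (n - j) * (q * Δ / (1 - q)) + s * (ρ - 1)
      ≤ -(T * Δ ^ 2 / 5) := by
    have f1 : s * (ρ - 1) ≤ Δ / 8 * (b - n * q + T * Δ / 10) := by
      have g0 : 0 ≤ b - n * q + T * Δ / 10 := by linarith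
      have g1 : ρ - 1 ≤ (b - n * q + T * Δ / 10) / (4 / 5 * T) := by
        rw [hρ1]
        calc (b - n * q) / ((n - b) * q) ≤ (b - n * q + T * Δ / 10) / ((n - b) * q) := by
              gcongr
              have : 0 ≤ T * Δ / 10 := by positivity
              linarith
          _ ≤ _ := by gcongr
      calc s * (ρ - 1) ≤ s * ((b - n * q + T * Δ / 10) / (4 / 5 * T)) := by gcongr
        _ ≤ (Δ * T / 10) * ((b - n * q + T * Δ / 10) / (4 / 5 * T)) := by gcongr
        _ = _ := by field_simp; ring
    have f2 : (n - j) * (q * Δ / (1 - q)) ≤ n * q * Δ + T * Δ ^ 2 / 100 := by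
      have g1 : (n - j) * (q * Δ / (1 - q)) = n * q * Δ + q * (n * q - j) * Δ / (1 - q) := by
        field_simp; ring
      have g2 : q * (n * q - j) * Δ / (1 - q) ≤ T * Δ ^ 2 / 100 := by
        rw [div_le_iff₀ h1q]
        have g3 : n * q - j ≤ Δ * T / 5 := by linarith
        have g5 : 0 ≤ T * Δ ^ 2 := by positivity
        calc q * (n * q - j) * Δ ≤ q * (Δ * T / 5) * Δ := by gcongr
          _ = q * (T * Δ ^ 2) / 5 := by ring
          _ ≤ 1 / 200 * (T * Δ ^ 2) / 5 := by gcongr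
          _ ≤ T * Δ ^ 2 / 100 * (1 - q) := by nlinarith
      linarith
    have hjr : (j : ℝ) = b - s := by linarith
    have f3 : -(j * (Δ + Δ ^ 2 / 2)) ≤ -(b * Δ) + Δ ^ 2 * T / 10 - 39 / 80 * T * Δ ^ 2 := by
      rw [hjr]
      have g1 : s * Δ ≤ Δ * T / 10 * Δ := by gcongr
      have g2 : 39 / 40 * (T : ℝ) * Δ ^ 2 ≤ (b - s) * Δ ^ 2 := by gcongr; linarith
      linarith
    have f4 : -(T * Δ / 10) * Δ ≤ (b - n * q) * Δ := by gcongr; linarith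
    have g5 : 0 ≤ T * Δ ^ 2 := by positivity
    linarith
  calc n.choose j * (q * (1 - Δ)) ^ j * (1 - q * (1 - Δ)) ^ (n - j)
      = n.choose j * q ^ j * (1 - Δ) ^ j * (1 - q * (1 - Δ)) ^ (n - j) := by rw [mul_pow]; ring
    _ ≤ n.choose j * q ^ j * Real.exp (-(j * (Δ + Δ ^ 2 / 2))) *
        (Real.exp ((n - j) * (q * Δ / (1 - q))) * (1 - q) ^ (n - j)) := by
        have : 0 ≤ 1 - q * (1 - Δ) := by nlinarith
        gcongr
    _ = Real.exp (-(j * (Δ + Δ ^ 2 / 2))) * Real.exp ((n - j) * (q * Δ / (1 - q))) *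
        (n.choose j * q ^ j * (1 - q) ^ (n - j)) := by ring
    _ ≤ Real.exp (-(j * (Δ + Δ ^ 2 / 2))) * Real.exp ((n - j) * (q * Δ / (1 - q))) *
        (Real.exp (s * (ρ - 1)) * (n.choose b * q ^ b * (1 - q) ^ (n - b))) := by
        refine mul_le_mul_of_nonneg_left (hP.trans ?_) (by positivity)
        gcongr
    _ = Real.exp (-(j * (Δ + Δ ^ 2 / 2)) + (n - j) * (q * Δ / (1 - q)) + s * (ρ - 1)) *
        (n.choose b * q ^ b * (1 - q) ^ (n - b)) := by
        rw [Real.exp_add, Real.exp_add]; ring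
    _ ≤ _ := by gcongr

theorem binTail_sub_eq_sum (q : ℝ) (n S : ℕ) {T : ℕ} (h : S ≤ T) :
    binTail n q S - binTail n q T
      = ∑ j ∈ Finset.Ico S T, (n.choose j : ℝ) * q ^ j * (1 - q) ^ (n - j) := by
  simp only [← binTail_sub_succ]
  rw [Finset.sum_Ico_eq_sum_range]
  induction T, h using Nat.le_induction with
  | base => simp
  | succ T hST ih =>
    rw [Nat.sub_add_comm hST, Finset.sum_range_succ, ← ih, Nat.add_sub_cancel' hST]
    ring_nf

/-- A relative decrease `Δ` of the success probability lowers the probability of reaching a level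
near the mean by a factor `exp (-(T * Δ ^ 2 / 5))`, even if the level is lowered at the same time
by a small fraction of `Δ * T`. -/
theorem binTail_compare {q Δ : ℝ} {n s T : ℕ} (hn : 300 * T ≤ n) (hT : 0 < T)
    (hΔ0 : 0 ≤ Δ) (hΔ1 : Δ ≤ 1 / 4) (hq0 : 9 / 10 * T ≤ n * q)
    (hq1 : n * q ≤ T * (1 + Δ / 10)) (hs : s ≤ Δ * T / 10) :
    binTail n (q * (1 - Δ)) (T - s)
      ≤ Real.exp (-(T * Δ ^ 2 / 5)) * binTail n q T + Real.exp (-(T / 6 : ℝ)) := by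
  have hT' : (0 : ℝ) < T := by exact_mod_cast hT
  have hn' : 300 * (T : ℝ) ≤ n := by exact_mod_cast hn
  have hnpos : (0 : ℝ) < n := by linarith
  have hq : 0 < q := by
    by_contra h
    have : n * q ≤ 0 := mul_nonpos_of_nonneg_of_nonpos hnpos.le (not_lt.1 h)
    linarith
  have hq' : q ≤ 1 / 200 := by
    by_contra h
    have : n * (1 / 200) < n * q := by gcongr; linarith
    nlinarith
  have hsT2 : s ≤ T := by
    have : (s : ℝ) ≤ T := by nlinarith
    exact_mod_cast this
  have h1 : binTail n (q * (1 - Δ)) (2 * T) ≤ Real.exp (-(T / 6 : ℝ)) := by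
    have h2 : n * (q * (1 - Δ)) ≤ 11 / 10 * T := by
      have : n * (q * (1 - Δ)) ≤ n * q := by nlinarith [mul_pos hnpos hq]
      nlinarith
    refine (binTail_le_exp (m := 11 / 10 * T) (s := 9 / 10 * T) (by nlinarith) (by nlinarith)
      (by positivity) h2 (by positivity) (by linarith) (by push_cast; linarith)).trans ?_
    · apply Real.exp_le_exp.2
      have : (9 / 10 * (T : ℝ)) ^ 2 / (4 * (11 / 10 * T)) = 81 / 440 * T := by field_simp; norm_num
      rw [this]; linarith
  have h2 := binTail_sub_eq_sum (q * (1 - Δ)) n (T - s) (T := 2 * T) (by omega)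
  have h3 : ∑ j ∈ Finset.Ico (T - s) (2 * T),
      (n.choose j : ℝ) * (q * (1 - Δ)) ^ j * (1 - q * (1 - Δ)) ^ (n - j)
      ≤ ∑ j ∈ Finset.Ico (T - s) (2 * T), Real.exp (-(T * Δ ^ 2 / 5)) *
        (n.choose (j + s) * q ^ (j + s) * (1 - q) ^ (n - (j + s))) := by
    refine Finset.sum_le_sum fun j hj => ?_
    rw [Finset.mem_Ico] at hj
    exact binPmf_le hn hT hΔ0 hΔ1 hq0 hq1 hs (by omega) hj.2
  have h4 : ∑ j ∈ Finset.Ico (T - s) (2 * T),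
      ((n.choose (j + s) : ℝ) * q ^ (j + s) * (1 - q) ^ (n - (j + s))) ≤ binTail n q T := by
    rw [Finset.sum_Ico_add' (fun j => (n.choose j : ℝ) * q ^ j * (1 - q) ^ (n - j)),
      Nat.sub_add_cancel hsT2, ← binTail_sub_eq_sum q n T (by omega)]
    linarith [binTail_nonneg hq.le (by linarith) n (2 * T + s)]
  rw [← Finset.mul_sum] at h3
  have h5 := mul_le_mul_of_nonneg_left h4 (Real.exp_pos (-(T * Δ ^ 2 / 5))).le
  linarith

/-! ### The second moment method -/

/-- If `m` events have probability at least `p` each and are pairwise negatively correlated, then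
by Chebyshev's inequality at least one of them happens, up to probability `(1 - p) / (m p)`. -/
theorem measure_iInter_compl_le {Ω ι : Type*} [MeasurableSpace Ω] (P : Measure Ω)
    [IsProbabilityMeasure P] [Fintype ι] [Nonempty ι] (A : ι → Set Ω)
    (hA : ∀ l, MeasurableSet (A l)) {p : ℝ} (hp : 0 < p) (hpA : ∀ l, p ≤ P.real (A l))
    (hneg : ∀ l l', l ≠ l' → P.real (A l ∩ A l') ≤ P.real (A l) * P.real (A l')) :
    P.real (⋂ l, (A l)ᶜ) ≤ (1 - p) / (Fintype.card ι * p) := by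
  classical
  let Z : ι → Ω → ℝ := fun l => (A l).indicator fun _ => 1
  have hZ : ∀ l, MemLp (Z l) 2 P := fun l => memLp_indicator_const 2 (hA l) 1 (by simp)
  have hE : ∀ l, ∫ ω, Z l ω ∂P = P.real (A l) := fun l => by
    simp [Z, integral_indicator (hA l)]
  have hcov : ∀ l l', ProbabilityTheory.covariance (Z l) (Z l') P
      = P.real (A l ∩ A l') - P.real (A l) * P.real (A l') := by
    intro l l'
    rw [ProbabilityTheory.covariance_eq_sub (hZ l) (hZ l'), hE, hE]
    congr 1
    have : Z l * Z l' = (A l ∩ A l').indicator fun _ => 1 := by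
      ext x; by_cases h1 : x ∈ A l <;> by_cases h2 : x ∈ A l' <;> simp [Z, h1, h2]
    rw [this, integral_indicator ((hA l).inter (hA l'))]; simp
  set s := ∑ l, P.real (A l) with hs
  have hcard : (0 : ℝ) < Fintype.card ι := by exact_mod_cast Fintype.card_pos
  have hsp : Fintype.card ι * p ≤ s := by
    rw [hs]; simpa using Finset.sum_le_sum fun l (_ : l ∈ Finset.univ) => hpA l
  have hs0 : 0 < s := lt_of_lt_of_le (by positivity) hsp
  have hvar : ProbabilityTheory.variance (∑ l, Z l) P ≤ (1 - p) * s := by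
    rw [ProbabilityTheory.variance_sum hZ, hs, Finset.mul_sum]
    refine Finset.sum_le_sum fun l _ => ?_
    rw [← Finset.add_sum_erase _ _ (Finset.mem_univ l)]
    have h1 : ∑ l' ∈ Finset.univ.erase l, ProbabilityTheory.covariance (Z l) (Z l') P ≤ 0 := by
      refine Finset.sum_nonpos fun l' hl' => ?_
      rw [hcov]
      linarith [hneg l l' (Finset.ne_of_mem_erase hl').symm]
    have h2 : ProbabilityTheory.covariance (Z l) (Z l) P ≤ (1 - p) * P.real (A l) := by
      rw [hcov, inter_self]
      nlinarith [hpA l, measureReal_nonneg (μ := P) (s := A l)]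
    linarith
  have hZs : MemLp (∑ l, Z l) 2 P := memLp_finsetSum' _ fun l _ => hZ l
  have hEs : ∫ ω, (∑ l, Z l) ω ∂P = s := by
    simp only [Finset.sum_apply]
    rw [integral_finsetSum _ fun l _ => (hZ l).integrable (by norm_num)]
    exact Finset.sum_congr rfl fun l _ => hE l
  have hch := ProbabilityTheory.meas_ge_le_variance_div_sq hZs hs0
  rw [hEs] at hch
  have hsub : (⋂ l, (A l)ᶜ) ⊆ {ω | s ≤ |(∑ l, Z l) ω - s|} := by
    intro ω hω
    have : (∑ l, Z l) ω = 0 := by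
      rw [Finset.sum_apply]
      refine Finset.sum_eq_zero fun l _ => ?_
      have := mem_iInter.1 hω l
      simp only [mem_compl_iff] at this
      simp [Z, this]
    show s ≤ |(∑ l, Z l) ω - s|
    rw [this, zero_sub, abs_neg, abs_of_pos hs0]
  have h3 : P.real (⋂ l, (A l)ᶜ) ≤ ProbabilityTheory.variance (∑ l, Z l) P / s ^ 2 := by
    refine ENNReal.toReal_le_of_le_ofReal ?_ ((measure_mono hsub).trans hch)
    exact div_nonneg (ProbabilityTheory.variance_nonneg _ _) (by positivity)
  obtain ⟨l0⟩ := ‹Nonempty ι›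
  have hp1 : 0 ≤ 1 - p := by
    have : P.real (A l0) ≤ 1 := measureReal_le_one
    linarith [hpA l0]
  calc _ ≤ _ := h3
    _ ≤ (1 - p) * s / s ^ 2 := by gcongr
    _ = (1 - p) / s := by field_simp
    _ ≤ _ := by gcongr

open Filter Topology

/-! ### Densities near a mode -/

/-- The upper half of a Taylor expansion of order two at a critical point, from a bound on the first
derivative only. -/
theorem sub_le_of_hasDerivAt_le {φ φ' : ℝ → ℝ} {K : ℝ}
    (h : ∀ t ∈ Icc (0 : ℝ) 1, HasDerivAt φ (φ' t) t) (hK : ∀ t ∈ Icc (0 : ℝ) 1, φ' t ≤ t * K) :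
    φ 1 - φ 0 ≤ K / 2 := by
  have hd : ∀ t ∈ Icc (0 : ℝ) 1, HasDerivAt (fun t => φ t - t ^ 2 / 2 * K) (φ' t - t * K) t := by
    intro t ht
    have h2 : HasDerivAt (fun t : ℝ => t ^ 2 / 2 * K) (t * K) t := by
      have := ((hasDerivAt_pow 2 t).div_const 2).mul_const K
      simpa using this
    exact (h t ht).sub h2
  have := antitoneOn_of_deriv_nonpos (convex_Icc (0 : ℝ) 1)
    (fun t ht => (hd t ht).continuousAt.continuousWithinAt)
    (fun t ht => (hd t (interior_subset ht)).differentiableAt.differentiableWithinAt)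
    (fun t ht => by
      rw [(hd t (interior_subset ht)).deriv]; linarith [hK t (interior_subset ht)])
  have := this (left_mem_Icc.2 zero_le_one) (right_mem_Icc.2 zero_le_one) zero_le_one
  norm_num at this
  linarith

theorem isLocalMax_of_mem_modes {E : Type*} [PseudoMetricSpace E] {f : E → ℝ} {x : E}
    (hx : x ∈ modes f) : IsLocalMax f x := by
  obtain ⟨ρ, hρ, h⟩ := hx
  filter_upwards [Metric.closedBall_mem_nhds x hρ] with y hy
  by_cases hyx : y = x
  · rw [hyx]
  · exact (h y hy hyx).le

section General

variable {E : Type*} [NormedAddCommGroup E] [NormedSpace ℝ E]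

theorem modes_pos [Nontrivial E] {f : E → ℝ} (hf : ∀ x, 0 ≤ f x) {x : E} (hx : x ∈ modes f) :
    0 < f x := by
  obtain ⟨ρ, hρ, h⟩ := hx
  obtain ⟨v, hv⟩ := exists_norm_eq E hρ.le
  have hv0 : v ≠ 0 := by rintro rfl; simp at hv; exact hρ.ne hv
  exact (hf _).trans_lt (h (x + v) (by simp [hv]) (by simpa using hv0))

theorem ModalStructure.continuousAt {f : E → ℝ} (hf : ModalStructure f) {x : E}
    (hx : x ∈ modes f) : ContinuousAt f x := by
  obtain ⟨U, hU, -⟩ := hf.smooth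
  exact ((hU x hx).2.2 x (hU x hx).2.1).1.continuousAt

/-- A point that maximizes `f` on its component of the superlevel set `{f ≥ f x}` is a mode, because
this component is a local maximum region. -/
theorem ModalStructure.mem_modes_of_max_on_component {f : E → ℝ} (hf : ModalStructure f) {x : E}
    (h : ∀ u ∈ connectedComponentIn {y | f x ≤ f y} x, f u ≤ f x) : x ∈ modes f := by
  set K := connectedComponentIn {y | f x ≤ f y} x with hK
  have hx : x ∈ {y | f x ≤ f y} := le_refl (f x)
  have hmem : x ∈ K := mem_connectedComponentIn hx
  have hreg : IsLocalMaxRegion f K := by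
    refine ⟨⟨⟨x, hmem⟩, isPreconnected_connectedComponentIn⟩, f x,
      fun y hy => le_antisymm (h y hy) (connectedComponentIn_subset {y | f x ≤ f y} x hy),
      fun N hN hKN => ?_⟩
    by_contra! hcon
    exact hKN.2 (hN.isPreconnected.subset_connectedComponentIn (hKN.1 hmem) hcon)
  obtain ⟨z, hz, hKz⟩ := hf.region_is_point K hreg
  rw [hKz, mem_singleton_iff] at hmem
  rwa [hmem]

/-- Around a mode a density with modal structure decays quadratically. -/
theorem ModalStructure.exists_quadratic [FiniteDimensional ℝ E] [Nontrivial E] {f : E → ℝ}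
    (hf : ModalStructure f) {x₀ : E} (hx : x₀ ∈ modes f) :
    ∃ c C ρ : ℝ, 0 < c ∧ 0 < C ∧ 0 < ρ ∧ ∀ x ∈ Metric.closedBall x₀ ρ,
      c * ‖x₀ - x‖ ^ 2 ≤ f x₀ - f x ∧ f x₀ - f x ≤ C * ‖x₀ - x‖ ^ 2 := by
  obtain ⟨U, hU, -⟩ := hf.smooth
  obtain ⟨hUo, hxU, hUd⟩ := hU x₀ hx
  set B := fderiv ℝ (fderiv ℝ f) x₀ with hB
  have hd2 : HasFDerivAt (fderiv ℝ f) B x₀ := (hUd x₀ hxU).2.hasFDerivAt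
  have hd0 : fderiv ℝ f x₀ = 0 := (isLocalMax_of_mem_modes hx).fderiv_eq_zero
  obtain ⟨c0, hc0, hBneg⟩ : ∃ c0 > 0, ∀ v : E, B v v ≤ -c0 * ‖v‖ ^ 2 := by
    have : ProperSpace E := FiniteDimensional.proper ℝ E
    obtain ⟨u, hu, hmax⟩ := (isCompact_sphere (0 : E) 1).exists_isMaxOn
      (NormedSpace.sphere_nonempty.2 zero_le_one)
      (f := fun v => B v v) (by fun_prop)
    have hu0 : u ≠ 0 := by rintro rfl; simp at hu
    refine ⟨-(B u u), by linarith [hf.hessian_neg x₀ hx u hu0], fun v => ?_⟩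
    by_cases hv : v = 0
    · simp [hv]
    have hv' : 0 < ‖v‖ := norm_pos_iff.2 hv
    have h1 : B (‖v‖⁻¹ • v) (‖v‖⁻¹ • v) ≤ B u u :=
      hmax (by simp [norm_smul, hv'.ne'])
    simp only [map_smul, smul_apply, smul_eq_mul] at h1
    have h2 : ‖v‖⁻¹ * (‖v‖⁻¹ * B v v) * ‖v‖ ^ 2 ≤ B u u * ‖v‖ ^ 2 := by gcongr
    have h3 : ‖v‖⁻¹ * (‖v‖⁻¹ * B v v) * ‖v‖ ^ 2 = B v v := by field_simp
    rw [h3] at h2; linarith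
  have hlit := hd2.isLittleO.def (half_pos hc0)
  rw [Metric.eventually_nhds_iff_ball] at hlit
  obtain ⟨ρ1, hρ1, hlit⟩ := hlit
  obtain ⟨ρ2, hρ2, hball⟩ := Metric.isOpen_iff.1 hUo x₀ hxU
  have hρ : 0 < min ρ1 ρ2 / 2 := by positivity
  refine ⟨c0 / 4, (‖B‖ + c0 / 2) / 2, min ρ1 ρ2 / 2, by positivity, by positivity, hρ, ?_⟩
  intro x hx'
  set v := x - x₀ with hv
  have hvn : ‖x₀ - x‖ = ‖v‖ := norm_sub_rev _ _
  have hvρ : ‖v‖ < min ρ1 ρ2 := by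
    rw [mem_closedBall_iff_norm] at hx'
    rw [hv]; linarith
  have hmem : ∀ t ∈ Icc (0 : ℝ) 1, x₀ + t • v ∈ Metric.ball x₀ (min ρ1 ρ2) := by
    intro t ht
    rw [mem_ball_iff_norm, add_sub_cancel_left, norm_smul, Real.norm_of_nonneg ht.1]
    nlinarith [norm_nonneg v, ht.1, ht.2]
  have hder : ∀ t ∈ Icc (0 : ℝ) 1,
      HasDerivAt (fun t : ℝ => f (x₀ + t • v)) (fderiv ℝ f (x₀ + t • v) v) t := by
    intro t ht
    have h1 : HasFDerivAt f (fderiv ℝ f (x₀ + t • v)) (x₀ + t • v) :=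
      (hUd _ (hball (Metric.ball_subset_ball (min_le_right _ _) (hmem t ht)))).1.hasFDerivAt
    have h2 : HasDerivAt (fun t : ℝ => x₀ + t • v) v t := by
      simpa using ((hasDerivAt_id t).smul_const v).const_add x₀
    exact h1.comp_hasDerivAt t h2
  have hest : ∀ t ∈ Icc (0 : ℝ) 1,
      |fderiv ℝ f (x₀ + t • v) v - t * B v v| ≤ t * (c0 / 2 * ‖v‖ ^ 2) := by
    intro t ht
    have h1 := hlit _ (Metric.ball_subset_ball (min_le_left _ _) (hmem t ht))
    rw [hd0, sub_zero, add_sub_cancel_left, map_smul, norm_smul, Real.norm_of_nonneg ht.1] at h1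
    have h2 := (fderiv ℝ f (x₀ + t • v) - t • B v).le_of_opNorm_le h1 v
    simp only [sub_apply, smul_apply, smul_eq_mul,
      Real.norm_eq_abs] at h2
    linarith
  have hup := sub_le_of_hasDerivAt_le (K := B v v + c0 / 2 * ‖v‖ ^ 2) hder (fun t ht => by
    have := (abs_le.1 (hest t ht)).2
    linarith)
  have hlo := sub_le_of_hasDerivAt_le (φ := fun t => -f (x₀ + t • v))
    (K := -(B v v) + c0 / 2 * ‖v‖ ^ 2) (fun t ht => (hder t ht).neg) (fun t ht => by
    have := (abs_le.1 (hest t ht)).1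
    linarith)
  have hBv := hBneg v
  have hBn : -(‖B‖ * ‖v‖ ^ 2) ≤ B v v := by
    have := B.le_opNorm₂ v v
    rw [Real.norm_eq_abs] at this
    have := (abs_le.1 this).1
    linarith
  simp only [one_smul, zero_smul, add_zero, hv, add_sub_cancel] at hup hlo
  rw [hvn]
  constructor <;> linarith

end General

section Line

variable {f : ℝ → ℝ}

theorem modes_subset_Ioo (hd : IsDensityOn f (Icc 0 1)) (hf : ModalStructure f) {x : ℝ}
    (hx : x ∈ modes f) : x ∈ Ioo (0 : ℝ) 1 := by
  have hpos := modes_pos hd.nonneg hx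
  have hev : ∀ᶠ y in 𝓝 x, y ∈ Icc (0 : ℝ) 1 := by
    filter_upwards [(hf.continuousAt hx).eventually (lt_mem_nhds hpos)] with y hy
    by_contra hyn
    exact hy.ne' (hd.eq_zero y hyn)
  rw [← interior_Icc]
  exact mem_interior_iff_mem_nhds.2 hev

theorem continuousAt_of_mem_Ioo {Cα α : ℝ≥0} (hα : 0 < α)
    (hh : HolderOnWith Cα α f (Icc 0 1)) {x : ℝ} (hx : x ∈ Ioo (0 : ℝ) 1) : ContinuousAt f x :=
  (hh.continuousOn hα).continuousAt (Icc_mem_nhds hx.1 hx.2)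

/-- Between two modes there is a point that is lower than both. -/
theorem exists_valley {x₀ x₁ : ℝ} (h₀ : x₀ ∈ modes f) (h₁ : x₁ ∈ modes f) (h : x₀ < x₁) :
    ∃ s ∈ Ioo x₀ x₁, f s < f x₀ ∧ f s < f x₁ := by
  obtain ⟨ρ, hρ, hm⟩ := h₀
  obtain ⟨ρ', hρ', hm'⟩ := h₁
  rcases le_total (f x₀) (f x₁) with hle | hle
  · have hpos : 0 < min ρ ((x₁ - x₀) / 2) := lt_min hρ (by linarith)
    have hle2 := min_le_right ρ ((x₁ - x₀) / 2)
    have hlt := hm (x₀ + min ρ ((x₁ - x₀) / 2))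
      (by rw [Metric.mem_closedBall, Real.dist_eq, add_sub_cancel_left, abs_of_pos hpos]
          exact min_le_left _ _) (by linarith)
    exact ⟨_, ⟨by linarith, by linarith⟩, hlt, hlt.trans_le hle⟩
  · have hpos : 0 < min ρ' ((x₁ - x₀) / 2) := lt_min hρ' (by linarith)
    have hle2 := min_le_right ρ' ((x₁ - x₀) / 2)
    have hlt := hm' (x₁ - min ρ' ((x₁ - x₀) / 2))
      (by rw [Metric.mem_closedBall, Real.dist_eq, sub_sub_cancel_left, abs_neg, abs_of_pos hpos]
          exact min_le_left _ _) (by linarith)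
    exact ⟨_, ⟨by linarith, by linarith⟩, hlt.trans_le hle, hlt⟩

theorem eventually_le_on_closedBall {x a : ℝ} (hc : ContinuousAt f x) (ha : f x < a) :
    ∀ᶠ r in 𝓝[>] (0 : ℝ), ∀ y ∈ Metric.closedBall x r, f y ≤ a := by
  have hev := hc.eventually (gt_mem_nhds ha)
  rw [Metric.eventually_nhds_iff_ball] at hev
  obtain ⟨ε, hε, h⟩ := hev
  filter_upwards [Ioo_mem_nhdsGT hε] with r hr y hy
  exact (h y (Metric.closedBall_subset_ball hr.2 hy)).le

theorem eventually_ge_on_closedBall {x b : ℝ} (hc : ContinuousAt f x) (hb : b < f x) :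
    ∀ᶠ r in 𝓝[>] (0 : ℝ), ∀ y ∈ Metric.closedBall x r, b ≤ f y := by
  filter_upwards [eventually_le_on_closedBall (f := fun x => -f x) (a := -b) hc.neg
    (by simpa using hb)] with r hr y hy
  have := hr y hy
  linarith

/-- A superlevel set whose level is not reached at distance `ρ` from `x` has its component of `x`
within that distance. -/
theorem connectedComponentIn_subset_closedBall {x ρ lam : ℝ} (hρ : 0 ≤ ρ) (h1 : f (x - ρ) < lam)
    (h2 : f (x + ρ) < lam) :
    connectedComponentIn {y | lam ≤ f y} x ⊆ Metric.closedBall x ρ := by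
  intro y hy
  have hx : x ∈ {y | lam ≤ f y} := by
    by_contra hx
    rw [connectedComponentIn_eq_empty hx] at hy; exact hy
  have hoc := (isPreconnected_connectedComponentIn (F := {y | lam ≤ f y}) (x := x)).ordConnected
  have hsub := connectedComponentIn_subset {y | lam ≤ f y} x
  have hxm := mem_connectedComponentIn hx
  rw [Real.closedBall_eq_Icc]
  by_contra hn
  rw [mem_Icc, not_and_or, not_le, not_le] at hn
  rcases hn with hn | hn
  · have := hsub (hoc.out hy hxm ⟨hn.le, by linarith⟩)
    exact absurd (show lam ≤ f (x - ρ) from this) (not_le.2 h1)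
  · have := hsub (hoc.out hxm hy ⟨by linarith, hn.le⟩)
    exact absurd (show lam ≤ f (x + ρ) from this) (not_le.2 h2)

/-- Existence of modal constants: the quadratic bounds hold with common constants near all of the
finitely many modes, and the superlevel sets are cut off just below the modes. -/
theorem exists_modalConstants {Cα α : ℝ≥0} (hα : 0 < α) (hd : IsDensityOn f (Icc 0 1))
    (hf : ModalStructure f) (hh : HolderOnWith Cα α f (Icc 0 1)) :
    ∃ lam₀ rM Cl Cu : ℝ, ModalConstants f lam₀ rM Cl Cu := by
  have hpos : ∀ᶠ r in 𝓝[>] (0 : ℝ), 0 < r := self_mem_nhdsWithin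
  choose! c C ρ hc hC hρ hq using fun x₀ (hx : x₀ ∈ modes f) => hf.exists_quadratic hx
  obtain ⟨Cl, hCl, hCl0⟩ := (((eventually_all_finite hf.finite).2 fun x hx =>
    (Ioo_mem_nhdsGT (hc x hx) : ∀ᶠ r in 𝓝[>] (0 : ℝ), r ∈ Ioo 0 (c x))).and hpos).exists
  obtain ⟨Cu, hCu, hCu0⟩ := (((eventually_all_finite hf.finite).2 fun x _ =>
    (eventually_ge_atTop (C x) : ∀ᶠ r in atTop, C x ≤ r)).and (eventually_gt_atTop 0)).exists
  have hlim : ∀ x ∈ modes f, ∀ᶠ r in 𝓝[>] (0 : ℝ), Cl * r ^ 2 / 2 < f x / 2 := by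
    intro x hx
    have h1 : Tendsto (fun r : ℝ => Cl * r ^ 2 / 2) (𝓝[>] 0) (𝓝 0) := by
      have : Continuous fun r : ℝ => Cl * r ^ 2 / 2 := by fun_prop
      have h2 := this.tendsto 0
      norm_num at h2
      exact h2.mono_left nhdsWithin_le_nhds
    exact h1.eventually (gt_mem_nhds (half_pos (modes_pos hd.nonneg hx)))
  obtain ⟨R, ⟨hR, hR2⟩, hR0⟩ := ((((eventually_all_finite hf.finite).2 fun x hx =>
    (Ioo_mem_nhdsGT (hρ x hx) : ∀ᶠ r in 𝓝[>] (0 : ℝ), r ∈ Ioo 0 (ρ x))).and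
    ((eventually_all_finite hf.finite).2 hlim)).and hpos).exists
  obtain ⟨lam₀, hlam, hlam0⟩ := (((eventually_all_finite hf.finite).2 fun x hx =>
    (Ioo_mem_nhdsGT (half_pos (modes_pos hd.nonneg hx)) :
      ∀ᶠ r in 𝓝[>] (0 : ℝ), r ∈ Ioo 0 (f x / 2))).and hpos).exists
  have hquad : ∀ x₀ ∈ modes f, ∀ x ∈ Metric.closedBall x₀ R,
      Cl * ‖x₀ - x‖ ^ 2 ≤ f x₀ - f x ∧ f x₀ - f x ≤ Cu * ‖x₀ - x‖ ^ 2 := by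
    intro x₀ hx₀ x hx
    obtain ⟨h1, h2⟩ := hq x₀ hx₀ x (Metric.closedBall_subset_closedBall (hR x₀ hx₀).2.le hx)
    constructor
    · exact le_trans (by gcongr; exact (hCl x₀ hx₀).2.le) h1
    · exact h2.trans (by gcongr; exact hCu x₀ hx₀)
  have hsep : ∀ x₀ ∈ modes f, ∀ x₁ ∈ modes f, ∀ᶠ r in 𝓝[>] (0 : ℝ), x₀ < x₁ →
      ∃ s ∈ Ioo x₀ x₁, ∃ a b : ℝ, a < b ∧ (∀ x ∈ Metric.closedBall s r, f x ≤ a) ∧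
        (∀ x ∈ Metric.closedBall x₀ r, b ≤ f x) ∧ ∀ x ∈ Metric.closedBall x₁ r, b ≤ f x := by
    intro x₀ h₀ x₁ h₁
    by_cases hlt : x₀ < x₁
    swap
    · exact Eventually.of_forall fun _ h => absurd h hlt
    obtain ⟨s, hs, hs0, hs1⟩ := exists_valley h₀ h₁ hlt
    obtain ⟨b, hb1, hb2⟩ := exists_between (lt_min hs0 hs1)
    obtain ⟨a, ha1, ha2⟩ := exists_between hb1
    have hm0 := modes_subset_Ioo hd hf h₀
    have hm1 := modes_subset_Ioo hd hf h₁
    filter_upwards [eventually_le_on_closedBall (continuousAt_of_mem_Ioo hα hh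
        ⟨hm0.1.trans hs.1, hs.2.trans hm1.2⟩) ha1,
      eventually_ge_on_closedBall (hf.continuousAt h₀) (hb2.trans_le (min_le_left _ _)),
      eventually_ge_on_closedBall (hf.continuousAt h₁) (hb2.trans_le (min_le_right _ _))]
      with r e1 e2 e3 _
    exact ⟨s, hs, a, b, ha2, e1, e2, e3⟩
  have hrM : ∀ᶠ r in 𝓝[>] (0 : ℝ), Cu * r ^ 2 < Cl * R ^ 2 / 2 := by
    have h1 : Tendsto (fun r : ℝ => Cu * r ^ 2) (𝓝[>] 0) (𝓝 0) := by
      have : Continuous fun r : ℝ => Cu * r ^ 2 := by fun_prop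
      have h2 := this.tendsto 0
      norm_num at h2
      exact h2.mono_left nhdsWithin_le_nhds
    exact h1.eventually (gt_mem_nhds (by positivity))
  obtain ⟨rM, ⟨⟨hrM0, hrMR⟩, hrM1⟩, hrM2⟩ := (((hpos.and
    (Ioo_mem_nhdsGT hR0 : ∀ᶠ r in 𝓝[>] (0 : ℝ), r ∈ Ioo 0 R)).and hrM).and
    ((eventually_all_finite hf.finite).2 fun x₀ h₀ =>
      (eventually_all_finite hf.finite).2 (hsep x₀ h₀))).exists
  refine ⟨lam₀, rM, Cl, Cu, hlam0, hrM0, hCl0, hCu0, fun x₀ h₀ => ?_, fun x₀ h₀ x₁ h₁ hne => ?_⟩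
  · refine ⟨f x₀ - Cl * R ^ 2 / 2, ?_, ?_, ?_⟩
    · linarith [(hlam x₀ h₀).2, hR2 x₀ h₀]
    · refine ((convex_closedBall x₀ rM).isPreconnected).subset_connectedComponentIn
        (Metric.mem_closedBall_self hrM0.le) fun x hx => ?_
      have h1 := (hquad x₀ h₀ x (Metric.closedBall_subset_closedBall hrMR.2.le hx)).2
      have h2 : ‖x₀ - x‖ ≤ rM := by rw [norm_sub_rev]; exact mem_closedBall_iff_norm.1 hx
      have h3 : Cu * ‖x₀ - x‖ ^ 2 ≤ Cu * rM ^ 2 := by gcongr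
      show f x₀ - Cl * R ^ 2 / 2 ≤ f x
      linarith
    · have hR2pos : 0 < Cl * R ^ 2 := by positivity
      have hend : ∀ x, ‖x₀ - x‖ = R → f x < f x₀ - Cl * R ^ 2 / 2 := fun x hx => by
        have := (hquad x₀ h₀ x (by rw [mem_closedBall_iff_norm, norm_sub_rev, hx])).1
        rw [hx] at this
        linarith
      exact fun x hx => hquad x₀ h₀ x (connectedComponentIn_subset_closedBall hR0.le
        (hend _ (by simp [abs_of_pos hR0])) (hend _ (by simp [abs_of_pos hR0])) hx)
  · rcases lt_or_gt_of_ne hne with hlt | hlt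
    · obtain ⟨s, hs, a, b, hab, e1, e2, e3⟩ := hrM2 x₀ h₀ x₁ h₁ hlt
      refine ⟨{s}, fun γ => ?_, a, b, hab, by simpa using e1, fun x hx => hx.elim (e2 x) (e3 x)⟩
      exact mem_range_of_exists_le_of_exists_ge γ.continuous ⟨0, by simpa using hs.1.le⟩
        ⟨1, by simpa using hs.2.le⟩
    · obtain ⟨s, hs, a, b, hab, e1, e2, e3⟩ := hrM2 x₁ h₁ x₀ h₀ hlt
      refine ⟨{s}, fun γ => ?_, a, b, hab, by simpa using e1, fun x hx => hx.elim (e3 x) (e2 x)⟩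
      exact mem_range_of_exists_le_of_exists_ge γ.continuous ⟨1, by simpa using hs.1.le⟩
        ⟨0, by simpa using hs.2.le⟩

end Line

/-! ### Nearest-neighbour radii -/

section Knn

variable {E : Type*} [PseudoMetricSpace E] {n k : ℕ} {X : Fin n → E} {x : E} {r : ℝ}

theorem nonneg_of_le_cnt (hk : 1 ≤ k) (h : k ≤ cnt (Metric.closedBall x r) X) : 0 ≤ r := by
  obtain ⟨i, hi⟩ := exists_of_cnt_pos (show 0 < cnt (Metric.closedBall x r) X by omega)
  exact Metric.nonempty_closedBall.1 ⟨_, hi⟩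

theorem knnRadius_le (hk : 1 ≤ k) (h : k ≤ cnt (Metric.closedBall x r) X) :
    knnRadius X k x ≤ r :=
  csInf_le ⟨0, fun _ hr => nonneg_of_le_cnt hk hr⟩ h

theorem exists_le_cnt_closedBall (hkn : k ≤ n) (X : Fin n → E) (x : E) :
    ∃ r, k ≤ cnt (Metric.closedBall x r) X := by
  obtain ⟨R, hR⟩ := (Set.finite_range fun i => dist (X i) x).bddAbove
  refine ⟨R, hkn.trans ?_⟩
  have : {i | X i ∈ Metric.closedBall x R} = Set.univ :=
    Set.eq_univ_of_forall fun i => hR ⟨i, rfl⟩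
  rw [cnt, this]; simp [Set.ncard_univ]

/-- The infimum in the definition of the nearest-neighbour radius is attained. -/
theorem le_cnt_closedBall_knnRadius (hkn : k ≤ n) (X : Fin n → E) (x : E) :
    k ≤ cnt (Metric.closedBall x (knnRadius X k x)) X := by
  set r₀ := knnRadius X k x with hr₀
  have hev : ∀ i, ∀ᶠ r in 𝓝[>] r₀, dist (X i) x ≤ r → dist (X i) x ≤ r₀ := by
    intro i
    rcases le_or_gt (dist (X i) x) r₀ with h | h
    · exact Eventually.of_forall fun _ _ => h
    · filter_upwards [Ioo_mem_nhdsGT h] with r hr h2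
      exact absurd h2 (not_le.2 hr.2)
  obtain ⟨r, hr, hr1⟩ := ((eventually_all.2 hev).and self_mem_nhdsWithin).exists
  obtain ⟨r', hr', hr'r⟩ := exists_lt_of_csInf_lt (exists_le_cnt_closedBall hkn X x)
    (show sInf _ < r from hr1)
  refine le_trans (le_trans hr' ?_) (Set.ncard_le_ncard
    (show {i | X i ∈ Metric.closedBall x r} ⊆ {i | X i ∈ Metric.closedBall x r₀} from
      fun i hi => hr i hi) (Set.toFinite _))
  exact cnt_mono (Metric.closedBall_subset_closedBall hr'r.le) X

theorem knnRadius_le_iff (hk : 1 ≤ k) (hkn : k ≤ n) :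
    knnRadius X k x ≤ r ↔ k ≤ cnt (Metric.closedBall x r) X :=
  ⟨fun h => (le_cnt_closedBall_knnRadius hkn X x).trans
    (cnt_mono (Metric.closedBall_subset_closedBall h) X), knnRadius_le hk⟩

end Knn

/-! ### The single mode in arbitrary dimension -/

section Conditional

variable {E : Type*} [PseudoMetricSpace E] [MeasurableSpace E] [OpensMeasurableSpace E]
  [SecondCountableTopology E] {n : ℕ} (μ : Measure E) [IsProbabilityMeasure μ]

theorem measurable_cnt_closedBall (i : Fin n) (r : ℝ) :
    Measurable fun X : Fin n → E => cnt (Metric.closedBall (X i) r) X := by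
  classical
  simp only [cnt_eq_sum, Metric.mem_closedBall]
  refine Finset.measurable_sum _ fun j _ => Measurable.ite ?_ measurable_const measurable_const
  exact measurableSet_le ((measurable_pi_apply j).dist (measurable_pi_apply i)) measurable_const

/-- Conditionally on the `i`-th observation, the number of the other ones in a ball around it is
binomial. -/
theorem pi_mem_and_le_cnt_closedBall_le (i : Fin (n + 1)) {C : Set E} (hC : MeasurableSet C)
    {r b : ℝ} {T : ℕ} (hr : 0 ≤ r)
    (h : ∀ x ∈ C, binTail n (μ.real (Metric.closedBall x r)) T ≤ b) :
    Measure.pi (fun _ : Fin (n + 1) => μ)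
      {X | X i ∈ C ∧ T + 1 ≤ cnt (Metric.closedBall (X i) r) X} ≤ ENNReal.ofReal b := by
  classical
  have hm : MeasurableSet
      {X : Fin (n + 1) → E | X i ∈ C ∧ T + 1 ≤ cnt (Metric.closedBall (X i) r) X} :=
    (measurable_pi_apply i hC).inter (measurable_cnt_closedBall i r measurableSet_Ici)
  rw [pi_succ_apply μ i hm]
  refine (lintegral_mono (g := fun _ => ENNReal.ofReal b) fun x => ?_).trans (by simp)
  by_cases hx : x ∈ C
  · refine le_trans (measure_mono ?_) ((pi_le_cnt μ
      (Metric.isClosed_closedBall (x := x) (ε := r)).measurableSet n T).le.trans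
      (ENNReal.ofReal_le_ofReal (h x hx)))
    intro Y hY
    have := hY.2
    rw [Fin.insertNth_apply_same, cnt_insertNth, if_pos (Metric.mem_closedBall_self hr)] at this
    show T ≤ _
    omega
  · have : {Y : Fin n → E | (i.insertNth x Y : Fin (n + 1) → E) ∈
        {X : Fin (n + 1) → E | X i ∈ C ∧ T + 1 ≤ cnt (Metric.closedBall (X i) r) X}} = ∅ := by
      ext Y; simp [hx]
    rw [this]; simp

theorem pi_mem_and_cnt_closedBall_le_le (i : Fin (n + 1)) {C : Set E} (hC : MeasurableSet C)
    {r b : ℝ} {T : ℕ} (hr : 0 ≤ r)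
    (h : ∀ x ∈ C, 1 - binTail n (μ.real (Metric.closedBall x r)) T ≤ b) :
    Measure.pi (fun _ : Fin (n + 1) => μ)
      {X | X i ∈ C ∧ cnt (Metric.closedBall (X i) r) X < T} ≤ ENNReal.ofReal b := by
  classical
  have hm : MeasurableSet
      {X : Fin (n + 1) → E | X i ∈ C ∧ cnt (Metric.closedBall (X i) r) X < T} :=
    (measurable_pi_apply i hC).inter (measurable_cnt_closedBall i r measurableSet_Iio)
  rw [pi_succ_apply μ i hm]
  refine (lintegral_mono (g := fun _ => ENNReal.ofReal b) fun x => ?_).trans (by simp)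
  by_cases hx : x ∈ C
  · refine le_trans (measure_mono ?_) ((pi_cnt_lt μ
      (Metric.isClosed_closedBall (x := x) (ε := r)).measurableSet n T).le.trans
      (ENNReal.ofReal_le_ofReal (h x hx)))
    intro Y hY
    have := hY.2
    rw [Fin.insertNth_apply_same, cnt_insertNth, if_pos (Metric.mem_closedBall_self hr)] at this
    show _ < T
    omega
  · have : {Y : Fin n → E | (i.insertNth x Y : Fin (n + 1) → E) ∈
        {X : Fin (n + 1) → E | X i ∈ C ∧ cnt (Metric.closedBall (X i) r) X < T}} = ∅ := by
      ext Y; simp [hx]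
    rw [this]; simp

/-- If all balls of radius `r` centred near `x₀` have more expected points than `k`, and all those
centred at distance at least `h` from `x₀` have fewer, by a relative margin of order `t`, then the
mode estimate is within distance `h` of `x₀` with high probability. -/
theorem pi_modeEstimate_le {x₀ : E} {k : ℕ} {h h' r t : ℝ} (hr : 0 ≤ r) (ht0 : 0 < t)
    (ht1 : t ≤ 1 / 4) (hkt : 4 ≤ k * t)
    (hout : ∀ z, h ≤ dist z x₀ → (n + 1) * μ.real (Metric.closedBall z r) ≤ k * (1 - 2 * t))
    (hin : ∀ z ∈ Metric.closedBall x₀ h',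
      k * (1 + t / 2) ≤ (n + 1) * μ.real (Metric.closedBall z r))
    (hne : k / 2 ≤ (n + 1) * μ.real (Metric.closedBall x₀ h')) :
    Measure.pi (fun _ : Fin (n + 1) => μ)
      {X | ∃ xhat, IsModeEstimate k X xhat ∧ h ≤ dist xhat x₀}
      ≤ ENNReal.ofReal ((2 * (n + 1) + 1) * Real.exp (-(t ^ 2 * k / 128))) := by
  have hk16 : (16 : ℝ) ≤ k := by nlinarith
  have hk : 1 ≤ k := by
    have : (1 : ℝ) ≤ k := by linarith
    exact_mod_cast this
  set P := Measure.pi (fun _ : Fin (n + 1) => μ) with hP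
  set b := Real.exp (-(t ^ 2 * k / 128)) with hb
  have hq0 : ∀ z, 0 ≤ μ.real (Metric.closedBall z r) := fun _ => measureReal_nonneg
  have hq1 : ∀ z, μ.real (Metric.closedBall z r) ≤ 1 := fun _ => measureReal_le_one
  have hexp : ∀ u : ℝ, t ^ 2 * k / 128 ≤ u → Real.exp (-u) ≤ b := fun u hu =>
    Real.exp_le_exp.2 (by linarith)
  have ht2k : 0 ≤ t ^ 2 * k := by positivity
  -- sample points at distance at least `h`
  have h1 : ∀ i : Fin (n + 1), P {X | X i ∈ {z | h ≤ dist z x₀} ∧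
      k - 1 + 1 ≤ cnt (Metric.closedBall (X i) r) X} ≤ ENNReal.ofReal b := by
    intro i
    refine pi_mem_and_le_cnt_closedBall_le μ i
      (measurableSet_le measurable_const (measurable_id.dist measurable_const)) hr fun z hz => ?_
    refine (binTail_le_exp (m := k * (1 - 2 * t)) (s := k * t) (hq0 z) (hq1 z) (by nlinarith) ?_
      (by positivity) (by nlinarith) ?_).trans (hexp _ ?_)
    · linarith [hout z hz, hq0 z]
    · rw [Nat.cast_sub hk]; push_cast; linarith [hout z hz, hq0 z]
    · rw [le_div_iff₀ (by nlinarith)]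
      nlinarith [mul_nonneg ht2k (Nat.cast_nonneg (α := ℝ) k)]
  -- sample points near `x₀`
  have h2 : ∀ i : Fin (n + 1), P {X | X i ∈ Metric.closedBall x₀ h' ∧
      cnt (Metric.closedBall (X i) r) X < k} ≤ ENNReal.ofReal b := by
    intro i
    refine pi_mem_and_cnt_closedBall_le_le μ i Metric.isClosed_closedBall.measurableSet hr
      fun z hz => ?_
    refine (one_sub_binTail_le_exp (m := k * (1 + t / 4)) (s := k * t / 4) (hq0 z) (hq1 z)
      (by positivity) ?_ (by positivity) (by nlinarith) (by linarith)).trans (hexp _ ?_)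
    · linarith [hin z hz, hq1 z]
    · rw [le_div_iff₀ (by positivity)]
      nlinarith [mul_nonneg ht2k (Nat.cast_nonneg (α := ℝ) k)]
  -- existence of sample points near `x₀`
  have h3 : P {X | cnt (Metric.closedBall x₀ h') X < 1} ≤ ENNReal.ofReal b := by
    rw [hP, pi_cnt_lt μ Metric.isClosed_closedBall.measurableSet]
    refine ENNReal.ofReal_le_ofReal ((one_sub_binTail_le_exp (m := k / 2) (s := k / 4)
      measureReal_nonneg measureReal_le_one (by positivity) (by push_cast; exact hne)
      (by positivity) (by linarith) (by push_cast; linarith)).trans (hexp _ ?_))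
    rw [le_div_iff₀ (by positivity)]
    have ht2 : t ^ 2 ≤ 1 := by nlinarith
    nlinarith [mul_le_mul_of_nonneg_right ht2 (sq_nonneg (k : ℝ))]
  have hsub : {X : Fin (n + 1) → E | ∃ xhat, IsModeEstimate k X xhat ∧ h ≤ dist xhat x₀} ⊆
      ((⋃ i, {X | X i ∈ {z | h ≤ dist z x₀} ∧
        k - 1 + 1 ≤ cnt (Metric.closedBall (X i) r) X}) ∪
      ⋃ i, {X | X i ∈ Metric.closedBall x₀ h' ∧ cnt (Metric.closedBall (X i) r) X < k}) ∪
      {X | cnt (Metric.closedBall x₀ h') X < 1} := by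
    rintro X ⟨_, ⟨i, rfl, hi⟩, hd⟩
    by_contra hX
    simp only [mem_union, mem_iUnion, not_or, not_exists] at hX
    obtain ⟨⟨g1, g2⟩, g3⟩ := hX
    obtain ⟨j, hj⟩ := exists_of_cnt_pos (A := Metric.closedBall x₀ h') (X := X)
      (by have : ¬ cnt (Metric.closedBall x₀ h') X < 1 := g3
          omega)
    have hj2 : k ≤ cnt (Metric.closedBall (X j) r) X := by
      by_contra hlt
      exact g2 j ⟨hj, by omega⟩
    have hkn : k ≤ n + 1 := hj2.trans (cnt_le _ _)
    have hi2 := (knnRadius_le_iff hk hkn).1 ((hi j).trans (knnRadius_le hk hj2))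
    exact g1 i ⟨hd, by omega⟩
  have hb0 : 0 ≤ b := (Real.exp_pos _).le
  calc P _ ≤ _ := measure_mono hsub
    _ ≤ (∑ i : Fin (n + 1), ENNReal.ofReal b + ∑ i : Fin (n + 1), ENNReal.ofReal b)
        + ENNReal.ofReal b := by
      refine (measure_union_le _ _).trans (add_le_add ((measure_union_le _ _).trans
        (add_le_add ?_ ?_)) h3)
      · exact (measure_iUnion_fintype_le _ _).trans (Finset.sum_le_sum fun i _ => h1 i)
      · exact (measure_iUnion_fintype_le _ _).trans (Finset.sum_le_sum fun i _ => h2 i)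
    _ = _ := by
      rw [← ENNReal.ofReal_sum_of_nonneg fun _ _ => hb0,
        ← ENNReal.ofReal_add (Finset.sum_nonneg fun _ _ => hb0) (Finset.sum_nonneg fun _ _ => hb0),
        ← ENNReal.ofReal_add (add_nonneg (Finset.sum_nonneg fun _ _ => hb0)
          (Finset.sum_nonneg fun _ _ => hb0)) hb0]
      congr 1
      simp only [Finset.sum_const, Finset.card_univ, Fintype.card_fin, nsmul_eq_mul]
      push_cast; ring

end Conditional

section Law

variable {E : Type*} [MeasureSpace E] {f : E → ℝ} {S A : Set E}

theorem IsDensityOn.isProbabilityMeasure (h : IsDensityOn f S) : IsProbabilityMeasure (law f) :=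
  ⟨by rw [law, withDensity_apply _ MeasurableSet.univ, setLIntegral_univ, h.lintegral_eq_one]⟩

theorem law_real_le {a : ℝ} (hA : MeasurableSet A) (hv : volume A ≠ ∞)
    (ha0 : 0 ≤ a) (ha : ∀ x ∈ A, f x ≤ a) : (law f).real A ≤ a * volume.real A := by
  refine ENNReal.toReal_le_of_le_ofReal (by positivity) ?_
  rw [law, withDensity_apply _ hA, ENNReal.ofReal_mul ha0, ofReal_measureReal hv]
  calc _ ≤ ∫⁻ _ in A, ENNReal.ofReal a :=
        setLIntegral_mono' hA fun x hx => ENNReal.ofReal_le_ofReal (ha x hx)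
    _ = _ := by rw [setLIntegral_const]

theorem le_law_real {a : ℝ} (hd : IsDensityOn f S) (hA : MeasurableSet A)
    (hv : volume A ≠ ∞) (ha0 : 0 ≤ a) (ha : ∀ x ∈ A, a ≤ f x) :
    a * volume.real A ≤ (law f).real A := by
  have := hd.isProbabilityMeasure
  rw [measureReal_def (law f), ← ENNReal.ofReal_le_iff_le_toReal (measure_ne_top _ _), law,
    withDensity_apply _ hA, ENNReal.ofReal_mul ha0, ofReal_measureReal hv]
  calc _ = ∫⁻ _ in A, ENNReal.ofReal a := by rw [setLIntegral_const]
    _ ≤ _ := setLIntegral_mono' hA fun x hx => ENNReal.ofReal_le_ofReal (ha x hx)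

theorem law_compl_eq_zero (hd : IsDensityOn f S) (hS : MeasurableSet S) : law f Sᶜ = 0 := by
  rw [law, withDensity_apply _ hS.compl]
  refine (setLIntegral_congr_fun hS.compl (g := fun _ => 0) fun x hx => ?_).trans (by simp)
  simp [hd.eq_zero x hx]

/-- Almost surely all observations lie in the domain of the density. -/
theorem sampleLaw_exists_notMem (hd : IsDensityOn f S) (hS : MeasurableSet S) (n : ℕ) :
    sampleLaw f n {X | ∃ i, X i ∉ S} = 0 := by
  have := hd.isProbabilityMeasure
  have : {X : Fin n → E | ∃ i, X i ∉ S} = ⋃ i, (fun X => X i) ⁻¹' Sᶜ := by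
    ext; simp
  rw [this]
  refine measure_iUnion_null fun i => ?_
  rw [sampleLaw, (measurePreserving_eval (fun _ : Fin n => law f) i).measure_preimage
    hS.compl.nullMeasurableSet]
  exact law_compl_eq_zero hd hS

end Law

section Euclidean

variable {D : ℕ} {f : EuclideanSpace ℝ (Fin D) → ℝ} {S : Set (EuclideanSpace ℝ (Fin D))}
  {Cα α : ℝ≥0}

/-- Superlevel sets at positive levels are compact: on an unbounded domain, a uniformly continuous
integrable function vanishes at infinity. -/
theorem isCompact_superlevel (hα : 0 < α) (hS : IsCompact S ∨ S = Set.univ)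
    (hd : IsDensityOn f S) (hh : HolderOnWith Cα α f S) {t : ℝ} (ht : 0 < t) :
    IsCompact {x | t ≤ f x} := by
  have hsub : {x | t ≤ f x} ⊆ S := by
    intro x hx
    by_contra hxS
    have : t ≤ f x := hx
    rw [hd.eq_zero x hxS] at this
    linarith
  have hSc : IsClosed S := by
    rcases hS with h | h
    · exact h.isClosed
    · rw [h]; exact isClosed_univ
  have hcl : IsClosed {x | t ≤ f x} := by
    have := (hh.continuousOn hα).preimage_isClosed_of_isClosed hSc (isClosed_Ici (a := t))
    have he : {x | t ≤ f x} = S ∩ f ⁻¹' Ici t :=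
      Set.ext fun x => ⟨fun hx => ⟨hsub hx, hx⟩, fun hx => hx.2⟩
    rwa [he]
  rcases hS with h | rfl
  · exact h.of_isClosed_subset hcl hsub
  refine Metric.isCompact_of_isClosed_isBounded hcl ?_
  have huc := (holderOnWith_univ.1 hh).uniformContinuous hα
  obtain ⟨r, hr, hfr⟩ := Metric.uniformContinuous_iff.1 huc (t / 2) (by positivity)
  have := hd.isProbabilityMeasure
  set V := volume.real (Metric.closedBall (0 : EuclideanSpace ℝ (Fin D)) (r / 2)) with hV
  have hVpos : 0 < V := by
    refine ENNReal.toReal_pos (Metric.measure_closedBall_pos _ _ (by positivity)).ne'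
      measure_closedBall_lt_top.ne
  obtain ⟨K, -, hK, hKm⟩ := MeasurableSet.univ.exists_isCompact_sdiff_lt
    (measure_ne_top (law f) univ) (ε := ENNReal.ofReal (t / 2 * V))
    (by rw [Ne, ENNReal.ofReal_eq_zero, not_le]; positivity)
  obtain ⟨R, hR⟩ := hK.isBounded.subset_closedBall (0 : EuclideanSpace ℝ (Fin D))
  refine Metric.isBounded_closedBall.subset (t := Metric.closedBall 0 (R + r)) fun x hx => ?_
  by_contra hxn
  rw [mem_closedBall_zero_iff, not_le] at hxn
  have hb : Metric.closedBall x (r / 2) ⊆ univ \ K := by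
    intro y hy
    refine ⟨trivial, fun hyK => ?_⟩
    have h1 := mem_closedBall_zero_iff.1 (hR hyK)
    have h2 := mem_closedBall_iff_norm.1 hy
    have h3 := norm_sub_norm_le x y
    rw [norm_sub_rev] at h3
    linarith
  have hlow : t / 2 * V ≤ (law f).real (Metric.closedBall x (r / 2)) := by
    have := le_law_real hd (A := Metric.closedBall x (r / 2)) (a := t / 2)
      Metric.isClosed_closedBall.measurableSet measure_closedBall_lt_top.ne (by positivity) ?_
    · rwa [measureReal_def, Measure.addHaar_closedBall_center, ← measureReal_def] at this
    · intro y hy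
      have h1 := hfr (a := y) (b := x) (by
        have := Metric.mem_closedBall.1 hy
        linarith)
      rw [Real.dist_eq] at h1
      have h2 := (abs_lt.1 h1).1
      have h3 : t ≤ f x := hx
      linarith
  have h4 := (ENNReal.ofReal_le_iff_le_toReal (measure_ne_top _ _)).2 hlow
  exact absurd (h4.trans (measure_mono hb)) (not_le.2 hKm)

/-- A density with a single mode decays at least quadratically near the mode and stays away from
its maximum elsewhere. -/
theorem exists_global_quadratic (hD : 1 ≤ D) (hα : 0 < α) (hS : IsCompact S ∨ S = Set.univ)
    (hd : IsDensityOn f S) (hf : ModalStructure f) (hh : HolderOnWith Cα α f S)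
    {x₀ : EuclideanSpace ℝ (Fin D)} (hm : modes f = {x₀}) :
    ∃ c C ρ : ℝ, 0 < c ∧ 0 < C ∧ 0 < ρ ∧ (∀ x, c * min (dist x x₀) ρ ^ 2 ≤ f x₀ - f x) ∧
      ∀ x ∈ Metric.closedBall x₀ ρ, f x₀ - f x ≤ C * dist x x₀ ^ 2 := by
  have : Nonempty (Fin D) := ⟨⟨0, hD⟩⟩
  have hx₀ : x₀ ∈ modes f := by rw [hm]; exact mem_singleton _
  have hpos := modes_pos hd.nonneg hx₀
  have hcont : ∀ {t : ℝ}, 0 < t → ContinuousOn f {x | t ≤ f x} := fun ht =>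
    (hh.continuousOn hα).mono fun x hx => by
      by_contra hxS
      have h1 : _ ≤ f x := hx
      rw [hd.eq_zero x hxS] at h1
      linarith
  have heq : ∀ {x}, (∀ y, f y ≤ f x) → x = x₀ := fun {x} hx => by
    have := hf.mem_modes_of_max_on_component fun u (_ : u ∈ connectedComponentIn _ x) => hx u
    rwa [hm] at this
  have hmax : ∀ y, f y ≤ f x₀ := by
    obtain ⟨x₁, hx₁, h₁⟩ := (isCompact_superlevel hα hS hd hh hpos).exists_isMaxOn
      ⟨x₀, le_refl (f x₀)⟩ (hcont hpos)
    have hg : ∀ y, f y ≤ f x₁ := fun y => by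
      rcases le_total (f x₀) (f y) with hy | hy
      · exact h₁ hy
      · exact hy.trans hx₁
    rw [heq hg] at hg
    exact hg
  have hlt : ∀ y, y ≠ x₀ → f y < f x₀ := fun y hy =>
    lt_of_le_of_ne (hmax y) fun he => hy (heq (by rwa [he]))
  obtain ⟨c, C, ρ, hc, hC, hρ, hq⟩ := hf.exists_quadratic hx₀
  obtain ⟨ε, hε, hε2⟩ : ∃ ε > 0, ∀ y, ρ ≤ dist y x₀ → f y ≤ f x₀ - ε := by
    have hK : IsCompact ({x | f x₀ / 2 ≤ f x} ∩ {y | ρ ≤ dist y x₀}) :=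
      (isCompact_superlevel hα hS hd hh (half_pos hpos)).inter_right
        (isClosed_le continuous_const (by fun_prop))
    rcases ({x | f x₀ / 2 ≤ f x} ∩ {y | ρ ≤ dist y x₀}).eq_empty_or_nonempty with he | hne
    · refine ⟨f x₀ / 2, half_pos hpos, fun y hy => ?_⟩
      by_contra hlt2
      have : y ∈ ({x | f x₀ / 2 ≤ f x} ∩ {y | ρ ≤ dist y x₀}) :=
        ⟨by show f x₀ / 2 ≤ f y
            linarith, hy⟩
      rw [he] at this; exact this
    · obtain ⟨x₂, hx₂, h₂⟩ := hK.exists_isMaxOn hne ((hcont (half_pos hpos)).mono inter_subset_left)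
      have hx₂' : x₂ ≠ x₀ := by
        rintro rfl
        have : ρ ≤ dist x₂ x₂ := hx₂.2
        rw [dist_self] at this; linarith
      refine ⟨min (f x₀ - f x₂) (f x₀ / 2), lt_min (sub_pos.2 (hlt _ hx₂')) (half_pos hpos),
        fun y hy => ?_⟩
      by_cases hy2 : f x₀ / 2 ≤ f y
      · have h1 : f y ≤ f x₂ := h₂ ⟨hy2, hy⟩
        linarith [min_le_left (f x₀ - f x₂) (f x₀ / 2)]
      · linarith [min_le_right (f x₀ - f x₂) (f x₀ / 2)]
  refine ⟨min c (ε / ρ ^ 2), C, ρ, lt_min hc (by positivity), hC, hρ, fun x => ?_, fun x hx => ?_⟩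
  · rcases le_total (dist x x₀) ρ with hx | hx
    · rw [min_eq_left hx]
      have := (hq x hx).1
      rw [← dist_eq_norm, dist_comm] at this
      exact le_trans (by gcongr; exact min_le_left _ _) this
    · rw [min_eq_right hx]
      have h1 : min c (ε / ρ ^ 2) * ρ ^ 2 ≤ ε / ρ ^ 2 * ρ ^ 2 := by
        gcongr; exact min_le_right _ _
      rw [div_mul_cancel₀ _ (by positivity)] at h1
      linarith [hε2 x hx]
  · have := (hq x hx).2
    rwa [← dist_eq_norm, dist_comm] at this

theorem volume_real_closedBall (hD : 1 ≤ D) (x : EuclideanSpace ℝ (Fin D)) {r : ℝ} (hr : 0 ≤ r) :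
    volume.real (Metric.closedBall x r)
      = r ^ D * volume.real (Metric.ball (0 : EuclideanSpace ℝ (Fin D)) 1) := by
  have : Nonempty (Fin D) := ⟨⟨0, hD⟩⟩
  rw [measureReal_def, Measure.addHaar_closedBall _ _ hr, ENNReal.toReal_mul, finrank_euclideanSpace,
    Fintype.card_fin, ENNReal.toReal_ofReal (by positivity), ← measureReal_def]

theorem mul_sq_le_of_global_quadratic (hD : 1 ≤ D) (hd : IsDensityOn f S)
    {x₀ : EuclideanSpace ℝ (Fin D)} {c ρ m : ℝ}
    (hlow : ∀ x, c * min (dist x x₀) ρ ^ 2 ≤ f x₀ - f x) (hm : 0 ≤ m) (hmρ : m ≤ ρ) :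
    c * m ^ 2 ≤ f x₀ := by
  have : Nonempty (Fin D) := ⟨⟨0, hD⟩⟩
  obtain ⟨u, hu⟩ := exists_norm_eq (EuclideanSpace ℝ (Fin D)) hm
  have h1 := hlow (x₀ + u)
  rw [dist_eq_norm, add_sub_cancel_left, hu, min_eq_left hmρ] at h1
  linarith [hd.nonneg (x₀ + u)]

/-- The error bound for the single mode at a fixed sample size: `y` is `n ^ (1 / (4 + D))`, `hm` is
the distance to be excluded, cut off at `ρ`, and `η * hm` is the radius of the region around the
mode where sample points with small radius are found. -/
theorem sampleLaw_modeEstimate_le (hD : 1 ≤ D) (hd : IsDensityOn f S)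
    {x₀ : EuclideanSpace ℝ (Fin D)} {c C ρ : ℝ} (hc : 0 < c) (hC : 0 < C) (hf0 : 0 < f x₀)
    (hlow : ∀ x, c * min (dist x x₀) ρ ^ 2 ≤ f x₀ - f x)
    (hup : ∀ x ∈ Metric.closedBall x₀ ρ, f x₀ - f x ≤ C * dist x x₀ ^ 2)
    {η : ℝ} (hη0 : 0 < η) (hη1 : η ≤ 1 / 2) (hη2 : 192 * C * η ^ 2 ≤ c)
    {n k : ℕ} {y h hm t : ℝ} (hn : 0 < n) (hy : 0 < y) (hny : (n : ℝ) = y ^ (4 + D))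
    (hk2 : k ≤ 2 * y ^ 4) (hhm : 0 < hm) (hhm1 : hm ≤ h) (hhm2 : hm ≤ ρ)
    (ht : t = c / (12 * f x₀) * hm ^ 2) (hkt : 4 ≤ k * t)
    (hA : 4 ≤ (η * hm * y) ^ D * (volume.real (Metric.ball (0 : EuclideanSpace ℝ (Fin D)) 1)
      * f x₀)) :
    sampleLaw f n {X | ∃ xhat, IsModeEstimate k X xhat ∧ h ≤ dist xhat x₀}
      ≤ ENNReal.ofReal ((2 * n + 1) * Real.exp (-(t ^ 2 * k / 128))) := by
  have := hd.isProbabilityMeasure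
  set v := volume.real (Metric.ball (0 : EuclideanSpace ℝ (Fin D)) 1) with hv
  set f0 := f x₀ with hf0'
  have hv0 : 0 < v := ENNReal.toReal_pos (Metric.measure_ball_pos _ _ one_pos).ne'
      measure_ball_lt_top.ne
  have hn' : (0 : ℝ) < n := by exact_mod_cast hn
  have ht0 : 0 < t := by rw [ht]; positivity
  have hct : c * hm ^ 2 = 12 * f0 * t := by rw [ht]; field_simp
  have ht1 : t ≤ 1 / 12 := by
    have h1 := mul_sq_le_of_global_quadratic hD hd hlow hhm.le hhm2
    rw [hct] at h1
    by_contra h3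
    nlinarith
  have hD0 : D ≠ 0 := by omega
  set r : ℝ := (k * (1 + t) / (n * v * f0)) ^ ((D : ℝ)⁻¹) with hr
  have hr0 : 0 ≤ r := by positivity
  have hrD : r ^ D = k * (1 + t) / (n * v * f0) := by
    rw [hr]; exact Real.rpow_inv_natCast_pow (by positivity) hD0
  have hrDf : n * (v * r ^ D * f0) = k * (1 + t) := by rw [hrD]; field_simp
  have hrη : r ≤ η * hm := by
    refine le_of_pow_le_pow_left₀ hD0 (by positivity) ?_
    rw [hrD, div_le_iff₀ (by positivity), hny]
    have h1 : (y : ℝ) ^ 4 * 4 ≤ y ^ 4 * ((η * hm * y) ^ D * (v * f0)) := by gcongr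
    have h2 : (k : ℝ) * (1 + t) ≤ 2 * y ^ 4 * 2 := by gcongr; linarith
    calc (k : ℝ) * (1 + t) ≤ y ^ 4 * ((η * hm * y) ^ D * (v * f0)) := by linarith
      _ = _ := by rw [mul_pow (η * hm)]; ring
  have hball : ∀ z : EuclideanSpace ℝ (Fin D), MeasurableSet (Metric.closedBall z r) := fun z =>
    Metric.isClosed_closedBall.measurableSet
  have hvol : ∀ z : EuclideanSpace ℝ (Fin D), volume.real (Metric.closedBall z r) = r ^ D * v := fun z =>
    volume_real_closedBall hD z hr0
  have hmη : hm * η ≤ hm * (1 / 2) := by gcongr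
  have hout : ∀ z, h ≤ dist z x₀ → n * (law f).real (Metric.closedBall z r) ≤ k * (1 - 2 * t) := by
    intro z hz
    have h1 := law_real_le (f := f) (A := Metric.closedBall z r) (a := f0 * (1 - 3 * t)) (hball z)
      measure_closedBall_lt_top.ne (mul_nonneg hf0.le (by linarith)) (fun x hx => by
        have g1 : hm / 2 ≤ min (dist x x₀) ρ := by
          refine le_min ?_ (by linarith)
          have := dist_triangle z x x₀
          have := Metric.mem_closedBall'.1 hx
          linarith
        have g2 : c * (hm / 2) ^ 2 ≤ c * min (dist x x₀) ρ ^ 2 := by gcongr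
        linarith [hlow x])
    rw [hvol] at h1
    calc n * (law f).real (Metric.closedBall z r) ≤ n * (f0 * (1 - 3 * t) * (r ^ D * v)) := by
          gcongr
      _ = n * (v * r ^ D * f0) * (1 - 3 * t) := by ring
      _ = k * (1 + t) * (1 - 3 * t) := by rw [hrDf]
      _ ≤ k * (1 - 2 * t) := by nlinarith
  have hin : ∀ z ∈ Metric.closedBall x₀ (η * hm),
      k * (1 + t / 2) ≤ n * (law f).real (Metric.closedBall z r) := by
    intro z hz
    have h1 := le_law_real hd (A := Metric.closedBall z r) (a := f0 * (1 - t / 4)) (hball z)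
      measure_closedBall_lt_top.ne (mul_nonneg hf0.le (by linarith)) (fun x hx => by
        have g1 : dist x x₀ ≤ 2 * (η * hm) := by
          have := dist_triangle x z x₀
          have := Metric.mem_closedBall.1 hx
          have := Metric.mem_closedBall.1 hz
          linarith
        have g2 := hup x (by rw [Metric.mem_closedBall]; linarith)
        have g3 : C * dist x x₀ ^ 2 ≤ C * (2 * (η * hm)) ^ 2 := by gcongr
        have g4 : 192 * C * η ^ 2 * hm ^ 2 ≤ c * hm ^ 2 := by gcongr
        nlinarith)
    rw [hvol] at h1
    calc (k : ℝ) * (1 + t / 2) ≤ k * (1 + t) * (1 - t / 4) := by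
          nlinarith [mul_nonneg (Nat.cast_nonneg (α := ℝ) k) ht0.le]
      _ = n * (v * r ^ D * f0) * (1 - t / 4) := by rw [hrDf]
      _ = n * (f0 * (1 - t / 4) * (r ^ D * v)) := by ring
      _ ≤ _ := by gcongr
  have hne : k / 2 ≤ n * (law f).real (Metric.closedBall x₀ (η * hm)) := by
    have hmono := measureReal_mono (μ := law f) (Metric.closedBall_subset_closedBall (x := x₀) hrη)
    calc (k : ℝ) / 2 ≤ k * (1 + t / 2) := by nlinarith
      _ ≤ _ := hin x₀ (Metric.mem_closedBall_self (by positivity))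
      _ ≤ _ := by gcongr
  obtain ⟨m, rfl⟩ := Nat.exists_eq_succ_of_ne_zero hn.ne'
  have := pi_modeEstimate_le (law f) (x₀ := x₀) (k := k) (h := h) (h' := η * hm) (r := r) (t := t)
    hr0 ht0 (by linarith) hkt (by exact_mod_cast hout) (by exact_mod_cast hin)
    (by exact_mod_cast hne)
  exact_mod_cast this

end Euclidean

set_option maxHeartbeats 800000 in
theorem exists_sampleLaw_modeEstimate_le {D : ℕ} (hD : 1 ≤ D) {f : EuclideanSpace ℝ (Fin D) → ℝ}
    {S : Set (EuclideanSpace ℝ (Fin D))} {x₀ : EuclideanSpace ℝ (Fin D)} {Cα α : ℝ≥0} (hα : 0 < α)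
    (hS : IsCompact S ∨ S = Set.univ) (hd : IsDensityOn f S) (hf : ModalStructure f)
    (hh : HolderOnWith Cα α f S) (hm : modes f = {x₀}) {δ₀ : ℝ} (hδ₀ : δ₀ < 1) :
    ∃ N : ℕ, ∀ n : ℕ, N ≤ n → ∀ δ : ℝ, 0 < δ → δ ≤ δ₀ →
      (IsCompact S ∨ Real.log n * Real.log (1 / δ) ≤ (n : ℝ) ^ (4 / (4 + D) : ℝ)) →
      sampleLaw f n {X | ∃ xhat, IsModeEstimate ⌈(n : ℝ) ^ (4 / (4 + D) : ℝ)⌉₊ X xhat ∧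
        √(Real.log (1 / δ)) * Real.log n / (n : ℝ) ^ (1 / (4 + D) : ℝ) ≤ ‖xhat - x₀‖}
        ≤ ENNReal.ofReal δ := by
  rcases le_or_gt δ₀ 0 with hδ | hδ
  · exact ⟨0, fun n _ δ h1 h2 => by linarith⟩
  have : Nonempty (Fin D) := ⟨⟨0, hD⟩⟩
  have hf0 : 0 < f x₀ := modes_pos hd.nonneg (by rw [hm]; exact mem_singleton _)
  obtain ⟨c, C, ρ, hc, hC, hρ, hlow, hup⟩ := exists_global_quadratic hD hα hS hd hf hh hm
  set L₀ := Real.log (1 / δ₀) with hL₀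
  have hL₀pos : 0 < L₀ := Real.log_pos (by rw [lt_div_iff₀ hδ]; linarith)
  set v := volume.real (Metric.ball (0 : EuclideanSpace ℝ (Fin D)) 1) with hv
  have hv0 : 0 < v := ENNReal.toReal_pos (Metric.measure_ball_pos _ _ one_pos).ne'
      measure_ball_lt_top.ne
  -- the inner region is so small that the density is nearly constant on it
  obtain ⟨η, hη0, hη1, hη2⟩ : ∃ η : ℝ, 0 < η ∧ η ≤ 1 / 2 ∧ 192 * C * η ^ 2 ≤ c := by
    refine ⟨min (1 / 2) √(c / (192 * C)), by positivity, min_le_left _ _, ?_⟩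
    have h1 : min (1 / 2) √(c / (192 * C)) ^ 2 ≤ √(c / (192 * C)) ^ 2 := by
      gcongr; exact min_le_right _ _
    rw [Real.sq_sqrt (by positivity), le_div_iff₀ (by positivity)] at h1
    linarith
  set a := c / (12 * f x₀) with ha
  have ha0 : 0 < a := by positivity
  set A : ℝ := (4 / (v * f x₀)) ^ ((D : ℝ)⁻¹) with hA
  have hAD : A ^ D = 4 / (v * f x₀) :=
    Real.rpow_inv_natCast_pow (by positivity) (by omega)
  obtain ⟨R, hR0, hR⟩ : ∃ R : ℝ, 0 < R ∧ (IsCompact S → ∀ x ∈ S, dist x x₀ < R) := by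
    by_cases hc : IsCompact S
    · obtain ⟨R, hR⟩ := hc.isBounded.subset_ball x₀
      exact ⟨max R 1, by positivity, fun _ x hx => (hR hx).trans_le (le_max_left _ _)⟩
    · exact ⟨1, one_pos, fun h => absurd h hc⟩
  set y : ℕ → ℝ := fun n => (n : ℝ) ^ (1 / (4 + D) : ℝ) with hy
  have hyt : Tendsto y atTop atTop :=
    (tendsto_rpow_atTop (by positivity)).comp tendsto_natCast_atTop_atTop
  have hlt : Tendsto (fun n : ℕ => Real.log n) atTop atTop :=
    Real.tendsto_log_atTop.comp tendsto_natCast_atTop_atTop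
  have hy4 : ∀ n : ℕ, (n : ℝ) ^ (4 / (4 + D) : ℝ) = y n ^ 4 := by
    intro n
    rw [hy, ← Real.rpow_natCast, ← Real.rpow_mul (by positivity)]
    norm_num; ring_nf
  have hyD : ∀ n : ℕ, (n : ℝ) = y n ^ (4 + D) := by
    intro n
    rw [hy, ← Real.rpow_natCast, ← Real.rpow_mul (by positivity)]
    push_cast
    rw [one_div, inv_mul_cancel₀ (by positivity), Real.rpow_one]
  have hlogy : ∀ᶠ n : ℕ in atTop, 512 * Real.log n ≤ a ^ 2 * ρ ^ 4 * y n ^ 4 := by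
    have h1 := (isLittleO_log_rpow_atTop (r := 4 / (4 + D)) (by positivity)).comp_tendsto
      (tendsto_natCast_atTop_atTop (R := ℝ))
    filter_upwards [h1.def (c := a ^ 2 * ρ ^ 4 / 512) (by positivity)] with n hn
    simp only [Function.comp_apply, Real.norm_eq_abs] at hn
    rw [hy4, abs_of_nonneg (a := y n ^ 4) (by positivity)] at hn
    linarith [le_abs_self (Real.log n)]
  have hev := (((((((eventually_ge_atTop 3).and hlogy).and (hlt.eventually_ge_atTop 1)).and
    (hlt.eventually_ge_atTop (A / (η * √L₀)))).and
    (hlt.eventually_ge_atTop (512 / (a ^ 2 * L₀ ^ 2)))).and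
    (hlt.eventually_ge_atTop (256 / (a ^ 2 * L₀)))).and
    (hlt.eventually_ge_atTop (256 / (a ^ 2 * ρ ^ 4)))).and
    ((hyt.eventually_ge_atTop (A / (η * ρ))).and
      (hyt.eventually_ge_atTop (1 + 256 * R ^ 2 / (a ^ 2 * ρ ^ 4))))
  obtain ⟨N, hN⟩ := eventually_atTop.1 hev
  refine ⟨N, fun n hn δ hδ0 hδδ hor => ?_⟩
  obtain ⟨⟨⟨⟨⟨⟨⟨e0, e1⟩, e2⟩, e3⟩, e4⟩, e5⟩, e6⟩, e7, e8⟩ := hN n hn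
  rw [hy4] at hor ⊢
  change sampleLaw f n {X | ∃ xhat, IsModeEstimate ⌈y n ^ 4⌉₊ X xhat ∧
        √(Real.log (1 / δ)) * Real.log n / y n ≤ ‖xhat - x₀‖} ≤ ENNReal.ofReal δ
  have hn0 : (0 : ℝ) < n := by
    have : 0 < n := by omega
    exact_mod_cast this
  have hyn0 : 0 < y n := Real.rpow_pos_of_pos hn0 _
  have hyn1 : 1 ≤ y n := by
    have : 0 ≤ 256 * R ^ 2 / (a ^ 2 * ρ ^ 4) := by positivity
    linarith
  have hDy := hyD n
  generalize y n = y at *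
  set l := Real.log n with hl
  set L := Real.log (1 / δ) with hL
  have hLL : L₀ ≤ L := Real.log_le_log (by positivity) (one_div_le_one_div_of_le hδ0 hδδ)
  have hLpos : 0 < L := hL₀pos.trans_le hLL
  set h := √L * l / y with hh'
  have hh0 : 0 < h := by positivity
  have hhy : h * y = √L * l := by rw [hh']; field_simp
  set k := ⌈y ^ 4⌉₊ with hk
  have hk1 : y ^ 4 ≤ k := Nat.le_ceil _
  have hy41 : 1 ≤ y ^ 4 := one_le_pow₀ hyn1
  have hk2 : (k : ℝ) ≤ 2 * y ^ 4 := by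
    have := Nat.ceil_lt_add_one (show 0 ≤ y ^ 4 by positivity)
    linarith
  -- on a compact domain no observation is at distance `R` or more
  by_cases hbig : IsCompact S ∧ R ≤ h
  · refine le_trans (measure_mono ?_) ((sampleLaw_exists_notMem hd
      hbig.1.isClosed.measurableSet n).le.trans zero_le)
    rintro X ⟨_, ⟨i, rfl, -⟩, hd⟩
    refine ⟨i, fun hi => ?_⟩
    have := hR hbig.1 _ hi
    rw [dist_eq_norm] at this
    linarith [hbig.2]
  set m := min h ρ with hm'
  have hm0 : 0 < m := lt_min hh0 hρ
  have hmy : A ≤ η * m * y := by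
    rcases min_choice h ρ with h1 | h1
    · rw [hm', h1, mul_assoc, hhy]
      rw [div_le_iff₀ (by positivity)] at e3
      have : √L₀ ≤ √L := Real.sqrt_le_sqrt hLL
      calc A ≤ l * (η * √L₀) := e3
        _ ≤ l * (η * √L) := by gcongr
        _ = _ := by ring
    · rw [hm', h1]
      rw [div_le_iff₀ (by positivity)] at e7
      linarith
  -- the exponent dominates `log n` and `log (1 / δ)`; if `h` exceeds the radius `ρ` of quadratic decay,
  -- then `log (1 / δ)` is small compared with `k`, as the domain is compact or by assumption
  have hmain : 256 * l + 128 * L ≤ (a * m ^ 2) ^ 2 * k := by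
    suffices hs : 256 * l + 128 * L ≤ (a * m ^ 2) ^ 2 * y ^ 4 from hs.trans (by gcongr)
    rcases le_total h ρ with h1 | h1
    · rw [hm', min_eq_left h1]
      have h2 : (a * h ^ 2) ^ 2 * y ^ 4 = a ^ 2 * L ^ 2 * l ^ 4 := by
        have : (h * y) ^ 4 = L ^ 2 * l ^ 4 := by
          rw [hhy, mul_pow, show √L ^ 4 = (√L ^ 2) ^ 2 by ring, Real.sq_sqrt hLpos.le]
        calc _ = a ^ 2 * (h * y) ^ 4 := by ring
          _ = _ := by rw [this]; ring
      rw [h2]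
      rw [div_le_iff₀ (by positivity)] at e4 e5
      have hl3 : l ≤ l ^ 3 := by
        calc l = l ^ 1 := (pow_one l).symm
          _ ≤ l ^ 3 := pow_le_pow_right₀ e2 (by norm_num)
      have hl4 : l ≤ l ^ 4 := by
        calc l = l ^ 1 := (pow_one l).symm
          _ ≤ l ^ 4 := pow_le_pow_right₀ e2 (by norm_num)
      have g1 : 512 * l ≤ a ^ 2 * L ^ 2 * l ^ 4 := by
        calc 512 * l ≤ (l * (a ^ 2 * L₀ ^ 2)) * l := by gcongr
          _ ≤ (l ^ 3 * (a ^ 2 * L ^ 2)) * l := by gcongr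
          _ = _ := by ring
      have g2 : 256 * L ≤ a ^ 2 * L ^ 2 * l ^ 4 := by
        calc 256 * L ≤ (l * (a ^ 2 * L₀)) * L := by gcongr
          _ ≤ (l ^ 4 * (a ^ 2 * L)) * L := by gcongr
          _ = _ := by ring
      linarith
    · rw [hm', min_eq_right h1]
      have h2 : (a * ρ ^ 2) ^ 2 * y ^ 4 = a ^ 2 * ρ ^ 4 * y ^ 4 := by ring
      rw [h2]
      have g2 : 256 * L ≤ a ^ 2 * ρ ^ 4 * y ^ 4 := by
        by_cases hcS : IsCompact S
        · have hhR : h ≤ R := by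
            by_contra hh2
            exact hbig ⟨hcS, by linarith⟩
          have g3 : L ≤ R ^ 2 * y ^ 2 := by
            have g4 : √L ≤ R * y := by
              calc √L ≤ √L * l := by
                    have := Real.sqrt_nonneg L
                    nlinarith
                _ = h * y := hhy.symm
                _ ≤ R * y := by gcongr
            calc L = √L ^ 2 := (Real.sq_sqrt hLpos.le).symm
              _ ≤ (R * y) ^ 2 := by gcongr
              _ = _ := by ring
          have g5 : 256 * R ^ 2 ≤ a ^ 2 * ρ ^ 4 * y := by
            have : 256 * R ^ 2 / (a ^ 2 * ρ ^ 4) ≤ y := by linarith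
            rw [div_le_iff₀ (by positivity)] at this
            linarith
          calc 256 * L ≤ 256 * R ^ 2 * y ^ 2 := by linarith
            _ ≤ a ^ 2 * ρ ^ 4 * y * y ^ 2 := by gcongr
            _ = a ^ 2 * ρ ^ 4 * y ^ 3 := by ring
            _ ≤ a ^ 2 * ρ ^ 4 * y ^ 4 := by
                gcongr
                norm_num
        · have g3 := hor.resolve_left hcS
          rw [div_le_iff₀ (by positivity)] at e6
          calc 256 * L ≤ l * (a ^ 2 * ρ ^ 4) * L := by gcongr
            _ = a ^ 2 * ρ ^ 4 * (l * L) := by ring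
            _ ≤ _ := by gcongr
      linarith
  set t := a * m ^ 2 with ht
  have ht0 : 0 < t := by positivity
  have hkt : 4 ≤ k * t := by
    have h1 : 256 ≤ t ^ 2 * k := by linarith
    have h2 : t ≤ 1 := by
      have h3 := mul_sq_le_of_global_quadratic hD hd hlow hm0.le (min_le_right _ _)
      have h4 : c * m ^ 2 = 12 * f x₀ * t := by rw [ht, ha]; field_simp
      by_contra h5
      nlinarith
    have h3 : t ^ 2 * k ≤ t * k := by gcongr; nlinarith
    linarith
  have hfin := sampleLaw_modeEstimate_le hD hd hc hC hf0 hlow hup hη0 hη1 hη2 (n := n) (k := k)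
    (y := y) (h := h) (hm := m) (t := t) (by omega) hyn0 hDy hk2 hm0 (min_le_left _ _)
    (min_le_right _ _) ht hkt (by
      calc (4 : ℝ) = A ^ D * (v * f x₀) := by rw [hAD]; field_simp
        _ ≤ _ := by gcongr)
  simp only [dist_eq_norm] at hfin
  refine hfin.trans (ENNReal.ofReal_le_ofReal ?_)
  have hδe : δ = Real.exp (-L) := by
    rw [hL, one_div, Real.log_inv, neg_neg, Real.exp_log hδ0]
  have h2n : (2 * n + 1 : ℝ) ≤ Real.exp (2 * l) := by
    have h3 : (3 : ℝ) ≤ n := by exact_mod_cast e0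
    rw [two_mul l, Real.exp_add, hl, Real.exp_log hn0]
    nlinarith
  calc (2 * n + 1 : ℝ) * Real.exp (-(t ^ 2 * k / 128))
      ≤ Real.exp (2 * l) * Real.exp (-(t ^ 2 * k / 128)) := by gcongr
    _ = Real.exp (2 * l - t ^ 2 * k / 128) := by rw [← Real.exp_add]; ring_nf
    _ ≤ δ := by rw [hδe]; apply Real.exp_le_exp.2; linarith

/-! ### The cluster algorithm -/

section Algorithm

variable {n k : ℕ} {X : Fin n → ℝ} {δ : ℝ}

theorem knnGraph_mono {γ γ' : ℝ} (h : γ ≤ γ') : knnGraph X k γ' ≤ knnGraph X k γ := by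
  intro i j hij
  exact ⟨hij.1, h.trans hij.2.1, h.trans hij.2.2.1, hij.2.2.2⟩

theorem mem_cluster_self (i : Fin n) : i ∈ cluster k δ X i := SimpleGraph.Reachable.refl _

/-- A cluster started at a lower point uses a larger graph, so it contains every cluster started
higher up that it meets. -/
theorem cluster_subset_of_le (hβ : beta n k δ ≤ 1) {i j : Fin n}
    (hij : knnDensity X k (X j) ≤ knnDensity X k (X i))
    (h : (cluster k δ X i ∩ cluster k δ X j).Nonempty) : cluster k δ X i ⊆ cluster k δ X j := by
  obtain ⟨m, hmi, hmj⟩ := h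
  have hle : knnDensity X k (X j) - beta n k δ * knnDensity X k (X j)
      ≤ knnDensity X k (X i) - beta n k δ * knnDensity X k (X i) := by nlinarith
  have hmono := knnGraph_mono (X := X) (k := k) hle
  intro x hx
  have h1 : (knnGraph X k (knnDensity X k (X j) - beta n k δ * knnDensity X k (X j))).Reachable j m :=
    hmj
  have h2 := SimpleGraph.Reachable.mono hmono hmi
  have h3 := SimpleGraph.Reachable.mono hmono hx
  exact h1.trans (h2.symm.trans h3)

/-- `A` is a cluster around the mode `z`: it contains the core `K z` and lies in the region `B z`. -/
def IsClusterOf (K B : ℝ → Set (Fin n)) (A : Set (Fin n)) (z : ℝ) : Prop := K z ⊆ A ∧ A ⊆ B z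

variable {K B : ℝ → Set (Fin n)} {T : Set ℝ} {top : ℝ → Fin n}

/-- A list with a cluster around each point of `T` is at least as long as `T` is large, as clusters
around different points are disjoint. -/
theorem ncard_le_length (hT : T.Finite) (hK : ∀ z ∈ T, top z ∈ K z)
    (hB : ∀ z ∈ T, ∀ z' ∈ T, z ≠ z' → Disjoint (B z) (B z')) {𝒜 : List (Set (Fin n))}
    (h : ∀ z ∈ T, ∃ A ∈ 𝒜, IsClusterOf K B A z) : T.ncard ≤ 𝒜.length := by
  classical
  choose! A hA hAz using h
  rw [Set.ncard_eq_toFinset_card T hT]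
  refine le_trans (Finset.card_le_card_of_injOn A (t := 𝒜.toFinset) ?_ ?_) (List.toFinset_card_le _)
  · intro z hz
    have hz : z ∈ T := by simpa using hz
    simpa using hA z hz
  · intro z hz z' hz' he
    have hz : z ∈ T := by simpa using hz
    have hz' : z' ∈ T := by simpa using hz'
    by_contra hne
    refine Set.disjoint_left.1 (hB z hz z' hz' hne) ((hAz z hz).2 ((hAz z hz).1 (hK z hz))) ?_
    have he : A z = A z' := he
    exact (hAz z' hz').2 (he ▸ (hAz z hz).1 (hK z hz))

/-- Pigeonhole: as many disjoint clusters around points of `T` as there are points in `T` leave no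
point out. -/
theorem forall_exists_of_length_eq (hT : T.Finite) (hK : ∀ z ∈ T, top z ∈ K z)
    {𝒜 : List (Set (Fin n))} (h : ∀ A ∈ 𝒜, ∃ z ∈ T, IsClusterOf K B A z)
    (hdis : 𝒜.Pairwise Disjoint) (hlen : 𝒜.length = T.ncard) :
    ∀ z ∈ T, ∃ A ∈ 𝒜, IsClusterOf K B A z := by
  classical
  choose! φ hφ hφc using h
  have hnd : (𝒜.map φ).Nodup := by
    rw [List.nodup_map_iff_inj_on ?_]
    · intro A hA A' hA' he
      by_contra hne
      have : Std.Symm (α := Set (Fin n)) Disjoint := ⟨fun _ _ h => h.symm⟩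
      have hd : Disjoint A A' := hdis.forall hA hA' hne
      exact Set.disjoint_left.1 hd ((hφc A hA).1 (hK _ (hφ A hA)))
        ((hφc A' hA').1 (he ▸ hK _ (hφ A hA)))
    · refine List.Pairwise.imp_of_mem ?_ hdis
      rintro A A' hA - hd rfl
      exact Set.disjoint_left.1 hd ((hφc A hA).1 (hK _ (hφ A hA)))
        ((hφc A hA).1 (hK _ (hφ A hA)))
  have hsub : (𝒜.map φ).toFinset ⊆ hT.toFinset := by
    intro z hz
    simp only [List.mem_toFinset, List.mem_map] at hz
    obtain ⟨A, hA, rfl⟩ := hz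
    simpa using hφ A hA
  have heq := Finset.eq_of_subset_of_card_le hsub (by
    rw [List.toFinset_card_of_nodup hnd, List.length_map, hlen, Set.ncard_eq_toFinset_card T hT])
  intro z hz
  have : z ∈ (𝒜.map φ).toFinset := by rw [heq]; simpa using hz
  simp only [List.mem_toFinset, List.mem_map] at this
  obtain ⟨A, hA, rfl⟩ := this
  exact ⟨A, hA, hφc A hA⟩

/-- Correctness of the loop. Suppose that every sample point which is at least as high as the top
of some core has a cluster that contains a whole core; that the cluster of such a point does not
leave the region of a mode whose top it contains; and that the regions are disjoint. Then the
clusters that are found correspond to the elements of `T`. -/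
theorem clusters_spec {p : ℕ} (hT : T.Finite) (hp : T.ncard = p) (hβ : beta n k δ ≤ 1)
    (hK : ∀ z ∈ T, top z ∈ K z)
    (hhome : ∀ i, (∃ z ∈ T, knnDensity X k (X (top z)) ≤ knnDensity X k (X i)) →
      ∃ z ∈ T, K z ⊆ cluster k δ X i)
    (hconf : ∀ i, ∀ z ∈ T, top z ∈ cluster k δ X i →
      knnDensity X k (X (top z)) ≤ knnDensity X k (X i) → cluster k δ X i ⊆ B z)
    (hB : ∀ z ∈ T, ∀ z' ∈ T, z ≠ z' → Disjoint (B z) (B z')) {l : List (Fin n)}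
    (hl : ∀ i, i ∈ l)
    (hsort : l.Pairwise (fun i j => knnDensity X k (X j) ≤ knnDensity X k (X i))) :
    (∀ A ∈ clusters p k δ X l, ∃ z ∈ T, IsClusterOf K B A z) ∧
      ∀ z ∈ T, ∃ A ∈ clusters p k δ X l, IsClusterOf K B A z := by
  classical
  have key : ∀ l₁ l₂ : List (Fin n), l = l₁ ++ l₂ →
      (∀ A ∈ clusters p k δ X l₁, ∃ z ∈ T, IsClusterOf K B A z) ∧
      (∀ A ∈ clusters p k δ X l₁, ∃ i ∈ l₁, A = cluster k δ X i) ∧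
      (clusters p k δ X l₁).Pairwise Disjoint ∧ (clusters p k δ X l₁).length ≤ p ∧
      ((clusters p k δ X l₁).length = p ∨
        ∀ z ∈ T, top z ∈ l₁ → ∃ A ∈ clusters p k δ X l₁, IsClusterOf K B A z) := by
    intro l₁
    induction l₁ using List.reverseRecOn with
    | nil => intro l₂ _; simp [clusters]
    | append_singleton l₁ i ih =>
      intro l₂ hl₂
      rw [List.append_assoc, List.singleton_append] at hl₂
      obtain ⟨h1, h2, h3, h4, h5⟩ := ih (i :: l₂) hl₂
      have hstep : clusters p k δ X (l₁ ++ [i]) = clusterStep p k δ X (clusters p k δ X l₁) i := by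
        simp [clusters, List.foldl_append]
      set 𝒜 := clusters p k δ X l₁ with h𝒜
      rw [hl₂, List.pairwise_append] at hsort
      have hvis : ∀ j, knnDensity X k (X i) < knnDensity X k (X j) → j ∈ l₁ := by
        intro j hj
        have := hl j
        rw [hl₂, List.mem_append, List.mem_cons] at this
        rcases this with h | rfl | h
        · exact h
        · exact absurd hj (lt_irrefl _)
        · exact absurd ((List.pairwise_cons.1 hsort.2.1).1 j h) (not_le.2 hj)
      have hprev : ∀ j ∈ l₁, knnDensity X k (X i) ≤ knnDensity X k (X j) := fun j hj =>
        hsort.2.2 j hj i (by simp)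
      have hclu : ∀ z ∈ T, top z = i → ∀ z' ∈ T, K z' ⊆ cluster k δ X i → z' = z := by
        intro z hz hzi z' hz' hKz'
        by_contra hne
        have hsub := hconf i z hz (by rw [hzi]; exact mem_cluster_self i)
          (congrArg (fun j => knnDensity X k (X j)) hzi).le
        have ht' : top z' ∈ cluster k δ X i := hKz' (hK z' hz')
        by_cases hv : knnDensity X k (X (top z')) ≤ knnDensity X k (X i)
        · exact Set.disjoint_left.1 (hB z' hz' z hz hne) (hconf i z' hz' ht' hv ht') (hsub ht')
        · have h6 : top z' ∈ cluster k δ X (top z') := mem_cluster_self _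
          have h7 := cluster_subset_of_le hβ (not_le.1 hv).le ⟨top z', h6, ht'⟩
          exact Set.disjoint_left.1 (hB z' hz' z hz hne)
            (hconf (top z') z' hz' h6 le_rfl h6) (hsub ht')
      rw [hstep]
      unfold clusterStep
      split_ifs with hlen hdisj
      · refine ⟨h1, fun A hA => ?_, h3, h4, Or.inl hlen⟩
        obtain ⟨j, hj, rfl⟩ := h2 A hA
        exact ⟨j, by simp [hj], rfl⟩
      · have h5 := h5.resolve_left hlen
        -- some top is not higher than `i`: otherwise all clusters would have been found
        have hex : ∃ z ∈ T, knnDensity X k (X (top z)) ≤ knnDensity X k (X i) := by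
          by_contra! hcon
          have := ncard_le_length hT hK hB fun z hz => h5 z hz (hvis _ (hcon z hz))
          omega
        obtain ⟨z, hz, hKz⟩ := hhome i hex
        have hvz : knnDensity X k (X (top z)) ≤ knnDensity X k (X i) := by
          by_contra! hlt
          obtain ⟨A, hA, hAz⟩ := h5 z hz (hvis _ hlt)
          exact Set.disjoint_left.1 (hdisj A hA) (hKz (hK z hz)) (hAz.1 (hK z hz))
        have hgood : IsClusterOf K B (cluster k δ X i) z :=
          ⟨hKz, hconf i z hz (hKz (hK z hz)) hvz⟩
        refine ⟨?_, ?_, ?_, ?_, Or.inr ?_⟩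
        · intro A hA
          rcases List.mem_cons.1 hA with rfl | hA
          · exact ⟨z, hz, hgood⟩
          · exact h1 A hA
        · intro A hA
          rcases List.mem_cons.1 hA with rfl | hA
          · exact ⟨i, by simp, rfl⟩
          · obtain ⟨j, hj, rfl⟩ := h2 A hA
            exact ⟨j, by simp [hj], rfl⟩
        · exact List.pairwise_cons.2 ⟨hdisj, h3⟩
        · rw [List.length_cons]; omega
        · intro z' hz' htop
          rcases List.mem_append.1 htop with htop | htop
          · obtain ⟨A, hA, hAz⟩ := h5 z' hz' htop
            exact ⟨A, List.mem_cons_of_mem _ hA, hAz⟩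
          · rw [List.mem_singleton] at htop
            have := hclu z' hz' htop z hz hKz
            subst this
            exact ⟨_, List.mem_cons_self, hgood⟩
      · refine ⟨h1, fun A hA => ?_, h3, h4, h5.imp_right fun h5 z hz htop => ?_⟩
        · obtain ⟨j, hj, rfl⟩ := h2 A hA
          exact ⟨j, by simp [hj], rfl⟩
        · rcases List.mem_append.1 htop with htop | htop
          · exact h5 z hz htop
          · rw [List.mem_singleton] at htop
            -- the cluster of the top meets a cluster found earlier, which then is that of `z`
            push Not at hdisj
            obtain ⟨A, hA, hndis⟩ := hdisj
            obtain ⟨j, hj, rfl⟩ := h2 A hA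
            obtain ⟨z', hz', hAz'⟩ := h1 _ hA
            rw [Set.not_disjoint_iff_nonempty_inter, inter_comm] at hndis
            have hsub := cluster_subset_of_le hβ (hprev j hj) hndis
            have := hclu z hz htop z' hz' (hAz'.1.trans hsub)
            subst this
            exact ⟨_, hA, hAz'⟩
  obtain ⟨h1, -, h3, -, h5⟩ := key l [] (by simp)
  refine ⟨h1, ?_⟩
  rcases h5 with h5 | h5
  · exact forall_exists_of_length_eq hT hK h1 h3 (h5.trans hp.symm)
  · exact fun z hz => h5 z hz (hl _)

end Algorithm

/-! ### Empirical counts of intervals -/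

/-- The distribution function of the law with density `f`. -/
noncomputable def distFun (f : ℝ → ℝ) (x : ℝ) : ℝ := (law f).real (Iic x)

section DistFun

variable {f : ℝ → ℝ} {S : Set ℝ} {F a b c : ℝ}

theorem law_real_Icc (hd : IsDensityOn f S) (hab : a ≤ b) :
    (law f).real (Icc a b) = distFun f b - distFun f a := by
  have := hd.isProbabilityMeasure
  have : NullSingletonClass (law f) := by unfold law; infer_instance
  have h1 : Iic b \ Iio a = Icc a b := by
    ext x; simp
  rw [← h1, measureReal_sdiff (Iio_subset_Iic_self.trans (Iic_subset_Iic.2 hab)) measurableSet_Iio,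
    distFun, distFun, measureReal_congr (Iio_ae_eq_Iic (a := a) (μ := law f))]

theorem distFun_mono (hd : IsDensityOn f S) : Monotone (distFun f) := by
  have := hd.isProbabilityMeasure
  exact fun a b h => measureReal_mono (Iic_subset_Iic.2 h)

theorem distFun_sub_le (hd : IsDensityOn f S) (hab : a ≤ b) (hc0 : 0 ≤ c)
    (hc : ∀ x ∈ Icc a b, f x ≤ c) : distFun f b - distFun f a ≤ c * (b - a) := by
  rw [← law_real_Icc hd hab]
  have := law_real_le measurableSet_Icc (by simp) hc0 hc
  rwa [Real.volume_real_Icc_of_le hab] at this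

theorem le_distFun_sub (hd : IsDensityOn f S) (hab : a ≤ b) (hc0 : 0 ≤ c)
    (hc : ∀ x ∈ Icc a b, c ≤ f x) : c * (b - a) ≤ distFun f b - distFun f a := by
  rw [← law_real_Icc hd hab]
  have := le_law_real hd measurableSet_Icc (by simp) hc0 hc
  rwa [Real.volume_real_Icc_of_le hab] at this

theorem continuous_distFun (hd : IsDensityOn f S) (hF : ∀ x, f x ≤ F) :
    Continuous (distFun f) := by
  have hF0 : 0 ≤ F := (hd.nonneg 0).trans (hF 0)
  refine (LipschitzWith.of_dist_le_mul (K := F.toNNReal) fun x y => ?_).continuous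
  wlog hxy : x ≤ y generalizing x y
  · rw [dist_comm, dist_comm x]; exact this y x (le_of_not_ge hxy)
  rw [dist_comm, dist_comm x, Real.dist_eq, Real.dist_eq, Real.coe_toNNReal _ hF0,
    abs_of_nonneg (sub_nonneg.2 hxy), abs_of_nonneg (sub_nonneg.2 (distFun_mono hd hxy))]
  exact distFun_sub_le hd hxy hF0 fun x _ => hF x

end DistFun

/-- On every interval in `[-1, 2]` with at most `m` expected observations, the number of
observations deviates from its expectation by at most `t`. -/
def UnifDev {n : ℕ} (f : ℝ → ℝ) (X : Fin n → ℝ) (m t : ℝ) : Prop :=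
  ∀ a b, -1 ≤ a → a ≤ b → b ≤ 2 → n * (distFun f b - distFun f a) ≤ m →
    |(cnt (Icc a b) X : ℝ) - n * (distFun f b - distFun f a)| ≤ t

section UnifDev

variable {n : ℕ} {f : ℝ → ℝ} {S : Set ℝ} {X : Fin n → ℝ} {F a b m t s : ℝ}

/-- A lower bound for the count of an interval that may have more than `m` expected observations: by
the intermediate value theorem it contains an interval with exactly `s + t` of them. -/
theorem UnifDev.le_cnt (hU : UnifDev f X m t) (hd : IsDensityOn f S) (hF : ∀ x, f x ≤ F)
    (ha : -1 ≤ a) (hab : a ≤ b) (hb : b ≤ 2) (hst : 0 ≤ s + t) (hm : s + t ≤ m)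
    (h : s + t ≤ n * (distFun f b - distFun f a)) : s ≤ cnt (Icc a b) X := by
  have hcont : ContinuousOn (fun x => (n : ℝ) * (distFun f x - distFun f a)) (Icc a b) :=
    (continuous_const.mul ((continuous_distFun hd hF).sub continuous_const)).continuousOn
  obtain ⟨x, hx, hxe⟩ := intermediate_value_Icc hab hcont
    (show s + t ∈ Icc _ _ by constructor <;> simpa)
  have hxe : n * (distFun f x - distFun f a) = s + t := hxe
  have h1 := abs_le.1 (hU a x ha hx.1 (hx.2.trans hb) (hxe.trans_le hm))
  have h2 : (cnt (Icc a x) X : ℝ) ≤ cnt (Icc a b) X :=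
    Nat.cast_le.2 (cnt_mono (Icc_subset_Icc_right hx.2) X)
  linarith [h1.1]

theorem UnifDev.sub_le (hU : UnifDev f X m t) (ha : -1 ≤ a) (hab : a ≤ b) (hb : b ≤ 2)
    (ht : 0 ≤ t) (hm : s ≤ m) (h : s ≤ cnt (Icc a b) X) :
    s - t ≤ n * (distFun f b - distFun f a) := by
  by_cases hle : n * (distFun f b - distFun f a) ≤ m
  · linarith [(abs_le.1 (hU a b ha hab hb hle)).2]
  · linarith

theorem UnifDev.exists_mem (hU : UnifDev f X m t) (hd : IsDensityOn f S) (hF : ∀ x, f x ≤ F)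
    (ha : -1 ≤ a) (hab : a ≤ b) (hb : b ≤ 2) (ht : 0 ≤ t) (hm : t < m)
    (h : t < n * (distFun f b - distFun f a)) : ∃ i, X i ∈ Icc a b := by
  refine exists_of_cnt_pos ?_
  have := hU.le_cnt (s := min m (n * (distFun f b - distFun f a)) - t) hd hF ha hab hb
    (by rw [sub_add_cancel]; exact le_min (by linarith) (by linarith))
    (by rw [sub_add_cancel]; exact min_le_left _ _) (by rw [sub_add_cancel]; exact min_le_right _ _)
  have h2 : 0 < min m (n * (distFun f b - distFun f a)) - t := sub_pos.2 (lt_min hm h)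
  exact_mod_cast h2.trans_le this

end UnifDev

/-- The observations lie in `[0, 1]`, and the counts of intervals with at most `2 k` expected
observations have relative error at most `e` (with respect to `k`). -/
structure RegularSample {n : ℕ} (f : ℝ → ℝ) (F : ℝ) (X : Fin n → ℝ) (k : ℕ) (e : ℝ) : Prop where
  density : IsDensityOn f (Icc 0 1)
  le_sup : ∀ x, f x ≤ F
  one_le : 1 ≤ k
  le_card : k ≤ n
  mem : ∀ i, X i ∈ Icc (0 : ℝ) 1
  dev : UnifDev f X (2 * k) (e * k)
  e_pos : 0 < e
  e_le : e ≤ 1 / 10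

namespace RegularSample

variable {n k : ℕ} {f : ℝ → ℝ} {X : Fin n → ℝ} {F e x r a b c : ℝ}

theorem k_pos (h : RegularSample f F X k e) : (0 : ℝ) < k := by exact_mod_cast h.one_le

theorem n_pos (h : RegularSample f F X k e) : (0 : ℝ) < n :=
  h.k_pos.trans_le (by exact_mod_cast h.le_card)

theorem nonneg_sup (h : RegularSample f F X k e) : 0 ≤ F :=
  (h.density.nonneg 0).trans (h.le_sup 0)

theorem radius_le_one (h : RegularSample f F X k e) (hx : x ∈ Icc (0 : ℝ) 1) :
    knnRadius X k x ≤ 1 := by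
  refine knnRadius_le h.one_le (h.le_card.trans ?_)
  have : {i | X i ∈ Metric.closedBall x 1} = Set.univ := by
    refine Set.eq_univ_of_forall fun i => ?_
    have := h.mem i
    show X i ∈ Metric.closedBall x 1
    rw [Real.closedBall_eq_Icc]
    exact ⟨by linarith [this.1, hx.2], by linarith [this.2, hx.1]⟩
  rw [cnt, this]; simp [Set.ncard_univ]

theorem radius_nonneg (h : RegularSample f F X k e) (x : ℝ) : 0 ≤ knnRadius X k x :=
  nonneg_of_le_cnt h.one_le (le_cnt_closedBall_knnRadius h.le_card X x)

theorem le_mass (h : RegularSample f F X k e) (hx : x ∈ Icc (0 : ℝ) 1) :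
    k * (1 - e) ≤ n * (distFun f (x + knnRadius X k x) - distFun f (x - knnRadius X k x)) := by
  have h0 := h.radius_nonneg x
  have h1 := h.radius_le_one hx
  have hc := le_cnt_closedBall_knnRadius h.le_card X x
  rw [Real.closedBall_eq_Icc] at hc
  have := h.dev.sub_le (by linarith [hx.1]) (by linarith) (by linarith [hx.2])
    (by have := h.k_pos; have := h.e_pos; positivity) (by linarith [h.k_pos])
    (show (k : ℝ) ≤ cnt (Icc (x - knnRadius X k x) (x + knnRadius X k x)) X by exact_mod_cast hc)
  linarith

theorem radius_pos (h : RegularSample f F X k e) (hx : x ∈ Icc (0 : ℝ) 1) :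
    0 < knnRadius X k x := by
  refine (h.radius_nonneg x).lt_of_ne fun h0 => ?_
  have := h.le_mass hx
  rw [← h0] at this
  have h2 : 0 < k * (1 - e) := mul_pos h.k_pos (by linarith [h.e_le])
  simp at this
  linarith

theorem radius_le_of_mass (h : RegularSample f F X k e) (hx : x ∈ Icc (0 : ℝ) 1) (hr0 : 0 ≤ r)
    (hr : r ≤ 1) (hm : k * (1 + e) ≤ n * (distFun f (x + r) - distFun f (x - r))) :
    knnRadius X k x ≤ r := by
  refine knnRadius_le h.one_le ?_
  have hk := h.k_pos
  have he := h.e_pos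
  have := h.dev.le_cnt (s := k) h.density h.le_sup (a := x - r) (b := x + r) (by linarith [hx.1])
    (by linarith) (by linarith [hx.2]) (by positivity) (by nlinarith [h.e_le]) (by linarith)
  rw [Real.closedBall_eq_Icc]
  exact_mod_cast this

theorem knnDensity_mul (h : RegularSample f F X k e) (hx : x ∈ Icc (0 : ℝ) 1) :
    knnDensity X k x * (2 * n * knnRadius X k x) = k := by
  have h1 := h.radius_pos hx
  have h2 := h.n_pos
  unfold knnDensity
  field_simp

theorem knnDensity_pos (h : RegularSample f F X k e) (hx : x ∈ Icc (0 : ℝ) 1) :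
    0 < knnDensity X k x := by
  have h1 := h.radius_pos hx
  have h2 := h.n_pos
  have h3 := h.k_pos
  unfold knnDensity
  positivity

/-- Where the density is at most `a`, so is the estimate, up to a factor `1 - e`. -/
theorem knnDensity_le (h : RegularSample f F X k e) (hx : x ∈ Icc (0 : ℝ) 1) (ha0 : 0 ≤ a)
    (ha : ∀ y ∈ Icc (x - knnRadius X k x) (x + knnRadius X k x), f y ≤ a) :
    knnDensity X k x * (1 - e) ≤ a := by
  have hr := h.radius_pos hx
  have hn := h.n_pos
  have h1 := h.le_mass hx
  have h2 := distFun_sub_le h.density (by linarith) ha0 ha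
  have h3 := h.knnDensity_mul hx
  set v := knnDensity X k x
  set r := knnRadius X k x
  have h4 : k * (1 - e) ≤ n * (a * (2 * r)) :=
    h1.trans (by
      refine mul_le_mul_of_nonneg_left (h2.trans_eq (by ring)) hn.le)
  have h5 : v * (1 - e) * (2 * n * r) ≤ a * (2 * n * r) := by
    rw [show v * (1 - e) * (2 * n * r) = (v * (2 * n * r)) * (1 - e) by ring, h3]
    linarith
  exact le_of_mul_le_mul_right h5 (by positivity)

theorem le_knnDensity_of_radius_le (h : RegularSample f F X k e) (hx : x ∈ Icc (0 : ℝ) 1)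
    (hr : knnRadius X k x ≤ r) : k / (2 * n * r) ≤ knnDensity X k x := by
  have h1 := h.radius_pos hx
  have h2 := h.n_pos
  have h3 := h.k_pos
  unfold knnDensity
  gcongr

theorem radius_le_of_le_knnDensity (h : RegularSample f F X k e) (hx : x ∈ Icc (0 : ℝ) 1)
    (ha : 0 < a) (hv : a ≤ knnDensity X k x) : knnRadius X k x ≤ k / (2 * n * a) := by
  have h2 := h.n_pos
  have h1 := h.radius_pos hx
  rw [le_div_iff₀ (by positivity), ← h.knnDensity_mul hx]
  nlinarith [mul_le_mul_of_nonneg_right hv (show 0 ≤ 2 * n * knnRadius X k x by positivity)]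

/-- Where the density is at least `a`, so is the estimate, up to a factor `1 + e`. -/
theorem le_knnDensity (h : RegularSample f F X k e) (hx : x ∈ Icc (0 : ℝ) 1) (ha0 : 0 < a)
    (hr : k * (1 + e) / (2 * n * a) ≤ 1)
    (ha : ∀ y ∈ Icc (x - k * (1 + e) / (2 * n * a)) (x + k * (1 + e) / (2 * n * a)), a ≤ f y) :
    a / (1 + e) ≤ knnDensity X k x := by
  have hn := h.n_pos
  have hk := h.k_pos
  have he := h.e_pos
  set r := k * (1 + e) / (2 * n * a) with hrdef
  have hr0 : 0 < r := by positivity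
  have h1 := le_distFun_sub h.density (by linarith) ha0.le ha
  have h2 := h.radius_le_of_mass hx hr0.le hr (by
    calc k * (1 + e) = n * (a * (x + r - (x - r))) := by rw [hrdef]; field_simp; ring
      _ ≤ _ := by gcongr)
  refine le_trans (le_of_eq ?_) (h.le_knnDensity_of_radius_le hx h2)
  rw [hrdef]; field_simp

theorem sup_radius (h : RegularSample f F X k e) (hx : x ∈ Icc (0 : ℝ) 1) (hF : 0 < F) :
    k / (4 * n * F) ≤ knnRadius X k x := by
  have hn := h.n_pos
  have hr := h.radius_pos hx
  have h1 := h.knnDensity_le hx hF.le fun y _ => h.le_sup y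
  have h3 := h.knnDensity_mul hx
  have hv := h.knnDensity_pos hx
  rw [div_le_iff₀ (by positivity), ← h3]
  have h4 : knnDensity X k x ≤ 2 * F := by nlinarith [h.e_le]
  have : 0 < n * knnRadius X k x := by positivity
  nlinarith

end RegularSample

/-! ### Recovery of the modes by the cluster algorithm -/

section Geometry

variable {f : ℝ → ℝ} {lam₀ rM Cl Cu : ℝ}

/-- The form in which the quadratic bounds are used: the ball of radius `rM` lies in the component.
-/
theorem ModalConstants.near (hM : ModalConstants f lam₀ rM Cl Cu) {z x : ℝ} (hz : z ∈ modes f)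
    (hx : |x - z| ≤ rM) :
    lam₀ < f x ∧ Cl * (x - z) ^ 2 ≤ f z - f x ∧ f z - f x ≤ Cu * (x - z) ^ 2 := by
  obtain ⟨lam, hlam, hball, hq⟩ := hM.quadratic z hz
  have hmem := hball (show x ∈ Metric.closedBall z rM by rwa [Metric.mem_closedBall, Real.dist_eq])
  have h1 : lam ≤ f x := connectedComponentIn_subset {x | lam ≤ f x} z hmem
  have h2 := hq x hmem
  rw [Real.norm_eq_abs, sq_abs, show (z - x) ^ 2 = (x - z) ^ 2 by ring] at h2
  exact ⟨hlam.trans_le h1, h2⟩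

theorem ModalConstants.lam₀_lt (hM : ModalConstants f lam₀ rM Cl Cu) {z : ℝ} (hz : z ∈ modes f) :
    lam₀ < f z :=
  (hM.near hz (by simpa using hM.rM_pos.le)).1

/-- Two modes closer than `rM` would each be strictly lower than the other. -/
theorem ModalConstants.rM_lt_abs_sub (hM : ModalConstants f lam₀ rM Cl Cu) {z z' : ℝ}
    (hz : z ∈ modes f) (hz' : z' ∈ modes f) (hne : z ≠ z') : rM < |z - z'| := by
  by_contra! hle
  have h1 := (hM.near hz' hle).2.1
  have h2 := (hM.near hz (by rwa [abs_sub_comm])).2.1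
  have h3 : 0 < (z - z') ^ 2 := by have := sub_ne_zero.2 hne; positivity
  nlinarith [hM.Cl_pos]

/-- From every point with positive density one can climb to a mode, without going below the
density at the starting point. -/
theorem ModalStructure.exists_mode_above (hd : IsDensityOn f (Icc 0 1)) (hf : ModalStructure f)
    (hc : ContinuousOn f (Icc 0 1)) {y : ℝ} (hy : 0 < f y) :
    ∃ z ∈ modes f, ∀ u ∈ uIcc y z, f y ≤ f u := by
  have hmem : ∀ x, 0 < f x → x ∈ Icc (0 : ℝ) 1 := fun x hx => by
    by_contra h; rw [hd.eq_zero x h] at hx; exact lt_irrefl _ hx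
  set A := {x | f y ≤ f x} with hA
  set M := connectedComponentIn A y with hMdef
  have hyA : y ∈ A := le_refl (f y)
  have hyM : y ∈ M := mem_connectedComponentIn hyA
  have hAsub : A ⊆ Icc 0 1 := fun x hx => hmem x (hy.trans_le hx)
  have hAcl : IsClosed A := by
    have := hc.preimage_isClosed_of_isClosed isClosed_Icc (isClosed_Ici (a := f y))
    convert this using 1
    ext x; exact ⟨fun hx => ⟨hAsub hx, hx⟩, fun hx => hx.2⟩
  have hMcl : IsClosed M := by
    refine isClosed_of_closure_subset ?_
    refine IsPreconnected.subset_connectedComponentIn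
      (isPreconnected_connectedComponentIn.closure) (subset_closure hyM) ?_
    exact closure_minimal (connectedComponentIn_subset _ _) hAcl
  have hMsub : M ⊆ Icc 0 1 := (connectedComponentIn_subset _ _).trans hAsub
  obtain ⟨z, hzM, hz⟩ := (isCompact_Icc.of_isClosed_subset hMcl hMsub).exists_isMaxOn ⟨y, hyM⟩
    (hc.mono hMsub)
  have hyz : f y ≤ f z := connectedComponentIn_subset A y hzM
  refine ⟨z, hf.mem_modes_of_max_on_component fun u hu => hz ?_, fun u hu => ?_⟩
  · rw [hMdef, connectedComponentIn_eq hzM]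
    exact connectedComponentIn_mono z (fun x hx => hyz.trans hx) hu
  · exact connectedComponentIn_subset A y
      (isPreconnected_connectedComponentIn.ordConnected.uIcc_subset hyM hzM hu)

/-- Let `G` have slope at most `c` on `[u - r, u + r]` and at least `c` on `[u + r, z]`. An interval
that is longer by `2 d` and lies further to the right, but still to the left of `z`, has an
increment that is larger by `c d`. -/
theorem le_sub_of_shift {G : ℝ → ℝ} (hG : Monotone G) {u r c z x d : ℝ} (hr : 0 ≤ r) (hc : 0 ≤ c)
    (hd : 0 ≤ d) (hup : ∀ a b, u - r ≤ a → a ≤ b → b ≤ u + r → G b - G a ≤ c * (b - a))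
    (hlow : ∀ a b, u + r ≤ a → a ≤ b → b ≤ z → c * (b - a) ≤ G b - G a)
    (hx : u ≤ x) (hxz : x + (r + d) ≤ z) :
    G (u + r) - G (u - r) + c * d ≤ G (x + (r + d)) - G (x - (r + d)) := by
  have h0 : 0 ≤ c * d := mul_nonneg hc hd
  rcases le_or_gt (u + r) (x - (r + d)) with h1 | h1
  · have h2 := hlow (x - (r + d)) (x + (r + d)) h1 (by linarith) hxz
    have h3 := hup (u - r) (u + r) le_rfl (by linarith) le_rfl
    nlinarith
  have h2 := hlow (u + r) (x + (r + d)) le_rfl (by linarith) hxz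
  rcases le_or_gt (u - r) (x - (r + d)) with h3 | h3
  · have h4 := hup (u - r) (x - (r + d)) le_rfl h3 h1.le
    nlinarith
  · have h4 := hG h3.le
    nlinarith [mul_nonneg hc (sub_nonneg.2 hx)]

end Geometry

/-- The numerical conditions under which the algorithm works on every regular sample: `w` is the
scale of the error (`w ^ 4 = log (1 / δ) ^ 2 log n / k`), `b w` the error bound, `η w` the radius of
the cores around the modes, and `ρ` bounds the nearest-neighbour radii where the density estimate
is at least `lam₀ / 2`. -/
structure Regime (lam₀ rM Cl Cu F g : ℝ) (Cα α : ℝ≥0) (n k : ℕ) (w η b ρ : ℝ) : Prop where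
  w_pos : 0 < w
  η_pos : 0 < η
  b_pos : 0 < b
  b_sq : Cl * b ^ 2 = F
  ρ_eq : ρ * (n * lam₀) = k
  w_le : 1000 * w ^ 2 ≤ 1
  ρ_le_core : 20 * ρ ≤ η * w
  ρ_le_width : 100 * ρ ≤ b * w
  ρ_le_half : ρ ≤ 1 / 2
  core : 2 * Cu * η ^ 2 ≤ lam₀
  η_le : η ≤ b
  width_le : 28 * (b * w) ≤ rM
  gap : 30 * F * w ^ 2 < g
  sup_le : 400 * F * w ^ 2 < lam₀
  holder : Cα * (2 * ρ) ^ (α : ℝ) ≤ lam₀ / 8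

section Clusters

variable {n k : ℕ} {f : ℝ → ℝ} {X : Fin n → ℝ} {lam₀ rM Cl Cu F g w η b ρ γ : ℝ} {Cα α : ℝ≥0}

/-- Sample points in an interval with density at least `lam₀ / 4` are connected to each other in
`G(γ)` if the density estimate is at least `γ` at all of them. -/
theorem RegularSample.reachable_of_interval {e : ℝ} (hS : RegularSample f F X k e) (hF : 0 < F)
    (hlam : 0 < lam₀) (he : 50 * F * e < lam₀) {a c : ℝ} (ha : 0 ≤ a) (hc : c ≤ 1)
    (hf : ∀ x ∈ Icc a c, lam₀ / 4 ≤ f x)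
    (hv : ∀ i, X i ∈ Icc a c → γ ≤ knnDensity X k (X i)) {i j : Fin n} (hi : X i ∈ Icc a c)
    (hj : X j ∈ Icc a c) : (knnGraph X k γ).Reachable i j := by
  have hn := hS.n_pos
  have hk := hS.k_pos
  set s := k / (4 * n * F) with hs
  have hs0 : 0 < s := by positivity
  have key : ∀ (N : ℕ) (i j : Fin n), X i ∈ Icc a c → X j ∈ Icc a c → X i ≤ X j →
      X j ≤ X i + N * (s / 3) → (knnGraph X k γ).Reachable i j := by
    intro N
    induction N with
    | zero =>
      intro i j hi hj hij hji
      by_cases heq : i = j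
      · subst heq; exact SimpleGraph.Reachable.refl _
      refine SimpleGraph.Adj.reachable ⟨heq, hv i hi, hv j hj, ?_⟩
      have : X i = X j := le_antisymm hij (by simpa using hji)
      rw [this, sub_self, abs_zero]
      exact le_min (hS.radius_nonneg _) (hS.radius_nonneg _)
    | succ N ih =>
      intro i j hi hj hij hji
      have hadj : ∀ l, X l ∈ Icc a c → X i ≤ X l → X l ≤ X i + s →
          (knnGraph X k γ).Reachable i l := by
        intro l hl hil hli
        by_cases heq : i = l
        · subst heq; exact SimpleGraph.Reachable.refl _
        refine SimpleGraph.Adj.reachable ⟨heq, hv i hi, hv l hl, ?_⟩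
        rw [abs_sub_comm, abs_of_nonneg (by linarith)]
        exact le_min ((by linarith : X l - X i ≤ s).trans (hS.sup_radius (hS.mem i) hF))
          ((by linarith : X l - X i ≤ s).trans (hS.sup_radius (hS.mem l) hF))
      by_cases hle : X j ≤ X i + s
      · exact hadj j hj hij hle
      push Not at hle
      have hsub : Icc (X i + s / 3) (X i + 2 * s / 3) ⊆ Icc a c :=
        Icc_subset_Icc (by linarith [hi.1]) (by linarith [hj.2])
      obtain ⟨l, hl⟩ : ∃ l, X l ∈ Icc (X i + s / 3) (X i + 2 * s / 3) := by
        refine hS.dev.exists_mem hS.density hS.le_sup (by linarith [hi.1]) (by linarith)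
          (by linarith [hj.2]) (by have := hS.e_pos; positivity) (by nlinarith [hS.e_le]) ?_
        have h1 := le_distFun_sub hS.density (show X i + s / 3 ≤ X i + 2 * s / 3 by linarith)
          (by positivity) fun x hx => hf x (hsub hx)
        have h2 : n * (lam₀ / 4 * (X i + 2 * s / 3 - (X i + s / 3))) ≤
          n * (distFun f (X i + 2 * s / 3) - distFun f (X i + s / 3)) := by gcongr
        refine lt_of_lt_of_le ?_ h2
        have h3 : n * (lam₀ / 4 * (X i + 2 * s / 3 - (X i + s / 3))) = k * (lam₀ / (48 * F)) := by
          rw [hs]; field_simp; ring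
        rw [h3, mul_comm]
        refine mul_lt_mul_of_pos_left ?_ hk
        rw [lt_div_iff₀ (by positivity)]
        nlinarith [mul_pos hF hS.e_pos]
      refine (hadj l (hsub hl) (by linarith [hl.1]) (by linarith [hl.2])).trans
        (ih l j (hsub hl) hj (by linarith [hl.2]) ?_)
      push_cast at hji
      linarith [hl.1]
  have key2 : ∀ i j : Fin n, X i ∈ Icc a c → X j ∈ Icc a c → X i ≤ X j →
      (knnGraph X k γ).Reachable i j := by
    intro i j hi hj hij
    obtain ⟨N, hN⟩ := exists_nat_ge ((X j - X i) / (s / 3))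
    refine key N i j hi hj hij ?_
    rw [div_le_iff₀ (by positivity)] at hN
    linarith
  rcases le_total (X i) (X j) with h | h
  · exact key2 i j hi hj h
  · exact (key2 j i hj hi h).symm

theorem Regime.ρ_pos (hR : Regime lam₀ rM Cl Cu F g Cα α n k w η b ρ)
    (hS : RegularSample f F X k (8 * w ^ 2)) (hM : ModalConstants f lam₀ rM Cl Cu) : 0 < ρ := by
  have h1 := hS.n_pos
  have h2 := hS.k_pos
  have h3 := hM.lam₀_pos
  by_contra! h
  have : ρ * (n * lam₀) ≤ 0 := mul_nonpos_of_nonpos_of_nonneg h (by positivity)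
  linarith [hR.ρ_eq]

/-- In the core of a mode, the density estimate is close to its value at the mode. -/
theorem RegularSample.core_le_knnDensity (hS : RegularSample f F X k (8 * w ^ 2))
    (hM : ModalConstants f lam₀ rM Cl Cu)
    (hR : Regime lam₀ rM Cl Cu F g Cα α n k w η b ρ) {z : ℝ} (hz : z ∈ modes f) {i : Fin n}
    (hi : |X i - z| ≤ η * w) : f z * (1 - 10 * w ^ 2) ≤ knnDensity X k (X i) := by
  have hn := hS.n_pos
  have hk := hS.k_pos
  have hw := hR.w_pos
  have hη := hR.η_pos
  have hρ := hR.ρ_pos hS hM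
  have hlam := hM.lam₀_pos
  have hfz := hM.lam₀_lt hz
  have hw2 := hR.w_le
  have hw20 : 0 < w ^ 2 := by positivity
  have hρc := hR.ρ_le_core
  set a := f z * (1 - w ^ 2) with ha
  have ha0 : 0 < a := mul_pos (hlam.trans hfz) (by linarith)
  have hr : k * (1 + 8 * w ^ 2) / (2 * n * a) ≤ ρ := by
    rw [div_le_iff₀ (by positivity), ← hR.ρ_eq]
    have h1 : lam₀ * (1 + 8 * w ^ 2) ≤ 2 * a := by
      rw [ha]
      have : f z * (1 + 8 * w ^ 2) ≤ f z * (2 * (1 - w ^ 2)) :=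
        mul_le_mul_of_nonneg_left (by linarith) (by linarith)
      nlinarith
    calc ρ * (n * lam₀) * (1 + 8 * w ^ 2) = ρ * n * (lam₀ * (1 + 8 * w ^ 2)) := by ring
      _ ≤ ρ * n * (2 * a) := by gcongr
      _ = _ := by ring
  have hηb : η * w ≤ b * w := mul_le_mul_of_nonneg_right hR.η_le hw.le
  have hbw := hR.width_le
  have h1 := hS.le_knnDensity (hS.mem i) ha0 (by linarith [hR.ρ_le_half]) fun y hy => by
    have hy1 : |y - X i| ≤ ρ := by
      rw [abs_le]; constructor <;> linarith [hy.1, hy.2]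
    have hyz : |y - z| ≤ 21 / 20 * (η * w) := by
      have := abs_sub_le y (X i) z; linarith
    have h2 := (hM.near hz (hyz.trans (by linarith [mul_pos hη hw]))).2.2
    have h3 : (y - z) ^ 2 ≤ (21 / 20 * (η * w)) ^ 2 := by
      rw [← sq_abs]; exact pow_le_pow_left₀ (abs_nonneg _) hyz 2
    have h4 : Cu * (y - z) ^ 2 ≤ Cu * (21 / 20 * (η * w)) ^ 2 :=
      mul_le_mul_of_nonneg_left h3 hM.Cu_pos.le
    have h5 : Cu * (21 / 20 * (η * w)) ^ 2 ≤ lam₀ * w ^ 2 := by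
      have := mul_le_mul_of_nonneg_right hR.core hw20.le
      nlinarith [mul_pos hlam hw20]
    have h6 : lam₀ * w ^ 2 ≤ f z * w ^ 2 := mul_le_mul_of_nonneg_right hfz.le hw20.le
    rw [ha]; linarith
  refine le_trans ?_ h1
  rw [le_div_iff₀ (by positivity), ha, mul_assoc]
  refine mul_le_mul_of_nonneg_left ?_ (by linarith)
  nlinarith

theorem RegularSample.radius_le_ρ (hS : RegularSample f F X k (8 * w ^ 2))
    (hM : ModalConstants f lam₀ rM Cl Cu)
    (hR : Regime lam₀ rM Cl Cu F g Cα α n k w η b ρ) {i : Fin n}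
    (hi : lam₀ / 2 ≤ knnDensity X k (X i)) : knnRadius X k (X i) ≤ ρ := by
  have hn := hS.n_pos
  have hlam := hM.lam₀_pos
  refine (hS.radius_le_of_le_knnDensity (hS.mem i) (by positivity) hi).trans (le_of_eq ?_)
  rw [← hR.ρ_eq]; field_simp

/-- Points of the graph `G(γ)`, `γ` close to `f z`, that are connected to a point near the mode `z`
are near `z` themselves: a single step cannot jump over the shell where the density is too low. -/
theorem RegularSample.confined (hS : RegularSample f F X k (8 * w ^ 2))
    (hM : ModalConstants f lam₀ rM Cl Cu)
    (hR : Regime lam₀ rM Cl Cu F g Cα α n k w η b ρ) {z : ℝ} (hz : z ∈ modes f)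
    (hγ : f z * (1 - 110 * w ^ 2) ≤ γ) {i j : Fin n} (hj : |X j - z| ≤ 13 * (b * w))
    (h : (knnGraph X k γ).Reachable j i) : |X i - z| ≤ 13 * (b * w) := by
  have hw := hR.w_pos
  have hb := hR.b_pos
  have hρ := hR.ρ_pos hS hM
  have hlam := hM.lam₀_pos
  have hfz := hM.lam₀_lt hz
  have hw2 := hR.w_le
  have hw20 : 0 < w ^ 2 := by positivity
  have hρb := hR.ρ_le_width
  have hbM := hR.width_le
  have hfF := hS.le_sup z
  obtain ⟨p⟩ := h
  induction p with
  | nil => exact hj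
  | @cons u v _ huv _ ih =>
    refine ih ?_
    obtain ⟨-, -, hv, hd⟩ := huv
    by_contra! hfar
    have hγ2 : lam₀ / 2 ≤ γ := by nlinarith
    have hrv := hS.radius_le_ρ hM hR (hγ2.trans hv)
    have hdv : |X u - X v| ≤ ρ := (hd.trans (min_le_right _ _)).trans hrv
    have hvz : |X v - z| ≤ 13 * (b * w) + ρ := by
      have := abs_sub_le (X v) (X u) z
      rw [abs_sub_comm (X v) (X u)] at this; linarith
    have h1 := hS.knnDensity_le (a := f z - 168 * F * w ^ 2) (hS.mem v) (by
        have := hR.sup_le; nlinarith) fun y hy => by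
      have hyv : |y - X v| ≤ ρ := by
        rw [abs_le]; constructor <;> linarith [hy.1, hy.2]
      have h2 : |y - z| ≤ rM := by
        have := abs_sub_le y (X v) z; linarith
      have h3 : 1299 / 100 * (b * w) ≤ |y - z| := by
        have := abs_sub_le (X v) y z
        rw [abs_sub_comm (X v) y] at this; linarith
      have h4 := (hM.near hz h2).2.1
      have h5 : (1299 / 100 * (b * w)) ^ 2 ≤ (y - z) ^ 2 := by
        rw [← sq_abs (y - z)]; exact pow_le_pow_left₀ (by positivity) h3 2
      have h6 := mul_le_mul_of_nonneg_left h5 hM.Cl_pos.le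
      have h7 : Cl * (1299 / 100 * (b * w)) ^ 2 = (1299 / 100) ^ 2 * (F * w ^ 2) := by
        rw [← hR.b_sq]; ring
      have h8 : 0 ≤ F * w ^ 2 := mul_nonneg hS.nonneg_sup hw20.le
      linarith
    have h2 : f z * (1 - 110 * w ^ 2) * (1 - 8 * w ^ 2) ≤ knnDensity X k (X v) * (1 - 8 * w ^ 2) :=
      mul_le_mul_of_nonneg_right (hγ.trans hv) (by linarith)
    have h3 : f z * w ^ 2 ≤ F * w ^ 2 := mul_le_mul_of_nonneg_right hfF hw20.le
    have h4 : 0 < f z * w ^ 2 := mul_pos (hlam.trans hfz) hw20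
    nlinarith [mul_pos h4 hw20]

end Clusters

section Clusters

variable {n k : ℕ} {f : ℝ → ℝ} {X : Fin n → ℝ} {lam₀ rM Cl Cu F g w η b ρ γ : ℝ} {Cα α : ℝ≥0}

theorem ModalConstants.lt_and_mem (hM : ModalConstants f lam₀ rM Cl Cu)
    (hd : IsDensityOn f (Icc 0 1)) {z x : ℝ} (hz : z ∈ modes f) (hx : |x - z| ≤ rM) :
    lam₀ < f x ∧ x ∈ Icc (0 : ℝ) 1 := by
  have h1 := (hM.near hz hx).1
  refine ⟨h1, ?_⟩
  by_contra h
  rw [hd.eq_zero x h] at h1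
  linarith [hM.lam₀_pos]

theorem Regime.core_le (hR : Regime lam₀ rM Cl Cu F g Cα α n k w η b ρ) : η * w ≤ rM := by
  have h1 := mul_le_mul_of_nonneg_right hR.η_le hR.w_pos.le
  have h2 := mul_pos hR.b_pos hR.w_pos
  linarith [hR.width_le]

theorem RegularSample.exists_core (hS : RegularSample f F X k (8 * w ^ 2))
    (hM : ModalConstants f lam₀ rM Cl Cu)
    (hR : Regime lam₀ rM Cl Cu F g Cα α n k w η b ρ) {z : ℝ} (hz : z ∈ modes f) :
    ∃ i, |X i - z| ≤ η * w := by
  have hn := hS.n_pos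
  have hk := hS.k_pos
  have hw2 := hR.w_le
  have hw20 : 0 < w ^ 2 := by have := hR.w_pos; positivity
  have hlam := hM.lam₀_pos
  have hηw0 : 0 < η * w := mul_pos hR.η_pos hR.w_pos
  have hz01 : ∀ x, |x - z| ≤ η * w → lam₀ < f x ∧ x ∈ Icc (0 : ℝ) 1 := fun x hx =>
    hM.lt_and_mem hS.density hz (hx.trans hR.core_le)
  have hza := (hz01 (z - η * w) (by rw [sub_sub_cancel_left, abs_neg, abs_of_pos hηw0])).2
  have hzb := (hz01 (z + η * w) (by rw [add_sub_cancel_left, abs_of_pos hηw0])).2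
  obtain ⟨i, hi⟩ := hS.dev.exists_mem hS.density hS.le_sup (by linarith [hza.1])
    (show z - η * w ≤ z + η * w by linarith) (by linarith [hzb.2]) (by positivity) (by nlinarith) (by
      have h1 := le_distFun_sub hS.density (show z - η * w ≤ z + η * w by linarith) hlam.le
        fun x hx => (hz01 x (abs_le.2 ⟨by linarith [hx.1], by linarith [hx.2]⟩)).1.le
      have h2 := mul_le_mul_of_nonneg_left h1 hn.le
      refine lt_of_lt_of_le ?_ h2
      have h3 : ρ * (n * lam₀) * 20 ≤ η * w * (n * lam₀) := by
        have := mul_le_mul_of_nonneg_right hR.ρ_le_core (show 0 ≤ n * lam₀ by positivity)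
        linarith
      rw [hR.ρ_eq] at h3
      nlinarith)
  exact ⟨i, abs_le.2 ⟨by linarith [hi.1], by linarith [hi.2]⟩⟩

/-- Every sample point with a high estimate is connected to the whole core of a mode that is at
least as high, up to a small relative error. From the point `y` of largest density in the
nearest-neighbour ball around the sample point one climbs to a mode `z`. Between the ball and `z`
the density is at least `f y`, and it is at most `f y` in the ball, so the estimate at sample points
on the way to `z` is almost as large as at the starting point. -/
theorem RegularSample.exists_home (hS : RegularSample f F X k (8 * w ^ 2))
    (hM : ModalConstants f lam₀ rM Cl Cu)
    (hR : Regime lam₀ rM Cl Cu F g Cα α n k w η b ρ) (hf : ModalStructure f) (hα : 0 < α)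
    (hh : HolderOnWith Cα α f (Icc 0 1)) {i : Fin n}
    (hi : 9 / 10 * lam₀ ≤ knnDensity X k (X i))
    (hγ : γ ≤ knnDensity X k (X i) * (1 - 100 * w ^ 2)) :
    ∃ z ∈ modes f, knnDensity X k (X i) * (1 - 8 * w ^ 2) ≤ f z ∧
      ∀ j, |X j - z| ≤ η * w → (knnGraph X k γ).Reachable i j := by
  have hn := hS.n_pos
  have hk := hS.k_pos
  have hw := hR.w_pos
  have hw2 := hR.w_le
  have hw20 : 0 < w ^ 2 := by have := hR.w_pos; positivity
  have hρ := hR.ρ_pos hS hM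
  have hlam := hM.lam₀_pos
  have hF : 0 < F := by rw [← hR.b_sq]; exact mul_pos hM.Cl_pos (pow_pos hR.b_pos 2)
  have hcont : ContinuousOn f (Icc 0 1) := hh.continuousOn hα
  have hr := hS.radius_le_ρ hM hR (show lam₀ / 2 ≤ knnDensity X k (X i) by linarith)
  have hr0 := hS.radius_pos (hS.mem i)
  have hmul := hS.knnDensity_mul (hS.mem i)
  have hmass := hS.le_mass (hS.mem i)
  have hXi := hS.mem i
  have hle := fun a ha0 ha => hS.knnDensity_le (a := a) hXi ha0 ha
  set v := knnDensity X k (X i) with hvdef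
  set r := knnRadius X k (X i) with hrdef
  have hv0 : 0 < v := by linarith
  have hρc := hR.ρ_le_core
  obtain ⟨y, ⟨hyB, hy01⟩, hymax⟩ : ∃ y ∈ Icc (X i - r) (X i + r) ∩ Icc 0 1,
      IsMaxOn f (Icc (X i - r) (X i + r) ∩ Icc 0 1) y :=
    (isCompact_Icc.inter isCompact_Icc).exists_isMaxOn
      ⟨X i, ⟨by linarith, by linarith⟩, hXi⟩ (hcont.mono inter_subset_right)
  set c := f y with hc
  have hc0 : 0 ≤ c := hS.density.nonneg y
  have hcB : ∀ x ∈ Icc (X i - r) (X i + r), f x ≤ c := by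
    intro x hx
    by_cases hx01 : x ∈ Icc (0 : ℝ) 1
    · exact hymax ⟨hx, hx01⟩
    · rw [hS.density.eq_zero x hx01]; exact hc0
  have hvc : v * (1 - 8 * w ^ 2) ≤ c := hle c hc0 hcB
  have hclam : 89 / 100 * lam₀ ≤ c := by nlinarith
  obtain ⟨z, hz, hzu⟩ := hf.exists_mode_above hS.density hcont (show 0 < f y by linarith)
  have hcz : c ≤ f z := hzu z right_mem_uIcc
  have hz01 : ∀ x, |x - z| ≤ η * w → lam₀ < f x ∧ x ∈ Icc (0 : ℝ) 1 := fun x hx =>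
    hM.lt_and_mem hS.density hz (hx.trans hR.core_le)
  have hηw0 : 0 < η * w := mul_pos hR.η_pos hw
  have hza := (hz01 (z - η * w) (by rw [sub_sub_cancel_left, abs_neg, abs_of_pos hηw0])).2
  have hzb := (hz01 (z + η * w) (by rw [add_sub_cancel_left, abs_of_pos hηw0])).2
  have hvcore : ∀ j, |X j - z| ≤ η * w → γ ≤ knnDensity X k (X j) := fun j hj => by
    refine (hγ.trans ?_).trans (hS.core_le_knnDensity hM hR hz hj)
    have h1 : v * (1 - 8 * w ^ 2) * (1 - 10 * w ^ 2) ≤ f z * (1 - 10 * w ^ 2) :=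
      mul_le_mul_of_nonneg_right (hvc.trans hcz) (by linarith)
    nlinarith [mul_pos hv0 hw20, mul_pos (mul_pos hv0 hw20) hw20]
  -- points with more mass than the ball around `X i` have a high estimate
  set d := 40 * w ^ 2 * r with hd
  have hd0 : 0 < d := by positivity
  have hrd : r + d ≤ 21 / 20 * ρ := by
    have : d ≤ 1 / 20 * r := by rw [hd]; nlinarith
    linarith
  have hgain : ∀ j, distFun f (X i + r) - distFun f (X i - r) + c * d
      ≤ distFun f (X j + (r + d)) - distFun f (X j - (r + d)) → γ ≤ knnDensity X k (X j) := by
    intro j hj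
    have h1 : k * (1 + 8 * w ^ 2) ≤
        n * (distFun f (X j + (r + d)) - distFun f (X j - (r + d))) := by
      have h2 := mul_le_mul_of_nonneg_left hj hn.le
      have h3 : k * (16 * w ^ 2) ≤ n * (c * d) := by
        have h4 : n * (v * (1 - 8 * w ^ 2) * d) ≤ n * (c * d) := by gcongr
        refine le_trans ?_ h4
        have h5 : n * (v * (1 - 8 * w ^ 2) * d) = (v * (2 * n * r)) * (20 * w ^ 2 * (1 - 8 * w ^ 2)) := by
          rw [hd]; ring
        rw [h5, hmul]
        refine mul_le_mul_of_nonneg_left ?_ hk.le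
        nlinarith
      linarith
    have h2 := hS.radius_le_of_mass (hS.mem j) (by linarith) (by linarith [hR.ρ_le_half]) h1
    have h3 := hS.le_knnDensity_of_radius_le (hS.mem j) h2
    refine (hγ.trans ?_).trans h3
    rw [le_div_iff₀ (by positivity), ← hmul, hd]
    have h4 : v * (1 - 100 * w ^ 2) * (2 * n * (r + 40 * w ^ 2 * r))
        = v * (2 * n * r) * ((1 - 100 * w ^ 2) * (1 + 40 * w ^ 2)) := by ring
    rw [h4]
    refine mul_le_of_le_one_right (by positivity) ?_
    nlinarith
  have hhol : ∀ x ∈ Icc (0 : ℝ) 1, |x - y| ≤ 2 * ρ → lam₀ / 4 ≤ f x := fun x hx hxy => by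
    have h1 := hh.dist_le hx hy01
    rw [Real.dist_eq, Real.dist_eq] at h1
    have h2 : (Cα : ℝ) * |x - y| ^ (α : ℝ) ≤ Cα * (2 * ρ) ^ (α : ℝ) := by gcongr
    have h3 := neg_abs_le (f x - f y)
    linarith [hR.holder]
  have hmono := distFun_mono hS.density
  refine ⟨z, hz, hvc.trans hcz, fun j hj => ?_⟩
  have he : 50 * F * (8 * w ^ 2) < lam₀ := by linarith [hR.sup_le]
  have hj' := abs_le.1 hj
  rcases le_or_gt |X i - z| (η * w) with hnear | hfar
  · refine hS.reachable_of_interval hF hlam he hza.1 hzb.2 (fun x hx => ?_)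
      (fun l hl => hvcore l ?_) ⟨?_, ?_⟩ ⟨by linarith, by linarith⟩
    · linarith [(hz01 x (abs_le.2 ⟨by linarith [hx.1], by linarith [hx.2]⟩)).1]
    · exact abs_le.2 ⟨by linarith [hl.1], by linarith [hl.2]⟩
    · linarith [(abs_le.1 hnear).1]
    · linarith [(abs_le.1 hnear).2]
  rcases le_total (X i) z with hlt | hlt
  · rw [abs_of_nonpos (by linarith)] at hfar
    refine hS.reachable_of_interval hF hlam he (a := X i) hXi.1 hzb.2 (fun x hx => ?_)
      (fun l hl => ?_) ⟨le_rfl, by linarith⟩ ⟨?_, by linarith⟩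
    · rcases le_total x (X i + r) with h1 | h1
      · refine hhol x ⟨hXi.1.trans hx.1, by linarith [hzb.2]⟩ (abs_le.2 ?_)
        constructor <;> linarith [hx.1, hyB.1, hyB.2]
      rcases le_total x z with h2 | h2
      · linarith [hzu x (mem_uIcc.2 (Or.inl ⟨hyB.2.trans h1, h2⟩))]
      · linarith [(hz01 x (abs_le.2 ⟨by linarith, by linarith [hx.2]⟩)).1]
    · by_cases hcore : |X l - z| ≤ η * w
      · exact hvcore l hcore
      have hl1 : X l + η * w < z := by
        by_contra! h
        exact hcore (abs_le.2 ⟨by linarith, by linarith [hl.2]⟩)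
      refine hgain l (le_sub_of_shift hmono (z := z) hr0.le hc0 hd0.le ?_ ?_ hl.1 (by linarith))
      · exact fun a c' h1 h2 h3 => distFun_sub_le hS.density h2 hc0 fun x hx =>
          hcB x ⟨h1.trans hx.1, hx.2.trans h3⟩
      · exact fun a c' h1 h2 h3 => le_distFun_sub hS.density h2 hc0 fun x hx =>
          hzu x (mem_uIcc.2 (Or.inl ⟨hyB.2.trans (h1.trans hx.1), hx.2.trans h3⟩))
    · linarith
  · rw [abs_of_nonneg (by linarith)] at hfar
    refine hS.reachable_of_interval hF hlam he (c := X i) hza.1 hXi.2 (fun x hx => ?_)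
      (fun l hl => ?_) ⟨by linarith, le_rfl⟩ ⟨by linarith, ?_⟩
    · rcases le_total (X i - r) x with h1 | h1
      · refine hhol x ⟨by linarith [hza.1], hx.2.trans hXi.2⟩ (abs_le.2 ?_)
        constructor <;> linarith [hx.2, hyB.1, hyB.2]
      rcases le_total z x with h2 | h2
      · linarith [hzu x (mem_uIcc.2 (Or.inr ⟨h2, h1.trans hyB.1⟩))]
      · linarith [(hz01 x (abs_le.2 ⟨by linarith [hx.1], by linarith⟩)).1]
    · by_cases hcore : |X l - z| ≤ η * w
      · exact hvcore l hcore
      have hl1 : z < X l - η * w := by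
        by_contra! h
        exact hcore (abs_le.2 ⟨by linarith [hl.1], by linarith⟩)
      -- the mirror image of the previous case
      have := le_sub_of_shift (G := fun t => -distFun f (-t)) (u := -X i) (r := r) (c := c)
        (z := -z) (x := -X l) (d := d) (fun a c' h => neg_le_neg (hmono (neg_le_neg h))) hr0.le hc0
        hd0.le
        (fun a c' h1 h2 h3 => by
          have := distFun_sub_le hS.density (neg_le_neg h2) hc0 fun x hx =>
            hcB x ⟨by linarith [hx.1], by linarith [hx.2]⟩
          linarith)
        (fun a c' h1 h2 h3 => by
          have := le_distFun_sub hS.density (neg_le_neg h2) hc0 fun x hx =>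
            hzu x (mem_uIcc.2 (Or.inr ⟨by linarith [hx.1], by linarith [hx.2, hyB.1]⟩))
          linarith) (by linarith [hl.2]) (by linarith)
      refine hgain l ?_
      rw [show -(-X i + r) = X i - r by ring, show -(-X i - r) = X i + r by ring,
        show -(-X l + (r + d)) = X l - (r + d) by ring,
        show -(-X l - (r + d)) = X l + (r + d) by ring] at this
      linarith
    · linarith

/-- Some radius separates the observations near `xp` from those in the shell `h ≤ |x - xp| ≤ 13 h`:
some ball of this radius around an observation in the core of `xp` contains `k` observations, but
no such ball around an observation in the shell does. -/
def SharpAt {n : ℕ} (X : Fin n → ℝ) (k : ℕ) (xp core h : ℝ) : Prop :=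
  ∃ r j, |X j - xp| ≤ core ∧ k ≤ cnt (Metric.closedBall (X j) r) X ∧
    ∀ i, h ≤ |X i - xp| → |X i - xp| ≤ 13 * h → cnt (Metric.closedBall (X i) r) X < k

/-- The deterministic part of the analysis of the `p`-mode estimator. -/
theorem RegularSample.abs_sub_lt_of_isPModeEstimate (hS : RegularSample f F X k (8 * w ^ 2))
    (hM : ModalConstants f lam₀ rM Cl Cu)
    (hR : Regime lam₀ rM Cl Cu F g Cα α n k w η b ρ) (hf : ModalStructure f) (hα : 0 < α)
    (hh : HolderOnWith Cα α f (Icc 0 1)) {p : ℕ} {δ xp xhat : ℝ} (hβ : beta n k δ = 100 * w ^ 2)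
    (hpl : p ≤ (modes f).ncard) (hxp : IsPMode f p xp) (hg : HasModeGap f p g)
    (hsharp : SharpAt X k xp (η * w) (b * w)) (hx : IsPModeEstimate p k δ X xhat) :
    |xhat - xp| < b * w := by
  obtain ⟨T, hT, hxpT, hxpmin⟩ := hxp
  obtain ⟨hTm, hTcard, -⟩ := id hT
  rw [min_eq_left hpl] at hTcard
  have hn := hS.n_pos
  have hk := hS.k_pos
  have hw := hR.w_pos
  have hw2 := hR.w_le
  have hw20 : 0 < w ^ 2 := by positivity
  have hρ := hR.ρ_pos hS hM
  have hlam := hM.lam₀_pos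
  have hF : 0 < F := by rw [← hR.b_sq]; exact mul_pos hM.Cl_pos (pow_pos hR.b_pos 2)
  have hηw0 : 0 < η * w := mul_pos hR.η_pos hw
  have hbw0 : 0 < b * w := mul_pos hR.b_pos hw
  have hηb : η * w ≤ b * w := mul_le_mul_of_nonneg_right hR.η_le hw.le
  have hbM := hR.width_le
  set K : ℝ → Set (Fin n) := fun z => {i | |X i - z| ≤ η * w} with hK
  set B : ℝ → Set (Fin n) := fun z => {i | |X i - z| ≤ 13 * (b * w)} with hB
  have hKne : ∀ z ∈ T, (K z).Nonempty := fun z hz => hS.exists_core hM hR (hTm hz)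
  have htop : ∀ z, ∃ i, z ∈ T → i ∈ K z ∧ ∀ j ∈ K z, knnDensity X k (X j) ≤ knnDensity X k (X i) := by
    intro z
    by_cases hz : z ∈ T
    · obtain ⟨i, hi, hi'⟩ := Set.exists_max_image (K z) (fun i => knnDensity X k (X i))
        (Set.toFinite _) (hKne z hz)
      exact ⟨i, fun _ => ⟨hi, hi'⟩⟩
    · exact ⟨⟨0, by exact_mod_cast hn⟩, fun h => absurd h hz⟩
  choose top htop using htop
  have htopv : ∀ z ∈ T, f z * (1 - 10 * w ^ 2) ≤ knnDensity X k (X (top z)) := fun z hz =>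
    hS.core_le_knnDensity hM hR (hTm hz) (htop z hz).1
  obtain ⟨l, hlnd, hl, hsort, ch, hch, hxhat⟩ := hx
  have hdis : ∀ z ∈ T, ∀ z' ∈ T, z ≠ z' → rM < |z - z'| := fun z hz z' hz' hne =>
    hM.rM_lt_abs_sub (hTm hz) (hTm hz') hne
  obtain ⟨hspec1, hspec2⟩ := clusters_spec (p := p) (δ := δ) (X := X) (K := K) (B := B) (top := top)
    (hf.finite.subset hTm) hTcard
    (by rw [hβ]; linarith) (fun z hz => (htop z hz).1)
    (by
      rintro i ⟨z₀, hz₀, hi⟩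
      have hfz := hM.lam₀_lt (hTm hz₀)
      have h1 := (htopv z₀ hz₀).trans hi
      obtain ⟨z, hz, hvz, hreach⟩ := hS.exists_home hM hR hf hα hh (i := i)
        (γ := knnDensity X k (X i) - beta n k δ * knnDensity X k (X i)) (by nlinarith)
        (by rw [hβ]; linarith)
      refine ⟨z, ?_, hreach⟩
      by_contra hzT
      have h2 := hg T hT z₀ hz₀ z ⟨hz, hzT⟩
      have h3 : f z₀ * (1 - 10 * w ^ 2) * (1 - 8 * w ^ 2) ≤
          knnDensity X k (X i) * (1 - 8 * w ^ 2) := mul_le_mul_of_nonneg_right h1 (by linarith)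
      have h4 : f z₀ * w ^ 2 ≤ F * w ^ 2 := mul_le_mul_of_nonneg_right (hS.le_sup _) hw20.le
      have h5 : 0 < f z₀ * w ^ 2 := mul_pos (hlam.trans hfz) hw20
      have := hR.gap
      nlinarith [mul_pos h5 hw20])
    (by
      intro i z hz hti hvi j hj
      have hfz := hM.lam₀_lt (hTm hz)
      refine hS.confined hM hR (hTm hz) (γ := knnDensity X k (X i) - beta n k δ * knnDensity X k (X i))
        ?_ (j := top z) ?_ (SimpleGraph.Reachable.trans (SimpleGraph.Reachable.symm hti) hj)
      · rw [hβ]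
        have h1 := (htopv z hz).trans hvi
        have h2 := mul_le_mul_of_nonneg_right h1 (show 0 ≤ 1 - 100 * w ^ 2 by linarith)
        have h5 : 0 < f z * w ^ 2 := mul_pos (hlam.trans hfz) hw20
        nlinarith [mul_pos h5 hw20]
      · have : |X (top z) - z| ≤ η * w := (htop z hz).1
        linarith)
    (by
      intro z hz z' hz' hne
      refine Set.disjoint_left.2 fun i hi hi' => ?_
      have h1 : |X i - z| ≤ 13 * (b * w) := hi
      have h2 : |X i - z'| ≤ 13 * (b * w) := hi'
      have h3 := abs_sub_le z (X i) z'
      rw [abs_sub_comm z (X i)] at h3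
      linarith [hdis z hz z' hz' hne])
    hl hsort
  -- the maximum over a cluster of `xp` is attained close to `xp`
  have hclose : ∀ A ∈ clusters p k δ X l, IsClusterOf K B A xp → |X (ch A) - xp| < b * w := by
    intro A hA hAxp
    obtain ⟨r, j, hj, hjr, hshell⟩ := hsharp
    obtain ⟨hmem, hmax⟩ := hch A hA
    by_contra! hge
    have h1 := hshell (ch A) hge (hAxp.2 hmem)
    have h2 : r < knnRadius X k (X (ch A)) := by
      by_contra! h
      exact absurd ((knnRadius_le_iff hS.one_le hS.le_card).1 h) (not_le.2 h1)
    have h3 : knnRadius X k (X j) < knnRadius X k (X (ch A)) := (knnRadius_le hS.one_le hjr).trans_lt h2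
    have h4 : knnDensity X k (X (ch A)) < knnDensity X k (X j) := by
      unfold knnDensity
      have := hS.radius_pos (hS.mem j)
      gcongr
    exact absurd (hmax j (hAxp.1 hj)) (not_le.2 h4)
  obtain ⟨A, hA, hAxp⟩ := hspec2 xp hxpT
  obtain ⟨⟨A', hA', rfl⟩, hleast⟩ := hxhat
  obtain ⟨z, hz, hAz⟩ := hspec1 A' hA'
  by_cases hzx : z = xp
  · subst hzx; exact hclose A' hA' hAz
  exfalso
  have h1 := hleast ⟨A, hA, rfl⟩
  have h2 := abs_lt.1 (hclose A hA hAxp)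
  have h3 : |X (ch A') - z| ≤ 13 * (b * w) := hAz.2 (hch A' hA').1
  have h4 := hdis z hz xp hxpT hzx
  rw [abs_of_nonneg (by linarith [hxpmin hz])] at h4
  linarith [(abs_le.1 h3).1]

end Clusters

/-! ### Uniform deviation of the counts of intervals -/

/-- Chernoff's bound for both tails of a count with mean at most `m`; the additional `1` allows for
rounding the threshold to an integer. -/
theorem pi_lt_abs_cnt_sub_le {E : Type*} [MeasurableSpace E] (μ : Measure E) [IsProbabilityMeasure μ]
    {A : Set E} (hA : MeasurableSet A) {n : ℕ} {m t : ℝ} (hm : 0 < m) (hq : n * μ.real A ≤ m)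
    (ht : 0 ≤ t) (htm : t ≤ 2 * m) :
    Measure.pi (fun _ : Fin n => μ) {X | t + 1 < |(cnt A X : ℝ) - n * μ.real A|}
      ≤ ENNReal.ofReal (2 * Real.exp (-(t ^ 2 / (4 * m)))) := by
  set q := μ.real A with hqdef
  have h0 : 0 ≤ q := measureReal_nonneg
  have h1 : q ≤ 1 := measureReal_le_one
  have hup : Measure.pi (fun _ : Fin n => μ) {X | ⌈n * q + t⌉₊ ≤ cnt A X}
      ≤ ENNReal.ofReal (Real.exp (-(t ^ 2 / (4 * m)))) := by
    rw [pi_le_cnt μ hA]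
    exact ENNReal.ofReal_le_ofReal (binTail_le_exp h0 h1 hm hq ht htm (Nat.le_ceil _))
  have hlow : Measure.pi (fun _ : Fin n => μ) {X | (cnt A X : ℝ) < n * q - (t + 1)}
      ≤ ENNReal.ofReal (Real.exp (-(t ^ 2 / (4 * m)))) := by
    by_cases hle : n * q - (t + 1) ≤ 0
    · refine (measure_mono_null (t := ∅) (fun X hX => ?_) measure_empty).trans_le zero_le
      have hX : (cnt A X : ℝ) < n * q - (t + 1) := hX
      have := Nat.cast_nonneg (α := ℝ) (cnt A X)
      linarith
    push Not at hle
    refine (measure_mono (t := {X | cnt A X < ⌈n * q - (t + 1)⌉₊}) fun X hX => ?_).trans ?_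
    · have hX : (cnt A X : ℝ) < n * q - (t + 1) := hX
      exact Nat.lt_ceil.2 hX
    · rw [pi_cnt_lt μ hA]
      refine ENNReal.ofReal_le_ofReal ((one_sub_binTail_le_exp (m := n * q) (s := t) h0 h1
        (by linarith) le_rfl ht (by linarith) ?_).trans ?_)
      · linarith [Nat.ceil_lt_add_one hle.le]
      · apply Real.exp_le_exp.2
        have : 0 < n * q := by linarith
        gcongr
  calc _ ≤ Measure.pi (fun _ : Fin n => μ)
        ({X | ⌈n * q + t⌉₊ ≤ cnt A X} ∪ {X | (cnt A X : ℝ) < n * q - (t + 1)}) := by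
        refine measure_mono fun X hX => ?_
        have hX : t + 1 < |(cnt A X : ℝ) - n * q| := hX
        rcases lt_abs.1 hX with h | h
        · exact Or.inl (Nat.ceil_le.2 (by linarith))
        · exact Or.inr (show (cnt A X : ℝ) < n * q - (t + 1) by linarith)
    _ ≤ _ := by
        refine (measure_union_le _ _).trans ((add_le_add hup hlow).trans_eq ?_)
        rw [← ENNReal.ofReal_add (by positivity) (by positivity)]; ring_nf

/-- The counts of all intervals are controlled by those of the intervals with end points in a grid
so fine that a cell contains at most one observation on average. -/
theorem sampleLaw_not_unifDev_le {f : ℝ → ℝ} {S : Set ℝ} {F m t : ℝ} {n : ℕ} (hd : IsDensityOn f S)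
    (hF : ∀ x, f x ≤ F) (hF0 : 0 < F) (hn : 0 < n) (hm : 0 ≤ m) (ht : 0 ≤ t) (htm : t ≤ 2 * m) :
    sampleLaw f n {X | ¬ UnifDev f X m (t + 3)} ≤
      ENNReal.ofReal ((3 * ⌈n * F⌉₊ + 1) ^ 2 * (2 * Real.exp (-(t ^ 2 / (4 * (m + 2)))))) := by
  have := hd.isProbabilityMeasure
  have hn0 : (0 : ℝ) < n := by exact_mod_cast hn
  set N := ⌈n * F⌉₊ with hN
  have hN0 : 0 < N := Nat.ceil_pos.2 (by positivity)
  have hN0' : (0 : ℝ) < N := by exact_mod_cast hN0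
  have hNF : n * F ≤ N := Nat.le_ceil _
  set x : ℕ → ℝ := fun j => j / N - 1 with hx
  have hxmono : Monotone x := fun i j h => by simp only [hx]; gcongr
  have hcell : ∀ a b : ℝ, a ≤ b → b - a ≤ 1 / N → n * (distFun f b - distFun f a) ≤ 1 := by
    intro a b hab hle
    have h1 := distFun_sub_le hd hab hF0.le fun x _ => hF x
    calc n * (distFun f b - distFun f a) ≤ n * (F * (1 / N)) := by
          refine mul_le_mul_of_nonneg_left (h1.trans ?_) hn0.le
          exact mul_le_mul_of_nonneg_left hle hF0.le
      _ = n * F / N := by ring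
      _ ≤ 1 := (div_le_one hN0').2 hNF
  set bad : ℕ × ℕ → Set (Fin n → ℝ) := fun p => {X | x p.1 ≤ x p.2 ∧
    n * (distFun f (x p.2) - distFun f (x p.1)) ≤ m + 2 ∧
    t + 1 < |(cnt (Icc (x p.1) (x p.2)) X : ℝ) - n * (distFun f (x p.2) - distFun f (x p.1))|}
    with hbad
  have hbadle : ∀ p, sampleLaw f n (bad p) ≤
      ENNReal.ofReal (2 * Real.exp (-(t ^ 2 / (4 * (m + 2))))) := by
    intro p
    by_cases h : x p.1 ≤ x p.2 ∧ n * (distFun f (x p.2) - distFun f (x p.1)) ≤ m + 2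
    · rw [← law_real_Icc hd h.1] at h
      refine (measure_mono fun X hX => ?_).trans
        (pi_lt_abs_cnt_sub_le (law f) measurableSet_Icc (by linarith) h.2 ht (by linarith))
      have hX := hX.2.2
      rw [← law_real_Icc hd h.1] at hX
      exact hX
    · refine (measure_mono_null (t := ∅) (fun X hX => ?_) measure_empty).trans_le zero_le
      exact absurd ⟨hX.1, hX.2.1⟩ h
  set I := Finset.range (3 * N + 1) ×ˢ Finset.range (3 * N + 1) with hI
  have hsub : {X | ¬ UnifDev f X m (t + 3)} ⊆ ⋃ p ∈ I, bad p := by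
    intro X hX
    by_contra hnot
    refine hX fun a b ha hab hb hmass => ?_
    have hgood : ∀ i j, i ≤ j → j ≤ 3 * N →
        n * (distFun f (x j) - distFun f (x i)) ≤ m + 2 →
        |(cnt (Icc (x i) (x j)) X : ℝ) - n * (distFun f (x j) - distFun f (x i))| ≤ t + 1 := by
      intro i j hij hj hmass
      by_contra! hlt
      refine hnot (mem_biUnion (x := (i, j)) ?_ ⟨hxmono hij, hmass, hlt⟩)
      simp only [hI, Finset.coe_product, Finset.coe_range, mem_prod, mem_Iio]
      omega
    have ha0 : 0 ≤ (a + 1) * N := mul_nonneg (by linarith) hN0'.le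
    have hb0 : 0 ≤ (b + 1) * N := mul_nonneg (by linarith) hN0'.le
    have hab' : (a + 1) * N ≤ (b + 1) * N := by gcongr
    have hbN : ⌈(b + 1) * N⌉₊ ≤ 3 * N := by
      refine Nat.ceil_le.2 ?_
      push_cast
      exact mul_le_mul_of_nonneg_right (by linarith) hN0'.le
    have hfl : ∀ y : ℝ, 0 ≤ (y + 1) * N → x ⌊(y + 1) * N⌋₊ ≤ y ∧ y - x ⌊(y + 1) * N⌋₊ ≤ 1 / N := by
      intro y hy
      have h1 := Nat.floor_le hy
      have h2 := (Nat.lt_floor_add_one ((y + 1) * N)).le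
      simp only [hx]
      constructor
      · rw [sub_le_iff_le_add, div_le_iff₀ hN0']; exact h1
      · have : y + 1 ≤ (⌊(y + 1) * N⌋₊ + 1) / N := (le_div_iff₀ hN0').2 h2
        rw [add_div] at this; linarith
    have hce : ∀ y : ℝ, 0 ≤ (y + 1) * N → y ≤ x ⌈(y + 1) * N⌉₊ ∧ x ⌈(y + 1) * N⌉₊ - y ≤ 1 / N := by
      intro y hy
      have h1 := Nat.le_ceil ((y + 1) * N)
      have h2 := (Nat.ceil_lt_add_one hy).le
      simp only [hx]
      constructor
      · rw [le_sub_iff_add_le, le_div_iff₀ hN0']; exact h1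
      · have : (⌈(y + 1) * N⌉₊ - 1) / N ≤ y + 1 := (div_le_iff₀ hN0').2 (by linarith)
        rw [sub_div] at this; linarith
    obtain ⟨fa1, fa2⟩ := hfl a ha0
    obtain ⟨fb1, fb2⟩ := hfl b hb0
    obtain ⟨ca1, ca2⟩ := hce a ha0
    obtain ⟨cb1, cb2⟩ := hce b hb0
    have m1 := hcell _ _ fa1 fa2
    have m2 := hcell _ _ fb1 fb2
    have m3 := hcell _ _ ca1 ca2
    have m4 := hcell _ _ cb1 cb2
    have hmono := distFun_mono hd
    rw [abs_le]
    constructor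
    · rcases le_or_gt ⌈(a + 1) * N⌉₊ ⌊(b + 1) * N⌋₊ with hle | hlt
      · have h1 := abs_le.1 (hgood _ _ hle ((Nat.floor_le_ceil _).trans hbN) (by
          have e1 : n * distFun f (x ⌊(b + 1) * N⌋₊) ≤ n * distFun f b := by gcongr; exact hmono fb1
          have e2 : n * distFun f a ≤ n * distFun f (x ⌈(a + 1) * N⌉₊) := by gcongr; exact hmono ca1
          linarith))
        have h2 : (cnt (Icc (x ⌈(a + 1) * N⌉₊) (x ⌊(b + 1) * N⌋₊)) X : ℝ) ≤ cnt (Icc a b) X :=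
          Nat.cast_le.2 (cnt_mono (Icc_subset_Icc ca1 fb1) X)
        linarith [h1.1]
      · have h1 : distFun f (x ⌊(b + 1) * N⌋₊) ≤ distFun f (x ⌈(a + 1) * N⌉₊) :=
          hmono (hxmono hlt.le)
        have h2 : n * distFun f (x ⌊(b + 1) * N⌋₊) ≤ n * distFun f (x ⌈(a + 1) * N⌉₊) := by gcongr
        have := Nat.cast_nonneg (α := ℝ) (cnt (Icc a b) X)
        linarith
    · have h1 := abs_le.1 (hgood ⌊(a + 1) * N⌋₊ ⌈(b + 1) * N⌉₊
        ((Nat.floor_le_ceil _).trans (Nat.ceil_mono hab')) hbN (by linarith))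
      have h2 : (cnt (Icc a b) X : ℝ) ≤ cnt (Icc (x ⌊(a + 1) * N⌋₊) (x ⌈(b + 1) * N⌉₊)) X :=
        Nat.cast_le.2 (cnt_mono (Icc_subset_Icc fa1 cb1) X)
      linarith [h1.2]
  refine (measure_mono hsub).trans ((measure_biUnion_finset_le _ _).trans ?_)
  refine (Finset.sum_le_card_nsmul _ _ _ fun p _ => hbadle p).trans ?_
  rw [hI, Finset.card_product, Finset.card_range, nsmul_eq_mul, ← ENNReal.ofReal_natCast,
    ← ENNReal.ofReal_mul (by positivity)]
  exact (congrArg ENNReal.ofReal (by push_cast; ring)).le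

/-! ### Comparing many windows near the mode with many windows away from it -/

/-- A probability `q` can be chosen for which, among `m` windows of probability `q`, it is likely
that one has `T` observations, while among `R m` windows of probability `q (1 - Δ)` it is unlikely
that one has `T - s` observations: either `m binTail n q T = exp (T Δ² / 10)`, or already the largest
admissible `q` makes the expected number of successful windows that small. -/
theorem exists_binTail_separation {n T m : ℕ} {Δ R : ℝ} (hn : 300 * T ≤ n) (hT : 0 < T)
    (hΔ0 : 0 < Δ) (hΔ1 : Δ ≤ 1 / 4) (hm : 1 ≤ m) (hmT : m ≤ Real.exp (T / 360))
    (hbig : 1000 ≤ T * Δ ^ 2) (hR : 0 ≤ R) :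
    ∃ q : ℝ, 9 / 10 * T ≤ n * q ∧ n * q ≤ T * (1 + Δ / 10) ∧ 0 < binTail n q T ∧
      ∀ s : ℕ, s ≤ Δ * T / 10 →
        (1 - binTail n q T) / (m * binTail n q T) + R * m * binTail n (q * (1 - Δ)) (T - s)
          ≤ (3 + 2 * R) * Real.exp (-(T * Δ ^ 2 / 500)) := by
  have hT' : (0 : ℝ) < T := by exact_mod_cast hT
  have hn' : 300 * (T : ℝ) ≤ n := by exact_mod_cast hn
  have hn0 : (0 : ℝ) < n := by linarith
  have hm' : (1 : ℝ) ≤ m := by exact_mod_cast hm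
  have hm0 : (0 : ℝ) < m := by linarith
  set ξ := Real.exp (-(T * Δ ^ 2 / 500)) with hξ
  have hξ0 : 0 < ξ := Real.exp_pos _
  set κ := Real.exp (T * Δ ^ 2 / 10) with hκ
  have hκ1 : 1 ≤ κ := Real.one_le_exp (by positivity)
  have hκξ : κ * Real.exp (-(T * Δ ^ 2 / 5)) ≤ ξ := by
    rw [hκ, ← Real.exp_add, hξ]
    apply Real.exp_le_exp.2
    have : 0 ≤ T * Δ ^ 2 := by positivity
    linarith
  have htail : m * Real.exp (-(T / 6 : ℝ)) ≤ ξ := by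
    calc m * Real.exp (-(T / 6 : ℝ)) ≤ Real.exp (T / 360) * Real.exp (-(T / 6 : ℝ)) := by gcongr
      _ = Real.exp (T / 360 + -(T / 6 : ℝ)) := by rw [Real.exp_add]
      _ ≤ ξ := by
        rw [hξ]
        apply Real.exp_le_exp.2
        have : T * Δ ^ 2 ≤ T * (1 / 4) ^ 2 := by gcongr
        linarith
  have hcomp : ∀ q : ℝ, 9 / 10 * T ≤ n * q → n * q ≤ T * (1 + Δ / 10) → m * binTail n q T ≤ κ →
      ∀ s : ℕ, s ≤ Δ * T / 10 → R * m * binTail n (q * (1 - Δ)) (T - s) ≤ 2 * R * ξ := by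
    intro q h1 h2 h3 s hs
    have h4 := binTail_compare hn hT hΔ0.le hΔ1 h1 h2 hs
    calc R * m * binTail n (q * (1 - Δ)) (T - s)
        ≤ R * m * (Real.exp (-(T * Δ ^ 2 / 5)) * binTail n q T + Real.exp (-(T / 6 : ℝ))) := by gcongr
      _ = R * (m * binTail n q T * Real.exp (-(T * Δ ^ 2 / 5)) + m * Real.exp (-(T / 6 : ℝ))) := by
        ring
      _ ≤ R * (κ * Real.exp (-(T * Δ ^ 2 / 5)) + m * Real.exp (-(T / 6 : ℝ))) := by gcongr
      _ ≤ R * (ξ + ξ) := by gcongr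
      _ = _ := by ring
  set q₀ := 9 / 10 * T / (n : ℝ) with hq₀
  set q₁ := T * (1 + Δ / 10) / (n : ℝ) with hq₁
  have hnq₀ : n * q₀ = 9 / 10 * T := by rw [hq₀]; field_simp
  have hnq₁ : n * q₁ = T * (1 + Δ / 10) := by rw [hq₁]; field_simp
  have hq₀0 : 0 ≤ q₀ := by positivity
  have hq01 : q₀ ≤ q₁ := by
    rw [hq₀, hq₁]; exact div_le_div_of_nonneg_right (by nlinarith) hn0.le
  have hq₁1 : q₁ ≤ 1 := by rw [hq₁, div_le_one hn0]; nlinarith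
  have hlow : m * binTail n q₀ T ≤ κ := by
    have h1 := binTail_le_exp (m := 9 / 10 * T) (s := T / 10) (T := T) hq₀0 (hq01.trans hq₁1)
      (by positivity) hnq₀.le (by positivity) (by linarith) (by rw [hnq₀]; linarith)
    have h2 : (T / 10 : ℝ) ^ 2 / (4 * (9 / 10 * T)) = T / 360 := by field_simp; norm_num
    rw [h2] at h1
    calc m * binTail n q₀ T ≤ Real.exp (T / 360) * Real.exp (-(T / 360)) :=
          mul_le_mul hmT h1 (binTail_nonneg hq₀0 (hq01.trans hq₁1) _ _) (Real.exp_pos _).le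
      _ = 1 := by rw [← Real.exp_add]; simp
      _ ≤ κ := hκ1
  rcases le_or_gt κ (m * binTail n q₁ T) with hup | hup
  · obtain ⟨q, hq, hqe⟩ := intermediate_value_Icc hq01
      (continuous_const.mul (continuous_binTail n T)).continuousOn
      (show κ ∈ Icc (m * binTail n q₀ T) (m * binTail n q₁ T) from ⟨hlow, hup⟩)
    have hqe : m * binTail n q T = κ := hqe
    have h1 : 9 / 10 * T ≤ n * q := by rw [← hnq₀]; exact mul_le_mul_of_nonneg_left hq.1 hn0.le
    have h2 : n * q ≤ T * (1 + Δ / 10) := by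
      rw [← hnq₁]; exact mul_le_mul_of_nonneg_left hq.2 hn0.le
    have hp : 0 < binTail n q T := by
      by_contra! h
      have := mul_nonpos_of_nonneg_of_nonpos hm0.le h
      linarith
    refine ⟨q, h1, h2, hp, fun s hs => ?_⟩
    have h3 := hcomp q h1 h2 hqe.le s hs
    have h4 : (1 - binTail n q T) / (m * binTail n q T) ≤ ξ := by
      rw [hqe, div_le_iff₀ (by positivity)]
      have : 1 ≤ ξ * κ := by
        rw [hξ, hκ, ← Real.exp_add]
        apply Real.one_le_exp
        linarith
      linarith
    linarith
  · have h1 : 9 / 10 * (T : ℝ) ≤ n * q₁ := by rw [hnq₁]; nlinarith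
    have h5 : 1 - binTail n q₁ T ≤ ξ := by
      refine (one_sub_binTail_le_exp (m := n * q₁) (s := T * Δ / 10) (hq₀0.trans hq01) hq₁1
        (by rw [hnq₁]; positivity) le_rfl (by positivity) (by rw [hnq₁]; linarith [mul_pos hT' hΔ0])
        (by rw [hnq₁]; linarith)).trans ?_
      rw [hξ]
      apply Real.exp_le_exp.2
      rw [hnq₁, neg_le_neg_iff, le_div_iff₀ (by positivity)]
      calc T * Δ ^ 2 / 500 * (4 * (T * (1 + Δ / 10)))
          = T ^ 2 * Δ ^ 2 * (4 * (1 + Δ / 10) / 500) := by ring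
        _ ≤ T ^ 2 * Δ ^ 2 * (1 / 100) :=
          mul_le_mul_of_nonneg_left (by linarith) (by positivity)
        _ = (T * Δ / 10) ^ 2 := by ring
    have h6 : ξ ≤ 1 / 2 := by
      rw [hξ, Real.exp_neg, inv_le_comm₀ (Real.exp_pos _) (by norm_num)]
      have := Real.add_one_le_exp (T * Δ ^ 2 / 500)
      norm_num
      linarith
    have hp : 1 / 2 ≤ binTail n q₁ T := by linarith
    refine ⟨q₁, h1, hnq₁.le, by linarith, fun s hs => ?_⟩
    have h3 := hcomp q₁ h1 hnq₁.le hup.le s hs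
    have h4 : (1 - binTail n q₁ T) / (m * binTail n q₁ T) ≤ 2 * ξ := by
      rw [div_le_iff₀ (by positivity)]
      have : 1 / 2 ≤ m * binTail n q₁ T := hp.trans (le_mul_of_one_le_left (by linarith) hm')
      have := mul_le_mul_of_nonneg_left this (show 0 ≤ 2 * ξ by positivity)
      linarith
    linarith

section Shift

variable {n : ℕ} {f : ℝ → ℝ} {S : Set ℝ} {X : Fin n → ℝ} {F m t r c D x y : ℝ}

/-- Two balls with the same radius and nearby centres have almost the same number of observations,
if the density is almost constant around them: besides the deviations of three short intervals,
only the difference of the masses of the two parts in which the balls differ matters. -/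
theorem UnifDev.abs_cnt_sub_cnt_le (hU : UnifDev f X m t) (hd : IsDensityOn f S)
    (hF : ∀ x, f x ≤ F) (hr : 0 ≤ r) (hxy : x ≤ y) (hx : -1 ≤ x - r) (hy : y + r ≤ 2) (hD : D ≤ c)
    (hc : ∀ u ∈ Icc (x - r) (y + r), c - D ≤ f u ∧ f u ≤ c) (hmass : n * (F * (y - x)) ≤ m) :
    |(cnt (Metric.closedBall x r) X : ℝ) - cnt (Metric.closedBall y r) X|
      ≤ 3 * t + n * (D * (y - x)) := by
  have hn := Nat.cast_nonneg (α := ℝ) n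
  have hF0 : 0 ≤ F := (hd.nonneg 0).trans (hF 0)
  have hcu : 0 ≤ c := (hd.nonneg _).trans (hc (x - r) ⟨le_rfl, by linarith⟩).2
  rw [Real.closedBall_eq_Icc, Real.closedBall_eq_Icc]
  have dev : ∀ a b, -1 ≤ a → a ≤ b → b ≤ 2 → b - a ≤ y - x →
      |(cnt (Icc a b) X : ℝ) - n * (distFun f b - distFun f a)| ≤ t := fun a b h1 h2 h3 h4 => by
    refine hU a b h1 h2 h3 ((mul_le_mul_of_nonneg_left ?_ hn).trans hmass)
    exact (distFun_sub_le hd h2 hF0 fun u _ => hF u).trans (mul_le_mul_of_nonneg_left h4 hF0)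
  have l1 := abs_le.1 (dev (x - r) (y - r) hx (by linarith) (by linarith) (by linarith))
  have l2 := abs_le.1 (dev (x + r) (y + r) (by linarith) (by linarith) hy (by linarith))
  have l3 := abs_le.1 (dev (x + r) (x + r) (by linarith) le_rfl (by linarith) (by linarith))
  have l4 := abs_le.1 (dev (y - r) (y - r) (by linarith) le_rfl (by linarith) (by linarith))
  rw [sub_self, mul_zero, sub_zero] at l3 l4
  have u1 : distFun f (y - r) - distFun f (x - r) ≤ c * (y - x) := by
    have := distFun_sub_le hd (show x - r ≤ y - r by linarith) hcu
      fun u hu => (hc u ⟨hu.1, by linarith [hu.2]⟩).2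
    linarith
  have u2 : distFun f (y + r) - distFun f (x + r) ≤ c * (y - x) := by
    have := distFun_sub_le hd (show x + r ≤ y + r by linarith) hcu
      fun u hu => (hc u ⟨by linarith [hu.1], hu.2⟩).2
    linarith
  have u3 : (c - D) * (y - x) ≤ distFun f (y - r) - distFun f (x - r) := by
    have := le_distFun_sub hd (show x - r ≤ y - r by linarith) (sub_nonneg.2 hD)
      fun u hu => (hc u ⟨hu.1, by linarith [hu.2]⟩).1
    linarith
  have u4 : (c - D) * (y - x) ≤ distFun f (y + r) - distFun f (x + r) := by
    have := le_distFun_sub hd (show x + r ≤ y + r by linarith) (sub_nonneg.2 hD)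
      fun u hu => (hc u ⟨by linarith [hu.1], hu.2⟩).1
    linarith
  have v1 : n * ((distFun f (y - r) - distFun f (x - r)) - (distFun f (y + r) - distFun f (x + r)))
      ≤ n * (D * (y - x)) := mul_le_mul_of_nonneg_left (by linarith) hn
  have v2 : n * ((distFun f (y + r) - distFun f (x + r)) - (distFun f (y - r) - distFun f (x - r)))
      ≤ n * (D * (y - x)) := mul_le_mul_of_nonneg_left (by linarith) hn
  -- the part of the union outside one ball is covered by a short closed interval; the part outside
  -- the other ball is such an interval up to an end point
  have c1 : cnt (Icc (x - r) (x + r)) X + cnt (Ioc (x + r) (y + r)) X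
      ≤ cnt (Icc (x - r) (y - r)) X + cnt (Icc (y - r) (y + r)) X := by
    rw [← cnt_union_of_disjoint]
    · refine (cnt_mono (fun u hu => ?_) X).trans (cnt_union_le _ _ X)
      have : x - r ≤ u ∧ u ≤ y + r := by
        rcases hu with hu | hu
        · exact ⟨hu.1, by linarith [hu.2]⟩
        · exact ⟨by linarith [hu.1], hu.2⟩
      rcases le_total u (y - r) with h | h
      · exact Or.inl ⟨this.1, h⟩
      · exact Or.inr ⟨h, this.2⟩
    · exact Set.disjoint_left.2 fun u hu hu' => absurd hu'.1 (not_lt.2 hu.2)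
  have c2 : cnt (Icc (y - r) (y + r)) X + cnt (Ico (x - r) (y - r)) X
      ≤ cnt (Icc (x - r) (x + r)) X + cnt (Icc (x + r) (y + r)) X := by
    rw [← cnt_union_of_disjoint]
    · refine (cnt_mono (fun u hu => ?_) X).trans (cnt_union_le _ _ X)
      have : x - r ≤ u ∧ u ≤ y + r := by
        rcases hu with hu | hu
        · exact ⟨by linarith [hu.1], hu.2⟩
        · exact ⟨hu.1, by linarith [hu.2]⟩
      rcases le_total u (x + r) with h | h
      · exact Or.inl ⟨this.1, h⟩
      · exact Or.inr ⟨h, this.2⟩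
    · exact Set.disjoint_left.2 fun u hu hu' => absurd hu.1 (not_le.2 hu'.2)
  have c3 : cnt (Icc (x + r) (y + r)) X ≤ cnt (Icc (x + r) (x + r)) X + cnt (Ioc (x + r) (y + r)) X := by
    refine (cnt_mono (fun u hu => ?_) X).trans (cnt_union_le _ _ X)
    rcases hu.1.eq_or_lt with h | h
    · exact Or.inl ⟨hu.1, h.symm.le⟩
    · exact Or.inr ⟨h, hu.2⟩
  have c4 : cnt (Icc (x - r) (y - r)) X ≤ cnt (Icc (y - r) (y - r)) X + cnt (Ico (x - r) (y - r)) X := by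
    refine (cnt_mono (fun u hu => ?_) X).trans (cnt_union_le _ _ X)
    rcases hu.2.eq_or_lt with h | h
    · exact Or.inl ⟨h.symm.le, hu.2⟩
    · exact Or.inr ⟨hu.1, h⟩
  have c1' : (cnt (Icc (x - r) (x + r)) X : ℝ) + cnt (Ioc (x + r) (y + r)) X
      ≤ cnt (Icc (x - r) (y - r)) X + cnt (Icc (y - r) (y + r)) X := by exact_mod_cast c1
  have c2' : (cnt (Icc (y - r) (y + r)) X : ℝ) + cnt (Ico (x - r) (y - r)) X
      ≤ cnt (Icc (x - r) (x + r)) X + cnt (Icc (x + r) (y + r)) X := by exact_mod_cast c2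
  have c3' : (cnt (Icc (x + r) (y + r)) X : ℝ)
      ≤ cnt (Icc (x + r) (x + r)) X + cnt (Ioc (x + r) (y + r)) X := by exact_mod_cast c3
  have c4' : (cnt (Icc (x - r) (y - r)) X : ℝ)
      ≤ cnt (Icc (y - r) (y - r)) X + cnt (Ico (x - r) (y - r)) X := by exact_mod_cast c4
  rw [abs_le]
  constructor
  · linarith [l1.1, l1.2, l2.1, l2.2, l3.2, l4.2]
  · linarith [l1.1, l1.2, l2.1, l2.2, l3.2, l4.2]

end Shift

section Sharp

variable {n k : ℕ} {f : ℝ → ℝ} {X : Fin n → ℝ} {lam₀ rM Cl Cu F g w η b ρ : ℝ} {Cα α : ℝ≥0}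

/-- Outside the error bound, the density in small balls is smaller than at the mode by almost
`f xp * w ^ 2`. -/
theorem Regime.shell_le (hR : Regime lam₀ rM Cl Cu F g Cα α n k w η b ρ)
    (hM : ModalConstants f lam₀ rM Cl Cu) (hF : ∀ x, f x ≤ F) {xp x y : ℝ}
    (hxp : xp ∈ modes f) (hx1 : b * w ≤ |x - xp|) (hx2 : |x - xp| ≤ 13 * (b * w))
    (hy : |y - x| ≤ ρ) : f y ≤ f xp * (1 - 98 / 100 * w ^ 2) := by
  have hbw := mul_pos hR.b_pos hR.w_pos
  have hρb := hR.ρ_le_width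
  have h1 : |y - xp| ≤ rM := by
    have := abs_sub_le y x xp
    linarith [hR.width_le]
  have h2 : 99 / 100 * (b * w) ≤ |y - xp| := by
    have := abs_sub_le x y xp
    rw [abs_sub_comm x y] at this; linarith
  have h3 : (99 / 100 * (b * w)) ^ 2 ≤ (y - xp) ^ 2 := by
    rw [← sq_abs (y - xp)]; exact pow_le_pow_left₀ (by positivity) h2 2
  have h4 := (hM.near hxp h1).2.1
  have h5 := mul_le_mul_of_nonneg_left h3 hM.Cl_pos.le
  have h6 : Cl * (99 / 100 * (b * w)) ^ 2 = (99 / 100) ^ 2 * (F * w ^ 2) := by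
    rw [← hR.b_sq]; ring
  have h7 : f xp * w ^ 2 ≤ F * w ^ 2 := mul_le_mul_of_nonneg_right (hF xp) (sq_nonneg w)
  have h8 : 0 ≤ f xp * w ^ 2 :=
    mul_nonneg (hM.lam₀_pos.le.trans (hM.lam₀_lt hxp).le) (sq_nonneg w)
  linarith

/-- In balls inside a fraction `c` of the core, the density is almost that at the mode. -/
theorem Regime.le_core (hR : Regime lam₀ rM Cl Cu F g Cα α n k w η b ρ)
    (hM : ModalConstants f lam₀ rM Cl Cu) {xp y c : ℝ} (hc1 : c ≤ 21 / 20)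
    (hxp : xp ∈ modes f) (hy : |y - xp| ≤ c * (η * w)) :
    f xp * (1 - c ^ 2 / 2 * w ^ 2) ≤ f y := by
  have hηw := mul_pos hR.η_pos hR.w_pos
  have hbw := mul_pos hR.b_pos hR.w_pos
  have h1 : |y - xp| ≤ rM := by
    have h1 := mul_le_mul_of_nonneg_right hR.η_le hR.w_pos.le
    have h2 := mul_le_mul_of_nonneg_right hc1 hηw.le
    linarith [hR.width_le]
  have h4 := (hM.near hxp h1).2.2
  have h3 : (y - xp) ^ 2 ≤ (c * (η * w)) ^ 2 := by
    rw [← sq_abs]; exact pow_le_pow_left₀ (abs_nonneg _) hy 2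
  have h5 := mul_le_mul_of_nonneg_left h3 hM.Cu_pos.le
  have h6 := mul_le_mul_of_nonneg_right hR.core (show 0 ≤ c ^ 2 / 2 * w ^ 2 by positivity)
  have h7 : lam₀ * (c ^ 2 / 2 * w ^ 2) ≤ f xp * (c ^ 2 / 2 * w ^ 2) :=
    mul_le_mul_of_nonneg_right (hM.lam₀_lt hxp).le (by positivity)
  nlinarith

/-- If the counts have relative error at most `w ^ 2 / 10`, the sample is sharp at the mode. -/
theorem RegularSample.sharpAt_of_unifDev (hS : RegularSample f F X k (8 * w ^ 2))
    (hM : ModalConstants f lam₀ rM Cl Cu)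
    (hR : Regime lam₀ rM Cl Cu F g Cα α n k w η b ρ) {xp : ℝ} (hxp : xp ∈ modes f)
    (hU : UnifDev f X (2 * k) (w ^ 2 / 10 * k)) : SharpAt X k xp (η * w) (b * w) := by
  have hn := hS.n_pos
  have hk := hS.k_pos
  have hw := hR.w_pos
  have hw2 := hR.w_le
  have hw20 : 0 < w ^ 2 := by positivity
  have hρ := hR.ρ_pos hS hM
  have hlam := hM.lam₀_pos
  have hf0 := hM.lam₀_lt hxp
  have hρc := hR.ρ_le_core
  set v := f xp with hv
  have hv0 : 0 < v := hlam.trans hf0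
  -- the expected count of a ball with constant density `v` would be `k (1 + 3 / 4 * w ^ 2)`
  set r := k * (1 + 3 / 4 * w ^ 2) / (2 * n * v) with hr
  have hr0 : 0 < r := by positivity
  have hrρ : r ≤ ρ := by
    rw [hr, div_le_iff₀ (by positivity), ← hR.ρ_eq]
    have h1 : lam₀ * (1 + 3 / 4 * w ^ 2) ≤ 2 * v := by nlinarith
    calc ρ * (n * lam₀) * (1 + 3 / 4 * w ^ 2) = ρ * n * (lam₀ * (1 + 3 / 4 * w ^ 2)) := by ring
      _ ≤ ρ * n * (2 * v) := by gcongr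
      _ = _ := by ring
  have hmass : ∀ a, n * (v * a * (2 * r)) = k * ((1 + 3 / 4 * w ^ 2) * a) := fun a => by
    rw [hr]; field_simp
  obtain ⟨j, hj⟩ := hS.exists_core hM hR hxp
  refine ⟨r, j, hj, ?_, fun i hi1 hi2 => ?_⟩
  · have h1 := le_distFun_sub hS.density (a := X j - r) (b := X j + r) (by linarith)
      (c := v * (1 - (21 / 20) ^ 2 / 2 * w ^ 2)) (mul_nonneg hv0.le (by linarith)) fun y hy =>
        hR.le_core hM le_rfl hxp (by
          have h2 : |y - X j| ≤ ρ := abs_le.2 ⟨by linarith [hy.1], by linarith [hy.2]⟩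
          have := abs_sub_le y (X j) xp
          linarith)
    have h2 := mul_le_mul_of_nonneg_left h1 hn.le
    rw [show X j + r - (X j - r) = 2 * r by ring, hmass] at h2
    have h3 := hU.le_cnt (s := k) hS.density hS.le_sup (a := X j - r) (b := X j + r)
      (by linarith [(hS.mem j).1, hR.ρ_le_half]) (by linarith)
      (by linarith [(hS.mem j).2, hR.ρ_le_half]) (by positivity) (by nlinarith) (by
        refine le_trans ?_ h2
        have h4 : 1 + w ^ 2 / 10 ≤
            (1 + 3 / 4 * w ^ 2) * (1 - (21 / 20) ^ 2 / 2 * w ^ 2) := by nlinarith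
        have := mul_le_mul_of_nonneg_left h4 hk.le
        linarith)
    rw [Real.closedBall_eq_Icc]
    exact_mod_cast h3
  · by_contra! hle
    have h1 := distFun_sub_le hS.density (a := X i - r) (b := X i + r) (by linarith)
      (c := v * (1 - 98 / 100 * w ^ 2)) (mul_nonneg hv0.le (by linarith)) fun y hy =>
        hR.shell_le hM hS.le_sup hxp hi1 hi2
          (abs_le.2 ⟨by linarith [hy.1], by linarith [hy.2]⟩)
    have h2 := mul_le_mul_of_nonneg_left h1 hn.le
    rw [show X i + r - (X i - r) = 2 * r by ring, hmass] at h2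
    rw [Real.closedBall_eq_Icc] at hle
    have h3 := hU.sub_le (s := k) (a := X i - r) (b := X i + r)
      (by linarith [(hS.mem i).1, hR.ρ_le_half]) (by linarith)
      (by linarith [(hS.mem i).2, hR.ρ_le_half]) (by positivity) (by linarith)
      (by exact_mod_cast hle)
    have h4 : (1 + 3 / 4 * w ^ 2) * (1 - 98 / 100 * w ^ 2) < 1 - w ^ 2 / 10 := by nlinarith
    have := mul_lt_mul_of_pos_left h4 hk
    linarith

/-- If some ball centred in the core has `k + s` observations, and the balls with the same radius
centred at a grid of points in the shell have less than `k - s`, then the sample is sharp at the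
mode, provided that the counts of short intervals are so regular that moving the centre of a ball
by the mesh `d` of the grid changes its count by at most `s`. -/
theorem RegularSample.sharpAt_of_windows (hS : RegularSample f F X k (8 * w ^ 2))
    (hM : ModalConstants f lam₀ rM Cl Cu)
    (hR : Regime lam₀ rM Cl Cu F g Cα α n k w η b ρ) {xp : ℝ} (hxp : xp ∈ modes f)
    {m t d r c : ℝ} {s N : ℕ} (hU : UnifDev f X m t) (ht : 0 ≤ t) (htm : t < m) (hd0 : 0 < d)
    (hdρ : d ≤ ρ) (hmd : n * (F * d) ≤ m) (htd : t < n * (lam₀ * d))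
    (hD : 225 * Cu * b ^ 2 * w ^ 2 ≤ lam₀)
    (hs : 3 * t + n * (225 * Cu * b ^ 2 * w ^ 2 * d) ≤ s) (hr0 : 0 ≤ r) (hrρ : r ≤ ρ)
    (hc : |c - xp| ≤ η * w / 2) (hin : k + s ≤ cnt (Metric.closedBall c r) X)
    (hN : 12 * (b * w) < N * d)
    (hout : ∀ j : Fin N, cnt (Metric.closedBall (xp + (b * w + j * d)) r) X < k - s ∧
      cnt (Metric.closedBall (xp - (b * w + j * d)) r) X < k - s) :
    SharpAt X k xp (η * w) (b * w) := by
  have hn := hS.n_pos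
  have hbw := mul_pos hR.b_pos hR.w_pos
  have hηw := mul_pos hR.η_pos hR.w_pos
  have hηb : η * w ≤ b * w := mul_le_mul_of_nonneg_right hR.η_le hR.w_pos.le
  have hρb := hR.ρ_le_width
  have hρc := hR.ρ_le_core
  have hbM := hR.width_le
  have hhalf := hR.ρ_le_half
  have hin01 : ∀ x, |x - xp| ≤ 14 * (b * w) → lam₀ < f x ∧ x ∈ Icc (0 : ℝ) 1 := fun x hx =>
    hM.lt_and_mem hS.density hxp (by linarith)
  have hF := hS.nonneg_sup
  -- moving the centre
  have hmove : ∀ x y, x ≤ y → y ≤ x + d → |x - xp| ≤ 14 * (b * w) → |y - xp| ≤ 14 * (b * w) →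
      |(cnt (Metric.closedBall x r) X : ℝ) - cnt (Metric.closedBall y r) X| ≤ s := by
    intro x y hxy hyx hx hy
    refine (hU.abs_cnt_sub_cnt_le hS.density hS.le_sup hr0 hxy (by linarith [(hin01 x hx).2.1])
      (by linarith [(hin01 y hy).2.2]) (c := f xp) (D := 225 * Cu * b ^ 2 * w ^ 2)
      (hD.trans (hM.lam₀_lt hxp).le) (fun u hu => ?_) ?_).trans ?_
    · have h1 : |u - xp| ≤ 15 * (b * w) := by
        rw [abs_le] at hx hy ⊢
        constructor <;> linarith [hu.1, hu.2, hx.1, hy.2]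
      have h2 := (hM.near hxp (h1.trans (by linarith))).2
      have h3 : (u - xp) ^ 2 ≤ (15 * (b * w)) ^ 2 := by
        rw [← sq_abs]; exact pow_le_pow_left₀ (abs_nonneg _) h1 2
      have h4 := mul_le_mul_of_nonneg_left h3 hM.Cu_pos.le
      have h5 := mul_nonneg hM.Cl_pos.le (sq_nonneg (u - xp))
      constructor
      · linarith [h2.2]
      · linarith [h2.1]
    · refine le_trans ?_ hmd
      gcongr
      linarith
    · refine le_trans ?_ hs
      have : n * (225 * Cu * b ^ 2 * w ^ 2 * (y - x)) ≤ n * (225 * Cu * b ^ 2 * w ^ 2 * d) := by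
        have := hM.Cu_pos
        gcongr
        linarith
      linarith
  have hc' := abs_le.1 hc
  have hcd : |c + d - xp| ≤ 14 * (b * w) := abs_le.2 ⟨by linarith, by linarith⟩
  have hc14 : |c - xp| ≤ 14 * (b * w) := abs_le.2 ⟨by linarith, by linarith⟩
  obtain ⟨j, hj⟩ := hU.exists_mem hS.density hS.le_sup (by linarith [(hin01 c hc14).2.1])
    (show c ≤ c + d by linarith) (by linarith [(hin01 _ hcd).2.2]) ht htm (by
      refine htd.trans_le (mul_le_mul_of_nonneg_left ?_ hn.le)
      have := le_distFun_sub hS.density (show c ≤ c + d by linarith) hM.lam₀_pos.le fun x hx =>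
        (hin01 x (abs_le.2 ⟨by linarith [hx.1], by linarith [hx.2]⟩)).1.le
      linarith)
  refine ⟨r, j, abs_le.2 ⟨by linarith [hj.1], by linarith [hj.2]⟩, ?_, fun i hi1 hi2 => ?_⟩
  · have h1 := abs_le.1 (hmove c (X j) hj.1 hj.2 hc14
      (abs_le.2 ⟨by linarith [hj.1], by linarith [hj.2]⟩))
    have h2 : (k + s : ℝ) ≤ cnt (Metric.closedBall c r) X := by exact_mod_cast hin
    have h3 : (k : ℝ) ≤ cnt (Metric.closedBall (X j) r) X := by linarith [h1.2]
    exact_mod_cast h3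
  · by_contra! hle
    set l := ⌊(|X i - xp| - b * w) / d⌋₊ with hl
    have hl1 : l * d ≤ |X i - xp| - b * w := by
      rw [← le_div_iff₀ hd0]
      exact Nat.floor_le (div_nonneg (by linarith) hd0.le)
    have hl2 : |X i - xp| - b * w ≤ (l + 1) * d := by
      rw [← div_le_iff₀ hd0]
      exact (Nat.lt_floor_add_one _).le
    have hlN : l < N := by
      by_contra! h
      have : (N : ℝ) * d ≤ l * d := by gcongr
      linarith
    have hld : 0 ≤ l * d := by positivity
    obtain ⟨ho1, ho2⟩ := hout ⟨l, hlN⟩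
    have hk' : (k : ℝ) ≤ cnt (Metric.closedBall (X i) r) X := by exact_mod_cast hle
    rcases le_total xp (X i) with hside | hside
    · rw [abs_of_nonneg (by linarith)] at hl1 hl2 hi1 hi2
      have h1 := abs_le.1 (hmove (xp + (b * w + l * d)) (X i) (by linarith) (by linarith)
        (abs_le.2 ⟨by linarith, by linarith⟩) (abs_le.2 ⟨by linarith, by linarith⟩))
      have h2 : (k : ℝ) ≤ cnt (Metric.closedBall (xp + (b * w + l * d)) r) X + s := by
        linarith [h1.1]
      have h3 : k ≤ cnt (Metric.closedBall (xp + (b * w + l * d)) r) X + s := by exact_mod_cast h2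
      exact absurd ho1 (by simp only; omega)
    · rw [abs_of_nonpos (by linarith)] at hl1 hl2 hi1 hi2
      have h1 := abs_le.1 (hmove (X i) (xp - (b * w + l * d)) (by linarith) (by linarith)
        (abs_le.2 ⟨by linarith, by linarith⟩) (abs_le.2 ⟨by linarith, by linarith⟩))
      have h2 : (k : ℝ) ≤ cnt (Metric.closedBall (xp - (b * w + l * d)) r) X + s := by
        linarith [h1.2]
      have h3 : k ≤ cnt (Metric.closedBall (xp - (b * w + l * d)) r) X + s := by exact_mod_cast h2
      exact absurd ho2 (by simp only; omega)

end Sharp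

/-- The probability that no window `A l` has `T` observations or some window `B j` has `T'`: the
second moment method for the former, the union bound for the latter. -/
theorem pi_not_windows_le {E ι κ : Type*} [MeasurableSpace E] (μ : Measure E)
    [IsProbabilityMeasure μ] [Fintype ι] [Nonempty ι] [Fintype κ] {A : ι → Set E} {B : κ → Set E}
    (hA : ∀ l, MeasurableSet (A l)) (hB : ∀ j, MeasurableSet (B j))
    (hdis : ∀ l l', l ≠ l' → Disjoint (A l) (A l')) {q q' : ℝ} {n T T' : ℕ} (hq : 0 ≤ q)
    (hqA : ∀ l, q ≤ μ.real (A l)) (hqB : ∀ j, μ.real (B j) ≤ q') (hq' : q' ≤ 1)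
    (hp : 0 < binTail n q T) :
    Measure.pi (fun _ : Fin n => μ)
        {X | ¬ ((∃ l, T ≤ cnt (A l) X) ∧ ∀ j, cnt (B j) X < T')}
      ≤ ENNReal.ofReal ((1 - binTail n q T) / (Fintype.card ι * binTail n q T)
          + Fintype.card κ * binTail n q' T') := by
  set P := Measure.pi (fun _ : Fin n => μ) with hP
  have hreal : ∀ C : Set E, MeasurableSet C → ∀ U, P.real {X | U ≤ cnt C X} = binTail n (μ.real C) U :=
    fun C hC U => by
      rw [measureReal_def, hP, pi_le_cnt μ hC, ENNReal.toReal_ofReal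
        (binTail_nonneg measureReal_nonneg measureReal_le_one _ _)]
  have h1 := measure_iInter_compl_le P (fun l => {X : Fin n → E | T ≤ cnt (A l) X})
    (fun l => measurableSet_le_cnt (hA l) T) hp
    (fun l => by
      rw [hreal _ (hA l)]
      exact binTail_mono hq (hqA l) measureReal_le_one n T)
    (fun l l' hne => by
      rw [hreal _ (hA l), hreal _ (hA l')]
      have := pi_le_cnt_inter_le μ (hA l) (hA l') (hdis l l' hne) n T T
      refine ENNReal.toReal_le_of_le_ofReal ?_ this
      exact mul_nonneg (binTail_nonneg measureReal_nonneg measureReal_le_one _ _)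
        (binTail_nonneg measureReal_nonneg measureReal_le_one _ _))
  have h2 : ∀ j, P {X | T' ≤ cnt (B j) X} ≤ ENNReal.ofReal (binTail n q' T') := fun j => by
    rw [hP, pi_le_cnt μ (hB j)]
    exact ENNReal.ofReal_le_ofReal (binTail_mono measureReal_nonneg (hqB j) hq' n T')
  have h1' : P (⋂ l, {X : Fin n → E | T ≤ cnt (A l) X}ᶜ) ≤
      ENNReal.ofReal ((1 - binTail n q T) / (Fintype.card ι * binTail n q T)) := by
    rw [← ofReal_measureReal]
    exact ENNReal.ofReal_le_ofReal h1
  have hq0 : binTail n q T ≤ 1 := by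
    have l : ι := Classical.arbitrary ι
    exact binTail_le_one hq ((hqA l).trans measureReal_le_one) n T
  calc _ ≤ P ((⋂ l, {X : Fin n → E | T ≤ cnt (A l) X}ᶜ) ∪ ⋃ j, {X | T' ≤ cnt (B j) X}) := by
        refine measure_mono fun X hX => ?_
        have hX : ¬ ((∃ l, T ≤ cnt (A l) X) ∧ ∀ j, cnt (B j) X < T') := hX
        by_cases h : ∃ l, T ≤ cnt (A l) X
        · right
          have : ¬ ∀ j, cnt (B j) X < T' := fun h' => hX ⟨h, h'⟩
          push Not at this
          obtain ⟨j, hj⟩ := this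
          exact mem_iUnion.2 ⟨j, hj⟩
        · left
          exact mem_iInter.2 fun l hl => h ⟨l, hl⟩
    _ ≤ ENNReal.ofReal ((1 - binTail n q T) / (Fintype.card ι * binTail n q T))
          + ∑ _j : κ, ENNReal.ofReal (binTail n q' T') :=
        (measure_union_le _ _).trans (add_le_add h1' ((measure_iUnion_fintype_le _ _).trans
          (Finset.sum_le_sum fun j _ => h2 j)))
    _ ≤ _ := by
        rw [Finset.sum_const, Finset.card_univ, nsmul_eq_mul, ← ENNReal.ofReal_natCast,
          ← ENNReal.ofReal_mul (by positivity)]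
        refine (ENNReal.ofReal_add ?_ ?_).ge
        · exact div_nonneg (by linarith) (by positivity)
        · rcases isEmpty_or_nonempty κ with h | ⟨⟨j⟩⟩
          · simp
          · exact mul_nonneg (by positivity)
              (binTail_nonneg (measureReal_nonneg.trans (hqB j)) hq' _ _)

set_option maxHeartbeats 1000000 in
/-- The probability that a regular sample is not sharp at the mode is small: the core contains so
many disjoint windows that one of them has exceptionally many observations, more than any window
away from the mode. -/
theorem sampleLaw_not_sharpAt_le {n k : ℕ} {f : ℝ → ℝ} {lam₀ rM Cl Cu F g w η b ρ ε xp : ℝ}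
    {Cα α : ℝ≥0} (hd : IsDensityOn f (Icc 0 1)) (hF : ∀ x, f x ≤ F)
    (hM : ModalConstants f lam₀ rM Cl Cu)
    (hR : Regime lam₀ rM Cl Cu F g Cα α n k w η b ρ) (hxp : xp ∈ modes f) (hk : 1 ≤ k)
    (hkn : 330 * k ≤ n) (hε : 0 < ε) (hε1 : ε ≤ 1) (hεC : 11250 * ε * Cu ≤ Cl)
    (hwε : F * w ^ 2 < 300 * (ε * lam₀)) (hD : 225 * Cu * b ^ 2 * w ^ 2 ≤ lam₀)
    (hwk : 100 ≤ w ^ 2 * k) (hwk4 : 1600 ≤ w ^ 4 * k)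
    (hexp : η * w / (3 * ρ) ≤ Real.exp (k / 360)) :
    sampleLaw f n {X | (RegularSample f F X k (8 * w ^ 2) ∧ UnifDev f X (ε * k) (w ^ 2 * k / 300)) ∧
        ¬ SharpAt X k xp (η * w) (b * w)}
      ≤ ENNReal.ofReal ((3 + 2 * (156 * b * F / (ε * lam₀ * η))) * Real.exp (-(w ^ 4 * k / 1000))) := by
  have := hd.isProbabilityMeasure
  have hk0 : (0 : ℝ) < k := by exact_mod_cast hk
  have hkn' : 330 * (k : ℝ) ≤ n := by exact_mod_cast hkn
  have hn0 : (0 : ℝ) < n := by linarith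
  have hw := hR.w_pos
  have hw2 := hR.w_le
  have hw20 : 0 < w ^ 2 := by positivity
  have hη := hR.η_pos
  have hb := hR.b_pos
  have hlam := hM.lam₀_pos
  have hf0 := hM.lam₀_lt hxp
  have hfF := hF xp
  have hF0 : 0 < F := by linarith
  have hρ : 0 < ρ := by
    by_contra! h
    have : ρ * (n * lam₀) ≤ 0 := mul_nonpos_of_nonpos_of_nonneg h (by positivity)
    linarith [hR.ρ_eq]
  have hρc := hR.ρ_le_core
  have hρb := hR.ρ_le_width
  have hρ2 := hR.ρ_le_half
  have hbw := mul_pos hb hw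
  have hηw := mul_pos hη hw
  set v := f xp with hv
  have hv0 : 0 < v := hlam.trans hf0
  -- the slack for moving a ball to a nearby observation or to a nearby grid point
  set s₁ := ⌈3 / 100 * (w ^ 2 * k)⌉₊ with hs₁
  have hs1 : 3 / 100 * (w ^ 2 * k) ≤ s₁ := Nat.le_ceil _
  have hs2 : (s₁ : ℝ) ≤ 4 / 100 * (w ^ 2 * k) := by
    have := (Nat.ceil_lt_add_one (show 0 ≤ 3 / 100 * (w ^ 2 * k) by positivity)).le
    linarith
  have hwkk : w ^ 2 * k ≤ k / 1000 := by
    have := mul_le_mul_of_nonneg_right hw2 hk0.le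
    linarith
  set T := k + s₁ with hT
  have hTr : (T : ℝ) = k + s₁ := by rw [hT]; push_cast; ring
  have hTk : (k : ℝ) ≤ T := by rw [hTr]; linarith [Nat.cast_nonneg (α := ℝ) s₁]
  have hTk' : (T : ℝ) ≤ 11 / 10 * k := by rw [hTr]; linarith
  -- the windows in the core and the grid in the shell
  set m := ⌊η * w / (3 * ρ)⌋₊ with hm
  have hm1 : (m : ℝ) * (3 * ρ) ≤ η * w := by
    rw [← le_div_iff₀ (by positivity)]; exact Nat.floor_le (by positivity)
  have hm2 : η * w / (6 * ρ) ≤ m := by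
    have h1 := (Nat.lt_floor_add_one (η * w / (3 * ρ))).le
    have h2 : 20 / 3 ≤ η * w / (3 * ρ) := by rw [le_div_iff₀ (by positivity)]; linarith
    have h3 : η * w / (6 * ρ) = η * w / (3 * ρ) / 2 := by field_simp; norm_num
    rw [h3]; linarith
  have hmpos : 1 ≤ m := by
    have h3 : (0 : ℝ) < m := lt_of_lt_of_le (by positivity) hm2
    have : 0 < m := by exact_mod_cast h3
    omega
  set d := ε * ρ * lam₀ / F with hdd
  have hd0 : 0 < d := by positivity
  have hdρ : d ≤ ρ := by
    rw [hdd, div_le_iff₀ hF0, mul_comm ε ρ, mul_assoc]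
    exact mul_le_mul_of_nonneg_left ((mul_le_of_le_one_left hlam.le hε1).trans (by linarith)) hρ.le
  have hnd : n * d = ε * k / F := by
    rw [hdd, ← hR.ρ_eq]; ring
  set N := ⌊12 * (b * w) / d⌋₊ + 1 with hN
  have hN1 : 12 * (b * w) < N * d := by
    rw [← div_lt_iff₀ hd0, hN]; push_cast
    exact Nat.lt_floor_add_one _
  have hN2 : (N : ℝ) ≤ 13 * (b * w) / d := by
    have h1 := Nat.floor_le (show 0 ≤ 12 * (b * w) / d by positivity)
    have h2 : 1 ≤ b * w / d := by rw [le_div_iff₀ hd0]; linarith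
    have h3 : 13 * (b * w) / d = 12 * (b * w) / d + b * w / d := by ring
    rw [h3, hN]; push_cast; linarith
  set R := 156 * b * F / (ε * lam₀ * η) with hRdef
  have hR0 : 0 ≤ R := by positivity
  have hNm : (N + N : ℝ) ≤ R * m := by
    calc (N + N : ℝ) ≤ 13 * (b * w) / d + 13 * (b * w) / d := add_le_add hN2 hN2
      _ = R * (η * w / (6 * ρ)) := by rw [hRdef, hdd]; field_simp; ring
      _ ≤ R * m := by gcongr
  -- relative to `f xp`, the density is at least `1 - 16 / 100 * w ^ 2` around the windows in the core
  -- and at most `1 - 98 / 100 * w ^ 2` around those in the shell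
  set Δ := 8 / 10 * w ^ 2 with hΔ
  have hTΔ : 64 / 100 * (w ^ 4 * k) ≤ T * Δ ^ 2 := by
    have h1 : T * Δ ^ 2 = 64 / 100 * (w ^ 4 * T) := by rw [hΔ]; ring
    rw [h1]
    have : w ^ 4 * k ≤ w ^ 4 * T := by gcongr
    linarith
  obtain ⟨q, hq1, hq2, hp, hq⟩ := exists_binTail_separation (n := n) (T := T) (m := m) (Δ := Δ)
    (R := R) (by
      have : (300 * T : ℝ) ≤ n := by linarith
      exact_mod_cast this) (by omega) (by positivity) (by rw [hΔ]; linarith) hmpos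
    ((Nat.floor_le (by positivity)).trans (hexp.trans (Real.exp_le_exp.2 (by linarith))))
    (by linarith) hR0
  have hq := hq (2 * s₁) (by
    rw [hΔ]; push_cast
    have : w ^ 2 * k ≤ w ^ 2 * T := by gcongr
    linarith)
  have hT2 : T - 2 * s₁ = k - s₁ := by omega
  rw [hT2] at hq
  have hq0 : 0 < q := by
    by_contra! h
    have := mul_nonpos_of_nonneg_of_nonpos hn0.le h
    linarith
  have hnq : n * q ≤ 12 / 10 * k := by
    have h1 : T * (1 + Δ / 10) ≤ 11 / 10 * k * (1 + 1 / 100) := by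
      have : Δ / 10 ≤ 1 / 100 := by rw [hΔ]; linarith
      gcongr
    linarith
  set a := 1 - 16 / 100 * w ^ 2 with ha
  have ha0 : 99 / 100 ≤ a := by rw [ha]; linarith
  -- with this radius the windows in the core have mass at least `q`
  set r := q / (2 * (v * a)) with hr
  have hr0 : 0 < r := by positivity
  have hrq : v * a * (2 * r) = q := by rw [hr]; field_simp
  have hrρ : r ≤ ρ := by
    have h1 : n * q ≤ n * (2 * (v * a) * ρ) := by
      calc n * q ≤ 12 / 10 * (ρ * (n * lam₀)) := by rw [hR.ρ_eq]; exact hnq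
        _ = n * ρ * (12 / 10 * lam₀) := by ring
        _ ≤ n * ρ * (2 * (v * a)) := by
          refine mul_le_mul_of_nonneg_left ?_ (by positivity)
          have : lam₀ * (99 / 100) ≤ v * a := mul_le_mul hf0.le ha0 (by norm_num) hv0.le
          linarith
        _ = _ := by ring
    rw [hr, div_le_iff₀ (by positivity), mul_comm ρ]
    exact le_of_mul_le_mul_left h1 hn0
  have hqΔ : q * (1 - Δ) ≤ 1 := by
    have h1 : q ≤ 1 := by
      by_contra! h
      have : n * 1 < n * q := mul_lt_mul_of_pos_left h hn0
      linarith
    have : q * (1 - Δ) ≤ q * 1 := mul_le_mul_of_nonneg_left (by rw [hΔ]; linarith) hq0.le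
    linarith
  set A : Fin m → Set ℝ := fun l => Metric.closedBall (xp - η * w / 2 + l * (3 * ρ)) r with hA
  set B : Fin N ⊕ Fin N → Set ℝ := Sum.elim
    (fun j => Metric.closedBall (xp + (b * w + j * d)) r)
    (fun j => Metric.closedBall (xp - (b * w + j * d)) r) with hB
  have hcen : ∀ l : Fin m, |xp - η * w / 2 + l * (3 * ρ) - xp| ≤ η * w / 2 := fun l => by
    have h1 : (l : ℝ) * (3 * ρ) ≤ m * (3 * ρ) := by
      have : (l : ℝ) ≤ m := by exact_mod_cast l.2.le
      gcongr
    have h2 : 0 ≤ (l : ℝ) * (3 * ρ) := by positivity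
    rw [abs_le]; constructor <;> linarith
  have hmassA : ∀ l, q ≤ (law f).real (A l) := fun l => by
    have h1 := le_law_real hd (A := A l) (a := v * a) measurableSet_closedBall
      (by rw [hA]; simp only; rw [Real.volume_closedBall]; exact ENNReal.ofReal_ne_top) (by positivity)
      fun y hy => by
        have hy : |y - (xp - η * w / 2 + l * (3 * ρ))| ≤ r := hy
        refine le_trans ?_ (hR.le_core hM (c := 11 / 20) (by norm_num) hxp ?_)
        · rw [ha]
          refine mul_le_mul_of_nonneg_left ?_ hv0.le
          linarith
        · have := abs_sub_le y (xp - η * w / 2 + l * (3 * ρ)) xp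
          linarith [hcen l]
    have h2 : volume.real (A l) = 2 * r := by
      rw [hA]; simp only
      rw [measureReal_def, Real.volume_closedBall, ENNReal.toReal_ofReal (by positivity)]
    rwa [h2, hrq] at h1
  have hmassB : ∀ x, b * w ≤ |x - xp| → |x - xp| ≤ 13 * (b * w) →
      (law f).real (Metric.closedBall x r) ≤ q * (1 - Δ) := fun x hx1 hx2 => by
    have h1 := law_real_le (f := f) (A := Metric.closedBall x r) (a := v * (1 - 98 / 100 * w ^ 2))
      measurableSet_closedBall (by rw [Real.volume_closedBall]; exact ENNReal.ofReal_ne_top)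
      (mul_nonneg hv0.le (by linarith)) fun y hy => by
        have hy : |y - x| ≤ r := hy
        exact hR.shell_le hM hF hxp hx1 hx2 (hy.trans hrρ)
    rw [measureReal_def volume, Real.volume_closedBall, ENNReal.toReal_ofReal (by positivity)] at h1
    refine h1.trans ?_
    rw [← hrq]
    have h2 : 1 - 98 / 100 * w ^ 2 ≤ a * (1 - Δ) := by
      rw [ha, hΔ]; linarith [mul_pos hw20 hw20]
    have := mul_le_mul_of_nonneg_left h2 (show 0 ≤ v * (2 * r) by positivity)
    linarith
  have hNd : (N : ℝ) * d ≤ 12 * (b * w) + d := by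
    have h1 := Nat.floor_le (show 0 ≤ 12 * (b * w) / d by positivity)
    rw [le_div_iff₀ hd0] at h1
    rw [hN]; push_cast; linarith
  have hmassB' : ∀ j, (law f).real (B j) ≤ q * (1 - Δ) := fun j => by
    have hj : ∀ j : Fin N, 0 ≤ (j : ℝ) * d ∧ (j : ℝ) * d ≤ 12 * (b * w) := fun j => by
      refine ⟨by positivity, ?_⟩
      have h1 : (j : ℝ) + 1 ≤ N := by exact_mod_cast j.2
      have := mul_le_mul_of_nonneg_right h1 hd0.le
      linarith
    rcases j with j | j
    · refine hmassB _ ?_ ?_ <;>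
      · rw [add_sub_cancel_left, abs_of_nonneg (by linarith [(hj j).1])]
        linarith [(hj j).1, (hj j).2]
    · refine hmassB _ ?_ ?_ <;>
      · rw [sub_sub_cancel_left, abs_neg, abs_of_nonneg (by linarith [(hj j).1])]
        linarith [(hj j).1, (hj j).2]
  have hdis : ∀ l l', l ≠ l' → Disjoint (A l) (A l') := by
    intro l l' hne
    refine Metric.closedBall_disjoint_closedBall ?_
    rw [Real.dist_eq, show xp - η * w / 2 + (l : ℝ) * (3 * ρ) - (xp - η * w / 2 + l' * (3 * ρ))
      = ((l : ℝ) - l') * (3 * ρ) by ring, abs_mul, abs_of_pos (show 0 < 3 * ρ by positivity)]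
    have h1 : (1 : ℝ) ≤ |(l : ℝ) - l'| := by
      have h2 : ((l : ℕ) : ℤ) - (l' : ℕ) ≠ 0 := by
        intro h; exact hne (Fin.ext (by omega))
      have h3 := Int.one_le_abs h2
      have h4 : ((1 : ℤ) : ℝ) ≤ (|((l : ℕ) : ℤ) - (l' : ℕ)| : ℤ) := by exact_mod_cast h3
      push_cast at h4
      exact h4
    have := mul_le_mul_of_nonneg_right h1 (show 0 ≤ 3 * ρ by positivity)
    linarith
  have : Nonempty (Fin m) := ⟨⟨0, hmpos⟩⟩
  have hwin := pi_not_windows_le (law f) (A := A) (B := B) (n := n) (T := T) (T' := k - s₁)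
    (fun l => measurableSet_closedBall)
    (fun j => by rcases j with j | j <;> exact measurableSet_closedBall) hdis hq0.le hmassA hmassB' hqΔ hp
  refine (measure_mono ?_).trans (hwin.trans (ENNReal.ofReal_le_ofReal ?_))
  · rintro X ⟨⟨hS, hU⟩, hnot⟩ ⟨⟨l, hl⟩, hout⟩
    refine hnot (hS.sharpAt_of_windows hM hR hxp (m := ε * k) (t := w ^ 2 * k / 300) (d := d) (r := r)
      (c := xp - η * w / 2 + l * (3 * ρ)) (s := s₁) (N := N) hU (by positivity) ?_ hd0 hdρ ?_ ?_ hD ?_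
      hr0.le hrρ (hcen l) hl hN1 fun j => ⟨hout (Sum.inl j), hout (Sum.inr j)⟩)
    · have h1 : F * w ^ 2 < F * (300 * ε) := by
        have := mul_le_mul_of_nonneg_left (hf0.le.trans hfF) hε.le
        linarith
      have h2 := mul_lt_mul_of_pos_right (lt_of_mul_lt_mul_left h1 hF0.le) hk0
      linarith
    · refine le_of_eq ?_
      rw [show n * (F * d) = n * d * F by ring, hnd]; field_simp
    · rw [show n * (lam₀ * d) = n * d * lam₀ by ring, hnd,
        show ε * k / F * lam₀ = ε * lam₀ * k / F by ring, lt_div_iff₀ hF0]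
      linarith [mul_lt_mul_of_pos_right hwε hk0]
    · have h1 : n * (225 * Cu * b ^ 2 * w ^ 2 * d) = 225 * Cu * ε * (b ^ 2 / F) * (w ^ 2 * k) := by
        rw [show n * (225 * Cu * b ^ 2 * w ^ 2 * d) = n * d * (225 * Cu * b ^ 2 * w ^ 2) by ring, hnd]
        ring
      have h2 : b ^ 2 / F = 1 / Cl := by
        rw [← hR.b_sq]; have := hM.Cl_pos; field_simp
      have h3 : 225 * Cu * ε * (1 / Cl) ≤ 1 / 50 := by
        have := hM.Cl_pos
        rw [mul_one_div, div_le_iff₀ this]; linarith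
      rw [h1, h2]
      have := mul_le_mul_of_nonneg_right h3 (show 0 ≤ w ^ 2 * k by positivity)
      linarith
  · rw [Fintype.card_fin, Fintype.card_sum, Fintype.card_fin]
    have hb0 : 0 ≤ binTail n (q * (1 - Δ)) (k - s₁) := by
      refine binTail_nonneg (mul_nonneg hq0.le (by rw [hΔ]; linarith)) hqΔ _ _
    have h1 : ((N + N : ℕ) : ℝ) * binTail n (q * (1 - Δ)) (k - s₁)
        ≤ R * m * binTail n (q * (1 - Δ)) (k - s₁) := by
      push_cast
      exact mul_le_mul_of_nonneg_right hNm hb0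
    have h2 : (3 + 2 * R) * Real.exp (-(T * Δ ^ 2 / 500))
        ≤ (3 + 2 * R) * Real.exp (-(w ^ 4 * k / 1000)) := by
      refine mul_le_mul_of_nonneg_left (Real.exp_le_exp.2 ?_) (by positivity)
      have : 0 ≤ w ^ 4 * k := by positivity
      linarith
    linarith

/-! ### The error probability of the `p`-mode estimator -/

theorem UnifDev.mono {n : ℕ} {f : ℝ → ℝ} {X : Fin n → ℝ} {m t t' : ℝ} (hU : UnifDev f X m t)
    (h : t ≤ t') : UnifDev f X m t' :=
  fun a b ha hab hb hm => (hU a b ha hab hb hm).trans h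

/-- The number of pairs of grid points is at most quadratic in `n`. -/
theorem sampleLaw_not_unifDev_le_exp {f : ℝ → ℝ} {S : Set ℝ} {F m u y : ℝ} {n : ℕ}
    (hd : IsDensityOn f S) (hF : ∀ x, f x ≤ F) (hF0 : 0 < F) (hn : 0 < n) (hu : 3 ≤ u)
    (hum : u ≤ 2 * m) (hy : y * (4 * (m + 2)) ≤ (u - 3) ^ 2) :
    sampleLaw f n {X | ¬ UnifDev f X m u} ≤
      ENNReal.ofReal ((n * (3 * F + 4)) ^ 2 * (2 * Real.exp (-y))) := by
  have h := sampleLaw_not_unifDev_le (m := m) (t := u - 3) hd hF hF0 hn (by linarith) (by linarith)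
    (by linarith)
  rw [sub_add_cancel] at h
  refine h.trans (ENNReal.ofReal_le_ofReal ?_)
  have hn' : (1 : ℝ) ≤ n := by exact_mod_cast hn
  have h1 : (3 * (⌈n * F⌉₊ : ℝ) + 1) ≤ n * (3 * F + 4) := by
    have := (Nat.ceil_lt_add_one (show 0 ≤ n * F by positivity)).le
    linarith
  have h2 : y ≤ (u - 3) ^ 2 / (4 * (m + 2)) := (le_div_iff₀ (by linarith)).2 hy
  gcongr

section

variable {n k : ℕ} {f : ℝ → ℝ} {lam₀ rM Cl Cu F g w η b ρ ε xp δ L : ℝ} {Cα α : ℝ≥0}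

/-- The error probability of the `p`-mode estimator in terms of the scale `w` and `L = log (1 / δ)`.
If `L ≥ 100`, the counts are precise enough for the sample to be sharp; otherwise the error
probability is at most `exp (-100)`. -/
theorem sampleLaw_isPModeEstimate_le (hd : IsDensityOn f (Icc 0 1)) (hf : ModalStructure f)
    (hα : 0 < α) (hh : HolderOnWith Cα α f (Icc 0 1)) (hM : ModalConstants f lam₀ rM Cl Cu)
    (hF : ∀ x, f x ≤ F) (hR : Regime lam₀ rM Cl Cu F g Cα α n k w η b ρ) {p : ℕ}
    (hpl : p ≤ (modes f).ncard) (hxp : IsPMode f p xp) (hg : HasModeGap f p g)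
    (hk : 1 ≤ k) (hδ : δ = Real.exp (-L)) (hL : 69 / 100 ≤ L)
    (hw4 : w ^ 4 * k = L ^ 2 * Real.log n) (hβ : beta n k δ = 100 * w ^ 2)
    (hε : 0 < ε) (hε1 : ε ≤ 1 / 10 ^ 7) (hεC : 11250 * ε * Cu ≤ Cl)
    (hwε : F * w ^ 2 < 300 * (ε * lam₀)) (hD : 225 * Cu * b ^ 2 * w ^ 2 ≤ lam₀)
    (hkn : 330 * k ≤ n) (hn : 4000 ≤ Real.log n) (hkn' : 2000 * Real.log n ≤ k)
    (hnF : 3 * F + 4 ≤ n) (hnη : η * lam₀ ≤ n)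
    (hsmall : 4 * (3 * F + 4) ^ 2 / n +
      (3 + 2 * (156 * b * F / (ε * lam₀ * η))) * Real.exp (-(Real.log n / 3000)) ≤ Real.exp (-100)) :
    sampleLaw f n {X | ∃ xhat, IsPModeEstimate p k δ X xhat ∧ b * w ≤ |xhat - xp|}
      ≤ ENNReal.ofReal δ := by
  have hxpm : xp ∈ modes f := by
    obtain ⟨T, hT, hxT, -⟩ := hxp
    exact hT.1 hxT
  have hk0 : (0 : ℝ) < k := by exact_mod_cast hk
  have hkn1 : 330 * (k : ℝ) ≤ n := by exact_mod_cast hkn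
  have hn0 : (0 : ℝ) < n := by linarith
  have hnpos : 0 < n := by exact_mod_cast hn0
  have hw := hR.w_pos
  have hw2 := hR.w_le
  have hw20 : 0 < w ^ 2 := by positivity
  have hlam := hM.lam₀_pos
  have hF0 : 0 < F := (hlam.trans (hM.lam₀_lt hxpm)).trans_le (hF xp)
  set ℓ := Real.log n with hℓ
  have hexpℓ : Real.exp ℓ = n := Real.exp_log hn0
  set Q := w ^ 4 * k with hQ
  have hQℓ : 476 / 1000 * ℓ ≤ Q := by
    have : (69 / 100 : ℝ) ^ 2 ≤ L ^ 2 := pow_le_pow_left₀ (by norm_num) hL 2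
    rw [hw4]
    refine mul_le_mul_of_nonneg_right ?_ (by linarith)
    linarith
  set a := w ^ 2 * k with ha
  have haQ : a ^ 2 = Q * k := by rw [ha, hQ]; ring
  have ha6 : 10 ^ 6 ≤ a := by
    have h1 : Q = w ^ 2 * a := by rw [hQ, ha]; ring
    have h2 : 1000 * w ^ 2 * a ≤ 1 * a := mul_le_mul_of_nonneg_right hw2 (by positivity)
    linarith
  have hak : a ≤ k / 1000 := by
    have := mul_le_mul_of_nonneg_right hw2 hk0.le
    rw [ha]; linarith
  have hQk : 476 / 1000 * ℓ * k ≤ Q * k := mul_le_mul_of_nonneg_right hQℓ hk0.le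
  have hout := sampleLaw_exists_notMem hd measurableSet_Icc n
  have hreg : ∀ X : Fin n → ℝ, (∀ i, X i ∈ Icc (0 : ℝ) 1) → UnifDev f X (2 * k) (8 * a) →
      RegularSample f F X k (8 * w ^ 2) := fun X h1 h2 =>
    ⟨hd, hF, hk, by omega, h1, by rw [ha] at h2; convert h2 using 1; ring, by positivity,
      by linarith⟩
  have hcover : ∀ E : Set (Fin n → ℝ), {X : Fin n → ℝ | (∀ i, X i ∈ Icc (0 : ℝ) 1) ∧
      ¬ (RegularSample f F X k (8 * w ^ 2) ∧ SharpAt X k xp (η * w) (b * w))} ⊆ E →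
      sampleLaw f n {X | ∃ xhat, IsPModeEstimate p k δ X xhat ∧ b * w ≤ |xhat - xp|}
        ≤ sampleLaw f n E := by
    intro E hE
    calc _ ≤ sampleLaw f n ({X | ∃ i, X i ∉ Icc (0 : ℝ) 1} ∪ E) := by
          refine measure_mono fun X hX => ?_
          obtain ⟨xhat, h1, h2⟩ := hX
          by_cases hmem : ∀ i, X i ∈ Icc (0 : ℝ) 1
          · refine Or.inr (hE ⟨hmem, fun hgood => ?_⟩)
            exact absurd (hgood.1.abs_sub_lt_of_isPModeEstimate hM hR hf hα hh hβ hpl hxp hg hgood.2 h1)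
              (not_lt.2 h2)
          · push Not at hmem
            exact Or.inl hmem
      _ ≤ _ := (measure_union_le _ _).trans (by rw [hout, zero_add])
  rcases le_or_gt 100 L with hL100 | hL100
  · -- for very small `δ` the counts are precise enough
    have hU := sampleLaw_not_unifDev_le_exp (m := 2 * k) (u := a / 10) (y := L * ℓ / 10) hd hF hF0
      hnpos (by linarith) (by linarith) (by
        have h1 : (a / 11) ^ 2 ≤ (a / 10 - 3) ^ 2 :=
          pow_le_pow_left₀ (by positivity) (by linarith) 2
        refine le_trans ?_ h1
        rw [div_pow, haQ]
        have h2 : 100 * L * ℓ ≤ Q := by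
          rw [hw4, sq]
          have : 100 * L ≤ L * L := mul_le_mul_of_nonneg_right hL100 (by linarith)
          exact mul_le_mul_of_nonneg_right this (by linarith)
        have h3 : L * ℓ / 10 * (4 * (2 * k + 2)) ≤ L * ℓ / 10 * (81 / 10 * k) :=
          mul_le_mul_of_nonneg_left (by linarith) (by positivity)
        have h4 := mul_le_mul_of_nonneg_right h2 hk0.le
        have h5 : 0 ≤ L * ℓ * k := by positivity
        linarith)
    refine (hcover _ ?_).trans (hU.trans (ENNReal.ofReal_le_ofReal ?_))
    · rintro X ⟨h1, h2⟩ h3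
      have h4 := hreg X h1 (h3.mono (by linarith))
      refine h2 ⟨h4, h4.sharpAt_of_unifDev hM hR hxpm ?_⟩
      convert h3 using 1
      rw [ha]; ring
    · rw [hδ]
      calc (n * (3 * F + 4)) ^ 2 * (2 * Real.exp (-(L * ℓ / 10)))
          ≤ ((n : ℝ) * n) ^ 2 * (n * Real.exp (-(L * ℓ / 10))) := by
            have : (2 : ℝ) ≤ n := by linarith
            gcongr
        _ = Real.exp (5 * ℓ + -(L * ℓ / 10)) := by
            rw [Real.exp_add, show (5 : ℝ) * ℓ = (5 : ℕ) * ℓ by norm_num, Real.exp_nat_mul, hexpℓ]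
            ring
        _ ≤ Real.exp (-L) := by
            apply Real.exp_le_exp.2
            have h1 : 100 * ℓ ≤ L * ℓ := mul_le_mul_of_nonneg_right hL100 (by linarith)
            have h2 : L * 4000 ≤ L * ℓ := mul_le_mul_of_nonneg_left hn (by linarith)
            linarith
  · -- the bound for the three exceptional events tends to zero with `n`
    have hU1 := sampleLaw_not_unifDev_le_exp (m := 2 * k) (u := 8 * a) (y := 3 * ℓ) hd hF hF0
      hnpos (by linarith) (by linarith) (by
        have h1 : (79 / 10 * a) ^ 2 ≤ (8 * a - 3) ^ 2 :=
          pow_le_pow_left₀ (by positivity) (by linarith) 2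
        refine le_trans ?_ h1
        rw [mul_pow, haQ]
        have h3 : 3 * ℓ * (4 * (2 * k + 2)) ≤ 3 * ℓ * (81 / 10 * k) :=
          mul_le_mul_of_nonneg_left (by linarith) (by linarith)
        have h5 : 0 ≤ ℓ * k := mul_nonneg (by linarith) hk0.le
        linarith)
    have hU2 := sampleLaw_not_unifDev_le_exp (m := ε * k) (u := a / 300) (y := 3 * ℓ) hd hF hF0
      hnpos (by linarith) (by
        have h1 : F * w ^ 2 < F * (300 * ε) := by
          have := mul_le_mul_of_nonneg_left ((hM.lam₀_lt hxpm).le.trans (hF xp)) hε.le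
          linarith
        have h2 := mul_lt_mul_of_pos_right (lt_of_mul_lt_mul_left h1 hF0.le) hk0
        linarith) (by
        have h1 : (a / 310) ^ 2 ≤ (a / 300 - 3) ^ 2 :=
          pow_le_pow_left₀ (by positivity) (by linarith) 2
        refine le_trans ?_ h1
        rw [div_pow, haQ]
        have h2 : ε * k ≤ 1 / 10 ^ 7 * k := mul_le_mul_of_nonneg_right hε1 hk0.le
        have h3 : 3 * ℓ * (4 * (ε * k + 2)) ≤ 3 * ℓ * (8 * (1 / 10 ^ 7 * k)) :=
          mul_le_mul_of_nonneg_left (by linarith) (by linarith)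
        have h5 : 0 ≤ ℓ * k := mul_nonneg (by linarith) hk0.le
        linarith)
    have hρ0 : 1 / (n * lam₀) ≤ ρ := by
      rw [div_le_iff₀ (by positivity), hR.ρ_eq]
      exact_mod_cast hk
    have hw1 : w ≤ 1 := by
      by_contra! h
      have : 1 ≤ w ^ 2 := one_le_pow₀ h.le
      linarith
    have hS := sampleLaw_not_sharpAt_le hd hF hM hR hxpm hk hkn hε (hε1.trans (by norm_num)) hεC hwε hD
      (by linarith) (by linarith) (by
        have h1 : 0 < 1 / (n * lam₀) := by positivity
        calc η * w / (3 * ρ) ≤ η * 1 / (1 * (1 / (n * lam₀))) := by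
              have := hR.η_pos
              gcongr
              norm_num
          _ = η * lam₀ * n := by field_simp
          _ ≤ (n : ℝ) * n := by gcongr
          _ = Real.exp (ℓ + ℓ) := by rw [Real.exp_add, hexpℓ]
          _ ≤ _ := Real.exp_le_exp.2 (by linarith))
    refine (hcover ({X | ¬ UnifDev f X (2 * k) (8 * a)} ∪ {X | ¬ UnifDev f X (ε * k) (a / 300)} ∪
      {X | (RegularSample f F X k (8 * w ^ 2) ∧ UnifDev f X (ε * k) (w ^ 2 * k / 300)) ∧
        ¬ SharpAt X k xp (η * w) (b * w)}) ?_).trans ?_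
    · rintro X ⟨h1, h2⟩
      by_cases h3 : UnifDev f X (2 * k) (8 * a)
      · by_cases h4 : UnifDev f X (ε * k) (a / 300)
        · exact Or.inr ⟨⟨hreg X h1 h3, h4⟩, fun h5 => h2 ⟨hreg X h1 h3, h5⟩⟩
        · exact Or.inl (Or.inr h4)
      · exact Or.inl (Or.inl h3)
    · refine (measure_union_le _ _).trans ((add_le_add ((measure_union_le _ _).trans
        (add_le_add hU1 hU2)) hS).trans ?_)
      have hb := hR.b_pos
      have hη := hR.η_pos
      have hcard : (n * (3 * F + 4)) ^ 2 * (2 * Real.exp (-(3 * ℓ))) = 2 * (3 * F + 4) ^ 2 / n := by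
        rw [Real.exp_neg, show (3 : ℝ) * ℓ = (3 : ℕ) * ℓ by norm_num, Real.exp_nat_mul, hexpℓ]
        field_simp
      rw [hcard, ← ENNReal.ofReal_add (by positivity) (by positivity),
        ← ENNReal.ofReal_add (by positivity) (by positivity), hδ]
      refine ENNReal.ofReal_le_ofReal ?_
      have h1 : Real.exp (-(Q / 1000)) ≤ Real.exp (-(ℓ / 3000)) :=
        Real.exp_le_exp.2 (by linarith)
      have h2 : Real.exp (-100) ≤ Real.exp (-L) := Real.exp_le_exp.2 (by linarith)
      have h3 := mul_le_mul_of_nonneg_left h1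
        (show 0 ≤ 3 + 2 * (156 * b * F / (ε * lam₀ * η)) by positivity)
      have h4 : 2 * (3 * F + 4) ^ 2 / (n : ℝ) + 2 * (3 * F + 4) ^ 2 / n
          = 4 * (3 * F + 4) ^ 2 / n := by ring
      linarith

end

theorem exists_forall_of_eventually_nhdsGT {P : ℝ → Prop} (h : ∀ᶠ x in 𝓝[>] (0 : ℝ), P x) :
    ∃ c, 0 < c ∧ ∀ x, 0 < x → x < c → P x := by
  obtain ⟨c, hc, hsub⟩ := mem_nhdsGT_iff_exists_Ioo_subset.1 h
  exact ⟨c, hc, fun x h1 h2 => hsub ⟨h1, h2⟩⟩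

theorem eventually_mul_sq_lt (a : ℝ) {c : ℝ} (hc : 0 < c) : ∀ᶠ x in 𝓝[>] (0 : ℝ), a * x ^ 2 < c := by
  have : Tendsto (fun x : ℝ => a * x ^ 2) (𝓝 0) (𝓝 (a * 0 ^ 2)) := by
    apply Continuous.tendsto; fun_prop
  rw [show a * (0 : ℝ) ^ 2 = 0 by ring] at this
  exact eventually_nhdsWithin_of_eventually_nhds (this.eventually_lt_const hc)

/-- The scale `w` of the error, and what the two bounds on `k` say about it. -/
theorem exists_scale {n k : ℕ} {δ C₁ C₂ : ℝ} (hk : 1 ≤ k) (hδ : 0 < δ) (hδ2 : δ ≤ 1 / 2)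
    (hC₂ : 0 < C₂) (hC₂1 : C₂ ≤ 1)
    (h1 : C₁ * Real.log n * Real.log (1 / δ) ^ 2 ≤ k)
    (h2 : (k : ℝ) ≤ C₂ * Real.log (1 / δ) ^ (2 / 5 : ℝ) * Real.log n ^ (1 / 5 : ℝ) *
      (n : ℝ) ^ (4 / 5 : ℝ)) :
    ∃ w : ℝ, 0 < w ∧ 0 < Real.log n ∧ w ^ 4 * k = Real.log (1 / δ) ^ 2 * Real.log n ∧
      beta n k δ = 100 * w ^ 2 ∧ C₁ * w ^ 4 ≤ 1 ∧ k ≤ C₂ * w * n ∧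
      ∀ M, M * √(Real.log (1 / δ)) * Real.log n ^ (1 / 4 : ℝ) / (k : ℝ) ^ (1 / 4 : ℝ) = M * w := by
  set L := Real.log (1 / δ) with hL
  set ℓ := Real.log n with hℓ
  have hk0 : (1 : ℝ) ≤ k := by exact_mod_cast hk
  have hkpos : (0 : ℝ) < k := by linarith
  have hLpos : 0 < L := Real.log_pos (by rw [one_lt_div hδ]; linarith)
  have hℓ0 : 0 < ℓ := by
    refine (Real.log_natCast_nonneg n).lt_of_ne fun h => ?_
    have h : ℓ = 0 := h.symm
    rw [h, Real.zero_rpow (by norm_num), mul_zero, zero_mul] at h2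
    linarith
  have hn0 : (0 : ℝ) ≤ n := Nat.cast_nonneg n
  set w := √(L * √ℓ / √k) with hw
  have hw0 : 0 < w := Real.sqrt_pos.2 (by positivity)
  have hw2 : w ^ 2 = L * √ℓ / √k := Real.sq_sqrt (by positivity)
  have hw4 : w ^ 4 * k = L ^ 2 * ℓ := by
    rw [show w ^ 4 = (w ^ 2) ^ 2 by ring, hw2, div_pow, mul_pow, Real.sq_sqrt hℓ0.le,
      Real.sq_sqrt hkpos.le]
    field_simp
  refine ⟨w, hw0, hℓ0, hw4, ?_, ?_, ?_, fun M => ?_⟩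
  · rw [hw2, beta]; ring
  · have : C₁ * w ^ 4 * k ≤ 1 * k := by
      rw [mul_assoc, hw4]; linarith
    exact le_of_mul_le_mul_right this hkpos
  · have h3 := pow_le_pow_left₀ hkpos.le h2 5
    rw [mul_pow, mul_pow, mul_pow, ← Real.rpow_mul_natCast hLpos.le, ← Real.rpow_mul_natCast hℓ0.le,
      ← Real.rpow_mul_natCast hn0] at h3
    norm_num at h3
    have h4 : (k : ℝ) ^ 4 * k ≤ (C₂ * w * n) ^ 4 * k := by
      calc (k : ℝ) ^ 4 * k = k ^ 5 := by ring
        _ ≤ C₂ ^ 5 * L ^ 2 * ℓ * n ^ 4 := h3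
        _ = C₂ ^ 5 * (L ^ 2 * ℓ) * n ^ 4 := by ring
        _ = C₂ ^ 4 * C₂ * (w ^ 4 * k) * n ^ 4 := by rw [hw4]; ring
        _ ≤ C₂ ^ 4 * 1 * (w ^ 4 * k) * n ^ 4 := by gcongr
        _ = _ := by ring
    have h5 := le_of_mul_le_mul_right h4 hkpos
    exact le_of_pow_le_pow_left₀ (by norm_num) (by positivity) h5
  · have h4 : ∀ x : ℝ, 0 ≤ x → x ^ (1 / 4 : ℝ) = √√x := fun x hx => by
      rw [Real.sqrt_eq_rpow, Real.sqrt_eq_rpow, ← Real.rpow_mul hx]; norm_num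
    rw [h4 ℓ hℓ0.le, h4 k hkpos.le, hw, Real.sqrt_div (by positivity), Real.sqrt_mul hLpos.le]
    ring

/-- Recovery of the `p`-mode. The constant `C₁` is so large that the scale of the error is small,
and `C₂` is so small that the nearest-neighbour radii are small compared with this scale and that
`n` is large. -/
theorem exists_sampleLaw_isPModeEstimate_le (lam₀ rM Cl Cu F g : ℝ) (Cα α : ℝ≥0) (hg : 0 < g)
    (hα : 0 < α) :
    ∃ C₁ C₂ : ℝ, 0 < C₁ ∧ 0 < C₂ ∧
      ∀ (f : ℝ → ℝ), IsDensityOn f (Icc 0 1) → ModalStructure f →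
        HolderOnWith Cα α f (Icc 0 1) → ModalConstants f lam₀ rM Cl Cu →
        IsLUB (range f) F →
        ∀ (p : ℕ) (xp : ℝ), p ≤ (modes f).ncard → IsPMode f p xp → HasModeGap f p g →
          ∀ (n k : ℕ) (δ M : ℝ), 1 ≤ k → 0 < δ → δ ≤ 1 / 2 →
            C₁ * Real.log n * Real.log (1 / δ) ^ 2 ≤ k →
            (k : ℝ) ≤ C₂ * Real.log (1 / δ) ^ (2 / 5 : ℝ) * Real.log n ^ (1 / 5 : ℝ) *
              (n : ℝ) ^ (4 / 5 : ℝ) →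
            √(F / Cl) < M →
            sampleLaw f n
              {X | ∃ xhat, IsPModeEstimate p k δ X xhat ∧
                M * √(Real.log (1 / δ)) * Real.log n ^ (1 / 4 : ℝ) / (k : ℝ) ^ (1 / 4 : ℝ)
                  ≤ |xhat - xp|} ≤ ENNReal.ofReal δ := by
  -- otherwise no density has these parameters
  by_cases hpos : 0 < lam₀ ∧ 0 < rM ∧ 0 < Cl ∧ 0 < Cu ∧ 0 < F
  swap
  · refine ⟨1, 1, one_pos, one_pos, fun f hd hf hh hM hF p xp hpl hxp => ?_⟩
    obtain ⟨T, hT, hxT, -⟩ := hxp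
    exact absurd ⟨hM.lam₀_pos, hM.rM_pos, hM.Cl_pos, hM.Cu_pos,
      (hM.lam₀_pos.trans (hM.lam₀_lt (hT.1 hxT))).trans_le (hF.1 ⟨xp, rfl⟩)⟩ hpos
  obtain ⟨hlam, hrM, hCl, hCu, hF0⟩ := hpos
  set b := √(F / Cl) with hb
  have hb0 : 0 < b := Real.sqrt_pos.2 (by positivity)
  have hb2 : b ^ 2 = F / Cl := Real.sq_sqrt (by positivity)
  -- in a core of radius `η * w` the density is at least `f z * (1 - w ^ 2 / 2)`
  set η := min (√(lam₀ / (2 * Cu))) b with hη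
  have hη0 : 0 < η := lt_min (Real.sqrt_pos.2 (by positivity)) hb0
  have hη2 : 2 * Cu * η ^ 2 ≤ lam₀ := by
    have h1 : η ^ 2 ≤ lam₀ / (2 * Cu) := by
      rw [← Real.sq_sqrt (show 0 ≤ lam₀ / (2 * Cu) by positivity)]
      exact pow_le_pow_left₀ hη0.le (min_le_left _ _) 2
    rw [le_div_iff₀ (by positivity)] at h1
    linarith
  set ε := min (1 / 10 ^ 7) (Cl / (11250 * Cu)) with hε
  have hε0 : 0 < ε := lt_min (by norm_num) (by positivity)
  have hεC : 11250 * ε * Cu ≤ Cl := by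
    have h1 : ε ≤ Cl / (11250 * Cu) := min_le_right _ _
    rw [le_div_iff₀ (by positivity)] at h1
    linarith
  set R := 3 + 2 * (156 * b * F / (ε * lam₀ * η)) with hR
  -- small `w`
  obtain ⟨W, hW0, hW⟩ := exists_forall_of_eventually_nhdsGT
    ((eventually_mul_sq_lt 1000 one_pos).and ((eventually_mul_sq_lt (30 * F) hg).and
    ((eventually_mul_sq_lt (400 * F) hlam).and
    ((eventually_mul_sq_lt F (show 0 < 300 * (ε * lam₀) by positivity)).and
    ((eventually_mul_sq_lt (225 * Cu * b ^ 2) hlam).and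
      (eventually_mul_sq_lt ((28 * b) ^ 2) (show 0 < rM ^ 2 by positivity)))))))
  -- large `n`
  obtain ⟨n₀, hn₀⟩ : ∃ n₀ : ℕ, ∀ n : ℕ, n₀ ≤ n → 4000 ≤ Real.log n ∧ 3 * F + 4 ≤ n ∧
      η * lam₀ ≤ n ∧
      4 * (3 * F + 4) ^ 2 / n + R * Real.exp (-(Real.log n / 3000)) ≤ Real.exp (-100) := by
    have hcast : Tendsto (fun n : ℕ => (n : ℝ)) atTop atTop := tendsto_natCast_atTop_atTop
    have hlog : Tendsto (fun n : ℕ => Real.log n) atTop atTop := Real.tendsto_log_atTop.comp hcast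
    have h0 : Tendsto (fun n : ℕ => 4 * (3 * F + 4) ^ 2 / (n : ℝ) +
        R * Real.exp (-(Real.log n / 3000))) atTop (𝓝 (0 + R * 0)) := by
      refine (hcast.const_div_atTop _).add (Tendsto.const_mul _ ?_)
      exact Real.tendsto_exp_neg_atTop_nhds_zero.comp (hlog.atTop_div_const (by norm_num))
    rw [mul_zero, add_zero] at h0
    exact eventually_atTop.1 ((hlog.eventually_ge_atTop 4000).and
      ((hcast.eventually_ge_atTop _).and ((hcast.eventually_ge_atTop _).and
        (h0.eventually_le_const (Real.exp_pos _)))))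
  -- small radii
  obtain ⟨ρ₀, hρ₀, hρ⟩ := exists_forall_of_eventually_nhdsGT
    (P := fun ρ => Cα * (2 * ρ) ^ (α : ℝ) ≤ lam₀ / 8) (by
      have hα' : (0 : ℝ) < α := hα
      have h0 : Tendsto (fun ρ : ℝ => (Cα : ℝ) * (2 * ρ) ^ (α : ℝ)) (𝓝 0)
          (𝓝 (Cα * (2 * 0) ^ (α : ℝ))) := by
        refine Tendsto.const_mul _ (Tendsto.rpow_const ?_ (Or.inr hα'.le))
        exact tendsto_const_nhds.mul tendsto_id
      rw [mul_zero, Real.zero_rpow hα'.ne', mul_zero] at h0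
      exact eventually_nhdsWithin_of_eventually_nhds
        (h0.eventually_le_const (show 0 < lam₀ / 8 by positivity)))
  have hlt : ∀ c : ℝ, 0 < c → ∀ᶠ x in 𝓝[>] (0 : ℝ), x < c := fun c hc =>
    eventually_nhdsWithin_of_eventually_nhds (eventually_lt_nhds hc)
  obtain ⟨κ, hκ0, hκη, hκb, hκlam, hκρ, hκ330, hκn⟩ : ∃ κ : ℝ, 0 < κ ∧ κ < η * lam₀ / 20 ∧
      κ < b * lam₀ / 100 ∧ κ < lam₀ / 2 ∧ κ < ρ₀ * lam₀ ∧ κ < 1 / 330 ∧ κ < 1 / (n₀ + 1) := by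
    have h := (hlt (η * lam₀ / 20) (by positivity)).and ((hlt (b * lam₀ / 100) (by positivity)).and
      ((hlt (lam₀ / 2) (by positivity)).and ((hlt (ρ₀ * lam₀) (by positivity)).and
      ((hlt (1 / 330) (by norm_num)).and (hlt (1 / ((n₀ : ℝ) + 1)) (by positivity))))))
    obtain ⟨κ, hκ, hκ0⟩ := (h.and self_mem_nhdsWithin).exists
    exact ⟨κ, hκ0, hκ⟩
  refine ⟨1 / W ^ 4 + 5000, κ, by positivity, hκ0, ?_⟩
  intro f hd hf hh hM hF p xp hpl hxp hgap n k δ M hk hδ hδ2 h1 h2 hbM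
  obtain ⟨w, hw0, hℓ0, hw4, hβ, hC₁, hkw, hthr⟩ := exists_scale hk hδ hδ2 hκ0 (by linarith) h1 h2
  have hk0 : (1 : ℝ) ≤ k := by exact_mod_cast hk
  have hwW : w < W := by
    refine lt_of_pow_lt_pow_left₀ 4 hW0.le ?_
    have h3 : 1 / W ^ 4 * w ^ 4 < 1 := by
      have : 0 < w ^ 4 := by positivity
      linarith
    rwa [one_div, inv_mul_lt_iff₀ (by positivity), mul_one] at h3
  obtain ⟨w1, w2, w3, w4, w5, w6⟩ := hW w hw0 hwW
  have hw1 : w ≤ 1 := by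
    by_contra! h
    have : 1 ≤ w ^ 2 := one_le_pow₀ h.le
    linarith
  have hn0 : (0 : ℝ) ≤ n := Nat.cast_nonneg n
  have hkκ : (k : ℝ) ≤ κ * n := by
    refine hkw.trans (mul_le_mul_of_nonneg_right ?_ hn0)
    exact mul_le_of_le_one_right hκ0.le hw1
  have hnpos : (0 : ℝ) < n := by
    by_contra! h
    have := mul_nonpos_of_nonneg_of_nonpos hκ0.le h
    linarith
  have hnn₀ : n₀ ≤ n := by
    have h3 : κ * n ≤ 1 / (n₀ + 1) * n := mul_le_mul_of_nonneg_right hκn.le hn0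
    have h4 : 1 ≤ 1 / ((n₀ : ℝ) + 1) * n := by linarith
    rw [one_div, ← div_eq_inv_mul, one_le_div (by positivity)] at h4
    have h5 : (n₀ : ℝ) ≤ n := by linarith
    exact_mod_cast h5
  obtain ⟨n1, n2, n3, n4⟩ := hn₀ n hnn₀
  have hL : 69 / 100 ≤ Real.log (1 / δ) := by
    have h3 : Real.log 2 ≤ Real.log (1 / δ) :=
      Real.log_le_log (by norm_num) (by rw [le_div_iff₀ hδ]; linarith)
    linarith [Real.log_two_gt_d9]
  have hFle : ∀ x, f x ≤ F := fun x => hF.1 ⟨x, rfl⟩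
  have hρle : (k : ℝ) / (n * lam₀) ≤ κ * w / lam₀ := by
    rw [div_le_div_iff₀ (by positivity) hlam]
    calc (k : ℝ) * lam₀ ≤ κ * w * n * lam₀ := by gcongr
      _ = κ * w * (n * lam₀) := by ring
  have hκw : κ * w ≤ κ := mul_le_of_le_one_right hκ0.le hw1
  have hreg : Regime lam₀ rM Cl Cu F g Cα α n k w η b (k / (n * lam₀)) := by
    refine ⟨hw0, hη0, hb0, ?_, ?_, w1.le, ?_, ?_, ?_, hη2, min_le_right _ _, ?_, w2, w3, ?_⟩
    · rw [hb2]; field_simp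
    · field_simp
    · have h3 : 20 * (κ * w / lam₀) ≤ η * w := by
        rw [mul_div_assoc', div_le_iff₀ hlam]
        have := mul_le_mul_of_nonneg_right hκη.le hw0.le
        linarith
      linarith
    · have h3 : 100 * (κ * w / lam₀) ≤ b * w := by
        rw [mul_div_assoc', div_le_iff₀ hlam]
        have := mul_le_mul_of_nonneg_right hκb.le hw0.le
        linarith
      linarith
    · refine hρle.trans ?_
      rw [div_le_iff₀ hlam]; linarith
    · refine le_of_pow_le_pow_left₀ (n := 2) (by norm_num) hrM.le ?_
      calc (28 * (b * w)) ^ 2 = (28 * b) ^ 2 * w ^ 2 := by ring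
        _ ≤ rM ^ 2 := w6.le
    · refine hρ _ (by positivity) (hρle.trans_lt ?_)
      rw [div_lt_iff₀ hlam]; linarith
  have key := sampleLaw_isPModeEstimate_le (L := Real.log (1 / δ)) hd hf hα hh hM hFle hreg hpl hxp hgap
    hk (by rw [one_div, Real.log_inv, neg_neg, Real.exp_log hδ]) hL hw4 hβ hε0 (min_le_left _ _) hεC w4
    w5.le (by
      have h3 : (330 * k : ℝ) ≤ n := by
        have : κ * n ≤ 1 / 330 * n := mul_le_mul_of_nonneg_right hκ330.le hn0
        linarith
      exact_mod_cast h3) n1 (by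
      refine le_trans ?_ h1
      have h3 : (69 / 100 : ℝ) ^ 2 ≤ Real.log (1 / δ) ^ 2 := pow_le_pow_left₀ (by norm_num) hL 2
      have h4 : 5000 * Real.log n ≤ (1 / W ^ 4 + 5000) * Real.log n :=
        mul_le_mul_of_nonneg_right (le_add_of_nonneg_left (by positivity)) hℓ0.le
      calc 2000 * Real.log n ≤ 5000 * Real.log n * (69 / 100) ^ 2 := by linarith
        _ ≤ _ := mul_le_mul h4 h3 (by positivity) (by positivity)) n2 n3 n4
  refine (measure_mono fun X hX => ?_).trans key
  obtain ⟨xhat, h3, h4⟩ := hX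
  rw [hthr] at h4
  exact ⟨xhat, h3, (mul_le_mul_of_nonneg_right hbM.le hw0.le).trans h4⟩

end ModeEst

theorem mainTheorem3 :
    -- every density on `[0, 1]` with modal structure and Hölder continuity has modal constants
    (∀ (f : ℝ → ℝ) (Cα α : ℝ≥0), 0 < α → α ≤ 1 →
      ModeEst.IsDensityOn f (Set.Icc 0 1) → ModeEst.ModalStructure f →
      HolderOnWith Cα α f (Set.Icc 0 1) →
      ∃ lam₀ rM Cl Cu : ℝ, ModeEst.ModalConstants f lam₀ rM Cl Cu) ∧
    -- recovery of the `p`-mode, with `C₁` and `C₂` depending only on the listed parameters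
    (∀ (lam₀ rM Cl Cu F g : ℝ) (Cα α : ℝ≥0), 0 < g → 0 < α → α ≤ 1 →
      ∃ C₁ C₂ : ℝ, 0 < C₁ ∧ 0 < C₂ ∧
        ∀ (f : ℝ → ℝ), ModeEst.IsDensityOn f (Set.Icc 0 1) → ModeEst.ModalStructure f →
          HolderOnWith Cα α f (Set.Icc 0 1) → ModeEst.ModalConstants f lam₀ rM Cl Cu →
          IsLUB (Set.range f) F →
          ∀ (p : ℕ) (xp : ℝ), 1 ≤ p → p ≤ (ModeEst.modes f).ncard →
            ModeEst.IsPMode f p xp → ModeEst.HasModeGap f p g →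
            ∀ (n k : ℕ) (δ M : ℝ), 1 ≤ k → 0 < δ → δ ≤ 1 / 2 →
              C₁ * Real.log n * Real.log (1 / δ) ^ 2 ≤ k →
              (k : ℝ) ≤ C₂ * Real.log (1 / δ) ^ (2 / 5 : ℝ) * Real.log n ^ (1 / 5 : ℝ) *
                (n : ℝ) ^ (4 / 5 : ℝ) →
              √(F / Cl) < M →
              ModeEst.sampleLaw f n
                {X | ∃ xhat, ModeEst.IsPModeEstimate p k δ X xhat ∧
                  M * √(Real.log (1 / δ)) * Real.log n ^ (1 / 4 : ℝ) / (k : ℝ) ^ (1 / 4 : ℝ)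
                    ≤ |xhat - xp|} ≤ ENNReal.ofReal δ) ∧
    -- the rate for the mode of a unimodal density in dimension `D`, with `k = n ^ (4 / (4 + D))`
    (∀ (D : ℕ), 1 ≤ D →
      ∀ (f : EuclideanSpace ℝ (Fin D) → ℝ) (S : Set (EuclideanSpace ℝ (Fin D)))
        (x₀ : EuclideanSpace ℝ (Fin D)) (Cα α : ℝ≥0), 0 < α → α ≤ 1 →
        (IsCompact S ∨ S = Set.univ) → ModeEst.IsDensityOn f S → ModeEst.ModalStructure f →
        HolderOnWith Cα α f S → ModeEst.modes f = {x₀} →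
        ∀ δ₀ : ℝ, δ₀ < 1 → ∃ N : ℕ, ∀ n : ℕ, N ≤ n → ∀ δ : ℝ, 0 < δ → δ ≤ δ₀ →
          (IsCompact S ∨ Real.log n * Real.log (1 / δ) ≤ (n : ℝ) ^ (4 / (4 + D) : ℝ)) →
          ModeEst.sampleLaw f n
            {X | ∃ xhat, ModeEst.IsModeEstimate ⌈(n : ℝ) ^ (4 / (4 + D) : ℝ)⌉₊ X xhat ∧
              √(Real.log (1 / δ)) * Real.log n / (n : ℝ) ^ (1 / (4 + D) : ℝ)
                ≤ ‖xhat - x₀‖} ≤ ENNReal.ofReal δ) := by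
  refine ⟨fun f Cα α hα _ hd hf hh => ModeEst.exists_modalConstants hα hd hf hh,
    fun lam₀ rM Cl Cu F g Cα α hg hα _ => ?_,
    fun D hD f S x₀ Cα α hα _ hS hd hf hh hm δ₀ hδ₀ =>
      ModeEst.exists_sampleLaw_modeEstimate_le hD hα hS hd hf hh hm hδ₀⟩
  obtain ⟨C₁, C₂, hC₁, hC₂, h⟩ :=
    ModeEst.exists_sampleLaw_isPModeEstimate_le lam₀ rM Cl Cu F g Cα α hg hα
  exact ⟨C₁, C₂, hC₁, hC₂, fun f hd hf hh hM hF p xp _ => h f hd hf hh hM hF p xp⟩
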